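/- Call $D \in \mathbb{Z}[i]$ a fundamental discriminant if it is the discriminant of a $\mathbb{Z}[i]$-basis of the ring of integers of a quadratic extension $L/\mathbb{Q}(i)$ (so $L = \mathbb{Q}(i)(\sqrt{D})$ and $(D)$ is the relative discriminant of $L$). Let $\chi_D = (\frac{D}{\cdot})$ be the associated primitive quadratic character on nonzero $n \in \mathbb{Z}[i]$: $\chi_D$ is completely multiplicative, equal to $1$ at units, and $\chi_D(\pi) = 0, 1, -1$ at a prime $\pi$ according as $\pi$ ramifies, splits or is inert in $\mathbb{Q}(i)(\sqrt{D})$. Put $\mathrm{N}(n) = |n|^2$, and let $L(s, \chi_D)$ be the entire continuation of $\sum_{0 \neq n \in \mathbb{Z}[i]} \chi_D(n) \mathrm{N}(n)^{-s}$ from $\Re(s) > 1$. A pair $(\alpha, \beta)$ in $\{0 \leq \beta \leq \frac12 \leq \alpha \leq 1\} \cup \{(0, \frac12), (1, 0)\}$ is called a quadratic exponent pair over $\mathbb{Q}(i)$ if for every $\epsilon > 0$, uniformly in all fundamental discriminants $D$ and all real $x \geq 1$, $$\sum_{x < \mathrm{N}(n) \leq 2x} \chi_D(n) \ll_\epsilon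 x^\alpha \, \mathrm{N}(D)^{\beta + \epsilon}.$$ **Proposition.** Let $\vartheta \in [0, \frac14)$ and $\vartheta' \geq 0$ be such that for every $\epsilon > 0$, uniformly in all fundamental discriminants $D$ and all $t \in \mathbb{R}$, $$L\left(\tfrac12 + it, \chi_D\right) \ll_\epsilon \mathrm{N}(D)^{\vartheta + \epsilon} (1 + |t|)^{\vartheta' + \epsilon}.$$ Then $$(\alpha, \beta) = \left(1 - \frac{1}{2(1 + \vartheta')}, \ \frac{\vartheta}{1 + \vartheta'}\right)$$ is a quadratic exponent pair over $\mathbb{Q}(i)$. Moreover, with these $\alpha, \beta$, for every $\epsilon > 0$, uniformly in all fundamental discriminants $D$ and all real $x \geq 1$, $$\sum_{0 < \mathrm{N}(n) \leq x} \chi_D(n) \ll_\epsilon x^\alpha \, \mathrm{N}(D)^{\beta + \epsilon}.$$ -/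

import Mathlib

namespace GaussianQuadratic

/-- The finite set of Gaussian integers of norm at most `x`. -/
theorem finite_norm_le (x : ℝ) : {n : GaussianInt | ((n.norm : ℤ) : ℝ) ≤ x}.Finite := by
  have hb : ∀ a b M : ℤ, a * a + b * b ≤ M → a ∈ Set.Icc (-M) M := by
    intro a b M h
    constructor <;> nlinarith [mul_self_nonneg b, mul_self_nonneg (a - 1), mul_self_nonneg (a + 1),
      mul_self_nonneg a, Int.le_self_sq a, Int.le_self_sq (-a)]
  refine Set.Finite.of_finite_image (f := fun n : GaussianInt => (n.re, n.im)) ?_ ?_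
  · refine ((Set.finite_Icc (-⌊x⌋) ⌊x⌋).prod (Set.finite_Icc (-⌊x⌋) ⌊x⌋)).subset ?_
    rintro _ ⟨n, hn, rfl⟩
    have h1 : n.norm ≤ ⌊x⌋ := Int.le_floor.mpr hn
    have h2 : n.re * n.re + n.im * n.im ≤ ⌊x⌋ := by
      rw [Zsqrtd.norm_def] at h1; linarith
    exact ⟨hb _ _ _ h2, hb n.im n.re _ (by linarith)⟩
  · intro a _ b _ h
    simp only [Prod.mk.injEq] at h
    exact Zsqrtd.ext h.1 h.2

/-- The finite set of Gaussian integers `n` with `N(n) ≤ x`. -/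
noncomputable def normLE (x : ℝ) : Finset GaussianInt :=
  (finite_norm_le x).toFinset

/-- The finite set of Gaussian integers `n` with `x < N(n) ≤ y`. -/
noncomputable def normIoc (x y : ℝ) : Finset GaussianInt :=
  (normLE y).filter fun n => x < ((n.norm : ℤ) : ℝ)

/-- `D` generates the discriminant of a quadratic extension `L` of `ℚ(i)`: it is the discriminant
of a `ℤ[i]`-basis of the ring of integers of `L`. Changing the basis multiplies `D` by the square
of a unit, so that `L = ℚ(i)(√D)`, and the discriminant ideal of `L / ℚ(i)` is `(D)`. -/
def IsFundamentalDiscriminant (D : GaussianInt) : Prop :=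
  ∃ (L : Type) (_ : Field L) (_ : Algebra (FractionRing GaussianInt) L)
    (_ : Algebra GaussianInt L) (_ : IsScalarTower GaussianInt (FractionRing GaussianInt) L)
    (b : Module.Basis (Fin 2) GaussianInt (integralClosure GaussianInt L)),
    Module.finrank (FractionRing GaussianInt) L = 2 ∧ Algebra.discr GaussianInt b = D

open Classical in
/-- The symbol `(D / π)` at a prime `π` of `ℤ[i]`: the quadratic residue symbol if `π` is odd, and
the Kronecker symbol if `π` is an associate of `1 + i` (for a discriminant `D`, it is `0`, `1` or
`-1` according as `π` is ramified, split or inert in `ℚ(i)(√D)`). -/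
noncomputable def primeSymbol (D π : GaussianInt) : ℤ :=
  if π ∣ D then 0
  else if π ∣ 2 then (if ∃ x : GaussianInt, 4 * π ∣ x ^ 2 - D then 1 else -1)
  else (if ∃ x : GaussianInt, π ∣ x ^ 2 - D then 1 else -1)

open Classical in
/-- The quadratic character `χ_D(n) = (D / n)`, extended completely multiplicatively from the
primes. It depends only on the ideal generated by `n`. -/
noncomputable def quadChar (D n : GaussianInt) : ℤ :=
  if n = 0 then 0 else ((UniqueFactorizationMonoid.factors n).map (primeSymbol D)).prod

/-- The Dirichlet series `∑_{0 ≠ n ∈ ℤ[i]} χ_D(n) N(n)^{-s}` (for `Re s > 1`); the term at `n = 0`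
vanishes since `χ_D(0) = 0`. -/
noncomputable def quadLSeries (D : GaussianInt) (s : ℂ) : ℂ :=
  ∑' n : GaussianInt, ((quadChar D n : ℤ) : ℂ) / ((n.norm : ℤ) : ℂ) ^ s

open Classical in
/-- The quadratic Dirichlet `L`-function `L(s, χ_D)`: the entire continuation of the Dirichlet
series. By the identity theorem there is at most one such continuation. -/
noncomputable def quadLFunction (D : GaussianInt) : ℂ → ℂ :=
  if h : ∃ F : ℂ → ℂ, Differentiable ℂ F ∧ ∀ s : ℂ, 1 < s.re → F s = quadLSeries D s
  then h.choose else quadLSeries D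

/-- The hybrid bound `L(1/2 + it, χ_D) ≪_ε N(D)^{ϑ + ε} (1 + |t|)^{ϑ' + ε}`, uniformly in the
fundamental discriminant `D` and in `t`. -/
def HybridSubconvexBound (ϑ ϑ' : ℝ) : Prop :=
  ∀ ε : ℝ, 0 < ε → ∃ C : ℝ, 0 < C ∧
    ∀ D : GaussianInt, IsFundamentalDiscriminant D → ∀ t : ℝ,
      ‖quadLFunction D (1 / 2 + t * Complex.I)‖ ≤
        C * ((D.norm : ℤ) : ℝ) ^ (ϑ + ε) * (1 + |t|) ^ (ϑ' + ε)

/-- `(α, β)` is a quadratic exponent pair over `ℚ(i)` (for intervals `(x, 2x]`). -/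
def IsQuadraticExponentPair (α β : ℝ) : Prop :=
  ((0 ≤ β ∧ β ≤ 1 / 2 ∧ 1 / 2 ≤ α ∧ α ≤ 1) ∨ (α = 0 ∧ β = 1 / 2) ∨ (α = 1 ∧ β = 0)) ∧
  ∀ ε : ℝ, 0 < ε → ∃ C : ℝ, 0 < C ∧
    ∀ D : GaussianInt, IsFundamentalDiscriminant D → ∀ x : ℝ, 1 ≤ x →
      |∑ n ∈ normIoc x (2 * x), ((quadChar D n : ℤ) : ℝ)| ≤
        C * x ^ α * ((D.norm : ℤ) : ℝ) ^ (β + ε)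

end GaussianQuadratic

/-! Write S(x) for the sum of χ_D(n) over N(n) ≤ x, and N for N(D). Summation by parts gives L(s,
χ_D) = s ∫ S(x) x^(-s-1) dx, so on the critical line L(s)/s is the Fourier transform of e^(w/2)
S(e^(-w)). Averaging this function against a Gaussian of width about 1/Y in w cuts the frequencies
off near Y, and the hybrid bound makes the averaged sum O(√x N^(ϑ+ε) Y^(ϑ'+ε)); see
`norm_integral_gaussian_mul_le` and `exists_integral_gaussian_cutoff_le`. Undoing the average costs
the number of lattice points in thin annuli, which is O(x/Y + √x) because the error in the circle
problem stays below √x (`exists_abs_charSum_sub_mollified_le`). Balancing x/Y against √x N^ϑ Y^ϑ'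
makes both equal to x^α N^β. When the balancing Y is below 1, the trivial bound S(x) ≪ x is already
good enough.

No contour is shifted. The Fourier formula on Re s = 1/2 is legitimate once S(x) ≪_D x^θ with θ <
1/2, and polynomial dependence on D in such a bound also settles the range x ≥ N^64, after which Y^ε
is absorbed into a power of N. The unconditional bound N^2 x^(15/32) of `exists_abs_sum_quadChar_le`
has two sources. Arithmetic: χ_D is periodic modulo 8 N and has sum zero over the residues
(`IsFundamentalDiscriminant.quadChar_add`, `IsFundamentalDiscriminant.sum_residueChar`). Periodicity
is quadratic reciprocity in ℤ[i], deduced from rational Jacobi symbols. The sum vanishes because D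
is not a square, so χ_D takes the value -1 at some invertible residue. Geometry: a shifted disc of
radius R ≥ 1 contains πR² + O(R^(15/16)) lattice points, uniformly in the shift
(`exists_lattice_disc_bound`). This is Poisson summation with Gaussian smoothing, together with the
bound O(√R) for the Fourier transform of the disc.

Since `quadLFunction` is a chosen continuation, existence has to be proved: it is the Mellin
transform of a theta function divided by Γ (`IsFundamentalDiscriminant.exists_continuation`). The
identity theorem then gives the summation by parts formula for Re s > 15/32
(`IsFundamentalDiscriminant.quadLFunction_eq_mellin`). -/

namespace GaussianQuadratic

/-! ### Discriminants of quadratic algebras over ℤ[i] -/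

/-- Stickelberger's congruence for a basis of a quadratic algebra over `ℤ[i]`, and the fact that the
discriminant is not a square if the algebra is a domain. -/
theorem discr_basis_fin_two {S : Type*} [CommRing S] [IsDomain S] [Algebra GaussianInt S]
    (b : Module.Basis (Fin 2) GaussianInt S) :
    (∃ t c : GaussianInt, Algebra.discr GaussianInt b = t ^ 2 - 4 * c) ∧
      ¬ IsSquare (Algebra.discr GaussianInt b) := by
  set M := Algebra.leftMulMatrix b
  set A := M (b 0) with hA
  set B := M (b 1) with hB
  have hcomm : A * B = B * A := by rw [hA, hB, ← map_mul, mul_comm, map_mul]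
  have e00 := congrFun (congrFun hcomm 0) 0
  have e01 := congrFun (congrFun hcomm 0) 1
  have e10 := congrFun (congrFun hcomm 1) 0
  simp only [Matrix.mul_apply, Fin.sum_univ_two] at e00 e01 e10
  have hD : Algebra.discr GaussianInt b =
      (A * A).trace * (B * B).trace - (A * B).trace * (A * B).trace := by
    rw [Algebra.discr_def, Matrix.det_fin_two]
    simp only [Algebra.traceMatrix_apply, Algebra.traceForm_apply,
      Algebra.trace_eq_matrix_trace b, hA, hB, ← map_mul, mul_comm (b 1) (b 0), M]
  have hy2 : (B.trace • A - A.trace • B) * (B.trace • A - A.trace • B) =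
      Algebra.discr GaussianInt b • (1 : Matrix (Fin 2) (Fin 2) GaussianInt) := by
    rw [hD]
    ext i j : 1
    fin_cases i <;> fin_cases j <;>
    simp only [Matrix.trace_fin_two, Matrix.mul_apply, Fin.sum_univ_two, Matrix.sub_apply,
      Matrix.smul_apply, smul_eq_mul, Matrix.one_apply, Fin.zero_eta, Fin.mk_one, Fin.isValue,
      one_ne_zero, zero_ne_one, if_true, if_false, mul_one, mul_zero] <;>
    grind
  constructor
  -- With conjugates a, a' and b, b' of the basis, the discriminant is (ab' - a'b)² = (ab' + a'b)² -
  -- 4 aa'bb', and ab' + a'b = tr A tr B - tr AB.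
  · refine ⟨A.trace * B.trace - (A * B).trace, A.det * B.det, ?_⟩
    rw [hD]
    simp only [Matrix.trace_fin_two, Matrix.mul_apply, Fin.sum_univ_two, Matrix.det_fin_two]
    grind
  · rintro ⟨d, hd⟩
    -- The element y has trace zero and square the discriminant. If that is d², then y = ±d in the
    -- domain, so 2d = 0 and y = 0. Independence of the basis then kills the trace form,
    -- contradicting tr 1 = 2.
    set y : S := B.trace • b 0 - A.trace • b 1 with hy
    have hMy : M y = B.trace • A - A.trace • B := by
      rw [hy, map_sub, map_smul, map_smul]
    have hyy : y * y = algebraMap GaussianInt S d * algebraMap GaussianInt S d := by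
      apply Algebra.leftMulMatrix_injective b
      change M _ = M _
      rw [map_mul, hMy, hy2, hd, map_mul, AlgHom.commutes, ← map_mul, Algebra.algebraMap_eq_smul_one]
    have htr : Algebra.trace GaussianInt S y = 0 := by
      rw [hy, map_sub, map_smul, map_smul, Algebra.trace_eq_matrix_trace b,
        Algebra.trace_eq_matrix_trace b, smul_eq_mul, smul_eq_mul]
      exact sub_eq_zero.mpr (mul_comm _ _)
    have h2 : Algebra.trace GaussianInt S (algebraMap GaussianInt S d) = 2 * d := by
      rw [Algebra.trace_algebraMap_of_basis b]
      simp
    have hd0 : d = 0 := by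
      rcases mul_self_eq_mul_self_iff.mp hyy with h | h
      · rw [h, h2] at htr
        simpa using htr
      · rw [h, map_neg, h2] at htr
        simpa using htr
    rw [hd0, map_zero, mul_zero, mul_self_eq_zero, hy] at hyy
    have hli := Fintype.linearIndependent_iff.mp b.linearIndependent ![B.trace, -A.trace] (by
      rw [Fin.sum_univ_two, ← hyy]
      simp [sub_eq_add_neg])
    have hB0 : B.trace = 0 := by simpa using hli 0
    have hA0 : A.trace = 0 := by simpa using hli 1
    have htr0 : Algebra.trace GaussianInt S = 0 := by
      refine b.ext fun i => ?_
      fin_cases i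
      · simpa [Algebra.trace_eq_matrix_trace b] using hA0
      · simpa [Algebra.trace_eq_matrix_trace b] using hB0
    have h1 : Algebra.trace GaussianInt S (algebraMap GaussianInt S 1) = 2 := by
      rw [Algebra.trace_algebraMap_of_basis b]
      simp
    rw [htr0] at h1
    simp at h1

theorem IsFundamentalDiscriminant.eq_sq_sub {D : GaussianInt} (h : IsFundamentalDiscriminant D) :
    ∃ t c : GaussianInt, D = t ^ 2 - 4 * c := by
  obtain ⟨L, _, _, _, _, b, -, rfl⟩ := h
  exact (discr_basis_fin_two b).1

theorem IsFundamentalDiscriminant.not_isSquare {D : GaussianInt}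
    (h : IsFundamentalDiscriminant D) : ¬ IsSquare D := by
  obtain ⟨L, _, _, _, _, b, -, rfl⟩ := h
  exact (discr_basis_fin_two b).2

end GaussianQuadratic

namespace GaussianQuadratic

open UniqueFactorizationMonoid

/-! ### The quadratic symbol as a function of the modulus -/

theorem primeSymbol_eq_of_associated (D : GaussianInt) {π ρ : GaussianInt} (h : Associated π ρ) :
    primeSymbol D π = primeSymbol D ρ := by
  have h4 : Associated (4 * π) (4 * ρ) := h.mul_left 4
  classical
  unfold primeSymbol
  exact if_congr h.dvd_iff_dvd_left rfl (if_congr h.dvd_iff_dvd_left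
    (if_congr (exists_congr fun _ => h4.dvd_iff_dvd_left) rfl rfl)
    (if_congr (exists_congr fun _ => h.dvd_iff_dvd_left) rfl rfl))

theorem map_primeSymbol_prod_eq (D : GaussianInt) {s t : Multiset GaussianInt}
    (h : Multiset.Rel Associated s t) :
    (s.map (primeSymbol D)).prod = (t.map (primeSymbol D)).prod := by
  congr 1
  rw [← Multiset.rel_eq, Multiset.rel_map]
  exact h.mono fun _ _ _ _ hab => primeSymbol_eq_of_associated D hab

@[simp] theorem quadChar_zero (D : GaussianInt) : quadChar D 0 = 0 := by simp [quadChar]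

theorem quadChar_mul (D m n : GaussianInt) :
    quadChar D (m * n) = quadChar D m * quadChar D n := by
  rcases eq_or_ne m 0 with rfl | hm
  · simp
  rcases eq_or_ne n 0 with rfl | hn
  · simp
  rw [quadChar, quadChar, quadChar, if_neg hm, if_neg hn, if_neg (mul_ne_zero hm hn),
    map_primeSymbol_prod_eq D (factors_mul hm hn), Multiset.map_add, Multiset.prod_add]

theorem quadChar_of_isUnit (D : GaussianInt) {u : GaussianInt} (hu : IsUnit u) :
    quadChar D u = 1 := by
  have h0 : factors u = 0 := by
    have := (factors_rel_of_associated (associated_one_iff_isUnit.mpr hu))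
    rw [factors_one] at this
    exact Multiset.rel_zero_right.mp this
  rw [quadChar, if_neg hu.ne_zero, h0, Multiset.map_zero, Multiset.prod_zero]

theorem quadChar_eq_of_associated (D : GaussianInt) {m n : GaussianInt} (h : Associated m n) :
    quadChar D m = quadChar D n := by
  obtain ⟨u, rfl⟩ := h
  rw [quadChar_mul, quadChar_of_isUnit D u.isUnit, mul_one]

theorem quadChar_of_prime (D : GaussianInt) {π : GaussianInt} (hπ : Prime π) :
    quadChar D π = primeSymbol D π := by
  obtain ⟨u, hu, h⟩ := prime_factors_irreducible hπ.irreducible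
    ⟨fun _ => prime_of_factor _, factors_prod hπ.ne_zero⟩
  rw [quadChar, if_neg hπ.ne_zero, h, Multiset.map_singleton, Multiset.prod_singleton]
  exact primeSymbol_eq_of_associated D hu.symm

theorem primeSymbol_values (D π : GaussianInt) :
    primeSymbol D π = 0 ∨ primeSymbol D π = 1 ∨ primeSymbol D π = -1 := by
  unfold primeSymbol; split_ifs <;> simp

theorem abs_quadChar_le_one (D n : GaussianInt) : |quadChar D n| ≤ 1 := by
  induction n using induction_on_prime with
  | h₁ => simp
  | h₂ u hu => simp [quadChar_of_isUnit D hu]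
  | h₃ a p ha hp ih =>
    rw [quadChar_mul, quadChar_of_prime D hp, abs_mul]
    rcases primeSymbol_values D p with h | h | h <;> simp [h, ih]

/-! ### Odd and primary Gaussian integers -/

/-- A Gaussian integer prime to `1 + i`. -/
def IsOddGaussian (n : GaussianInt) : Prop := Odd (n.re + n.im)

/-- An odd Gaussian integer with odd real part and even imaginary part. -/
def IsPrimary (n : GaussianInt) : Prop := Odd n.re ∧ Even n.im

/-- Reduction modulo 1 + i is the ring homomorphism n ↦ re n + im n onto 𝔽₂. -/
theorem isOddGaussian_mul {m n : GaussianInt} :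
    IsOddGaussian (m * n) ↔ IsOddGaussian m ∧ IsOddGaussian n := by
  unfold IsOddGaussian
  rw [← Int.odd_mul, Zsqrtd.re_mul, Zsqrtd.im_mul]
  have : (m.re * n.re + -1 * m.im * n.im + (m.re * n.im + m.im * n.re)) =
    (m.re + m.im) * (n.re + n.im) - 2 * (m.im * n.im) := by ring
  rw [this]
  simp [parity_simps]

theorem IsPrimary.isOdd {n : GaussianInt} (h : IsPrimary n) : IsOddGaussian n := h.1.add_even h.2

theorem IsPrimary.mul {m n : GaussianInt} (hm : IsPrimary m) (hn : IsPrimary n) :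
    IsPrimary (m * n) := by
  obtain ⟨h1, h2⟩ := hm
  obtain ⟨h3, h4⟩ := hn
  constructor <;> simp [parity_simps, *]

theorem IsPrimary.of_mul {m n : GaussianInt} (hm : IsPrimary m) (hmn : IsPrimary (m * n)) :
    IsPrimary n := by
  obtain ⟨h1, h2⟩ := hm
  obtain ⟨h3, h4⟩ := hmn
  have h1' := Int.not_even_iff_odd.mpr h1
  simp [parity_simps, h1', h2] at h3 h4
  exact ⟨(Int.odd_mul.mp h3).2, h4⟩

theorem IsOddGaussian.exists_primary {n : GaussianInt} (h : IsOddGaussian n) :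
    ∃ m, Associated n m ∧ IsPrimary m := by
  rcases Int.even_or_odd n.im with h2 | h2
  · refine ⟨n, Associated.refl _, ?_, h2⟩
    rw [IsOddGaussian, Int.odd_add] at h
    exact h.mpr h2
  · refine ⟨n * ⟨0, 1⟩, ?_, ?_⟩
    · refine (associated_mul_unit_right n _ ?_)
      exact IsUnit.of_mul_eq_one (⟨0, -1⟩ : GaussianInt) (by ext <;> simp)
    · rw [IsOddGaussian, Int.odd_add'] at h
      have := h.mp h2
      constructor <;> simp [parity_simps, h2, this]

theorem norm_natAbs_mul (m n : GaussianInt) :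
    (m * n).norm.natAbs = m.norm.natAbs * n.norm.natAbs := by
  rw [Zsqrtd.norm_mul, Int.natAbs_mul]

theorem isUnit_iff_norm_natAbs {u : GaussianInt} : IsUnit u ↔ u.norm.natAbs = 1 :=
  Zsqrtd.norm_eq_one_iff.symm

theorem coe_norm_natAbs (n : GaussianInt) : ((n.norm.natAbs : ℕ) : ℤ) = n.re ^ 2 + n.im ^ 2 := by
  rw [GaussianInt.abs_natCast_norm, Zsqrtd.norm_def]; ring

theorem IsPrimary.eq_one_or_neg_one {u : GaussianInt} (h : IsPrimary u) (hu : IsUnit u) :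
    u = 1 ∨ u = -1 := by
  rw [isUnit_iff_norm_natAbs] at hu
  have h1 := coe_norm_natAbs u
  rw [hu] at h1
  obtain ⟨⟨a, ha⟩, ⟨b, hb⟩⟩ := h
  have hb0 : b = 0 := by
    by_contra hb0
    have : 1 ≤ b ^ 2 := by have := sq_pos_of_ne_zero hb0; omega
    rw [hb] at h1
    push_cast at h1
    nlinarith [sq_nonneg u.re]
  have him : u.im = 0 := by omega
  rw [him] at h1
  have : u.re = 1 ∨ u.re = -1 := by
    rw [← sq_eq_one_iff]
    simpa using h1.symm
  rcases this with h | h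
  · left; ext <;> simp [h, him]
  · right; ext <;> simp [h, him]

theorem IsPrimary.norm_mod_four {n : GaussianInt} (h : IsPrimary n) : n.norm.natAbs % 4 = 1 := by
  have h1 := coe_norm_natAbs n
  obtain ⟨⟨a, ha⟩, ⟨b, hb⟩⟩ := h
  have : ((n.norm.natAbs : ℕ) : ℤ) = 4 * (a ^ 2 + a + b ^ 2) + 1 := by rw [h1, ha, hb]; ring
  omega

theorem IsOddGaussian.norm_odd {n : GaussianInt} (h : IsOddGaussian n) : Odd n.norm.natAbs := by
  obtain ⟨m, ⟨u, rfl⟩, hm⟩ := h.exists_primary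
  have h1 := hm.norm_mod_four
  rw [norm_natAbs_mul, isUnit_iff_norm_natAbs.mp u.isUnit, mul_one] at h1
  rw [Nat.odd_iff]; omega

/-- Induction on primary Gaussian integers through their factorization. -/
theorem IsPrimary.induction {P : GaussianInt → Prop} (h1 : P 1) (hneg : P (-1))
    (hprime : ∀ π, Prime π → IsPrimary π → P π)
    (hmul : ∀ m n, IsPrimary m → IsPrimary n → P m → P n → P (m * n)) :
    ∀ n, IsPrimary n → P n := by
  intro n
  induction hk : n.norm.natAbs using Nat.strong_induction_on generalizing n with
  | _ k ih =>
  intro hn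
  by_cases hu : IsUnit n
  · rcases hn.eq_one_or_neg_one hu with rfl | rfl <;> assumption
  have hn0 : n ≠ 0 := by
    rintro rfl
    exact absurd hn.1 (by simp)
  obtain ⟨π, hπ, hd⟩ := WfDvdMonoid.exists_irreducible_factor hu hn0
  have hodd : IsOddGaussian π := by
    obtain ⟨c, rfl⟩ := hd
    exact (isOddGaussian_mul.mp hn.isOdd).1
  obtain ⟨ρ, hρ, hρp⟩ := hodd.exists_primary
  obtain ⟨c, rfl⟩ := hρ.dvd_iff_dvd_left.mp hd
  have hρ' : Prime ρ := hρ.prime hπ.prime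
  have hc := IsPrimary.of_mul hρp hn
  refine hmul _ _ hρp hc (hprime _ hρ' hρp) (ih _ ?_ c rfl hc)
  rw [← hk, norm_natAbs_mul]
  have h2 : ρ.norm.natAbs ≠ 1 := fun h => hρ'.not_isUnit (isUnit_iff_norm_natAbs.mpr h)
  have h3 : c.norm.natAbs ≠ 0 := by
    rw [Int.natAbs_ne_zero, Ne, GaussianInt.norm_eq_zero]
    rintro rfl
    simp at hn0
  have h4 : ρ.norm.natAbs ≠ 0 := by
    rw [Int.natAbs_ne_zero, Ne, GaussianInt.norm_eq_zero]
    exact hρ'.ne_zero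
  have h5 : 2 ≤ ρ.norm.natAbs := by omega
  nlinarith [Nat.pos_of_ne_zero h3]

/-! ### Residue symbols at odd primes -/

theorem IsOddGaussian.not_dvd_two {π : GaussianInt} (hπ : Prime π) (h : IsOddGaussian π) :
    ¬ π ∣ 2 := by
  rintro ⟨c, hc⟩
  have h1 := norm_natAbs_mul π c
  rw [← hc] at h1
  have h2 : (2 : GaussianInt).norm.natAbs = 2 ^ 2 := by simp [Zsqrtd.norm_def]
  rw [h2] at h1
  have h3 : π.norm.natAbs ∣ 2 ^ 2 := ⟨_, h1⟩
  have h4 : Nat.Coprime π.norm.natAbs (2 ^ 2) :=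
    (Nat.coprime_two_right.mpr h.norm_odd).pow_right 2
  exact hπ.not_isUnit (isUnit_iff_norm_natAbs.mpr (Nat.Coprime.eq_one_of_dvd h4 h3))

open Classical in
theorem IsOddGaussian.primeSymbol_eq {π : GaussianInt} (hπ : Prime π) (h : IsOddGaussian π)
    (m : GaussianInt) :
    primeSymbol m π = if π ∣ m then 0 else if ∃ x, π ∣ x ^ 2 - m then 1 else -1 := by
  rw [primeSymbol, if_neg (h.not_dvd_two hπ)]

theorem finite_quotient_span {π : GaussianInt} (hπ : π ≠ 0) :
    Finite (GaussianInt ⧸ Ideal.span {π}) := by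
  have := (finite_norm_le π.norm).to_subtype
  refine Finite.of_surjective (fun n : {n : GaussianInt | ((n.norm : ℤ) : ℝ) ≤ (π.norm : ℤ)} =>
    Ideal.Quotient.mk (Ideal.span {π}) n) fun y => ?_
  obtain ⟨x, rfl⟩ := Ideal.Quotient.mk_surjective y
  refine ⟨⟨x % π, ?_⟩, ?_⟩
  · have h1 : (x % π).norm ≤ π.norm := (GaussianInt.norm_mod_lt x hπ).le
    change (((x % π).norm : ℤ) : ℝ) ≤ ((π.norm : ℤ) : ℝ)
    exact_mod_cast h1
  · refine Ideal.Quotient.eq.mpr (Ideal.mem_span_singleton.mpr ⟨-(x / π), ?_⟩)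
    change x % π - x = _
    rw [GaussianInt.mod_def]; ring

/-- The quotient by π is a finite field, and the symbol is its quadratic character. -/
theorem primeSymbol_mul {π : GaussianInt} (hπ : Prime π) (h : IsOddGaussian π)
    (m n : GaussianInt) : primeSymbol (m * n) π = primeSymbol m π * primeSymbol n π := by
  classical
  have := finite_quotient_span hπ.ne_zero
  have hmax : (Ideal.span {π}).IsMaximal :=
    PrincipalIdealRing.isMaximal_of_irreducible hπ.irreducible
  let _ := Ideal.Quotient.field (Ideal.span {π})
  let _ := Fintype.ofFinite (GaussianInt ⧸ Ideal.span {π})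
  have key : ∀ m, primeSymbol m π = quadraticCharFun (GaussianInt ⧸ Ideal.span {π})
      (Ideal.Quotient.mk (Ideal.span {π}) m) := by
    intro m
    rw [h.primeSymbol_eq hπ, quadraticCharFun, Ideal.Quotient.eq_zero_iff_mem,
      Ideal.mem_span_singleton]
    congr 1
    refine if_congr ?_ rfl rfl
    constructor
    · rintro ⟨x, hx⟩
      refine ⟨Ideal.Quotient.mk _ x, ?_⟩
      rw [← map_mul, Ideal.Quotient.eq, Ideal.mem_span_singleton, ← dvd_neg]
      convert hx using 1; ring
    · rintro ⟨y, hy⟩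
      obtain ⟨x, rfl⟩ := Ideal.Quotient.mk_surjective y
      refine ⟨x, ?_⟩
      rw [← map_mul, Ideal.Quotient.eq, Ideal.mem_span_singleton, ← dvd_neg] at hy
      convert hy using 1; ring
  rw [key, key, key, map_mul, quadraticCharFun_mul]

theorem primeSymbol_congr {π : GaussianInt} (hπ : Prime π) (h : IsOddGaussian π)
    {m n : GaussianInt} (hmn : π ∣ m - n) : primeSymbol m π = primeSymbol n π := by
  classical
  rw [h.primeSymbol_eq hπ, h.primeSymbol_eq hπ, dvd_iff_dvd_of_dvd_sub hmn]
  congr 1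
  refine if_congr (exists_congr fun x => dvd_iff_dvd_of_dvd_sub ?_) rfl rfl
  rw [← dvd_neg]
  convert hmn using 1; ring

end GaussianQuadratic

namespace GaussianQuadratic

open NumberTheorySymbols

/-! ### Jacobi symbols and sums of two squares -/

/-- For N ≡ 1 mod 4 reciprocity carries no sign, and J(-1 | N) = 1 makes the sign of w irrelevant.
-/
theorem jacobiSym_eq_jacobiSym_natAbs {N : ℕ} (hN : N % 4 = 1) {w : ℤ} (hw : Odd w) :
    J(w | N) = J(N | w.natAbs) := by
  have hNo : Odd N := by rw [Nat.odd_iff]; omega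
  rw [← jacobiSym.quadratic_reciprocity_one_mod_four' (Int.natAbs_odd.mpr hw) hN]
  rcases Int.natAbs_eq w with h | h
  · rw [← h]
  · conv_lhs => rw [h]
    rw [jacobiSym.neg _ hNo, ZMod.χ₄_nat_one_mod_four hN, one_mul]

theorem jacobiSym_sq_eq_one {x : ℤ} {m : ℕ} (h : IsCoprime x (m : ℤ)) : J(x ^ 2 | m) = 1 :=
  jacobiSym.sq_one' (Int.isCoprime_iff_gcd_eq_one.mp h)

theorem isCoprime_natAbs {x y : ℤ} (h : IsCoprime x y) : IsCoprime x (y.natAbs : ℤ) := by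
  rcases Int.natAbs_eq y with h' | h'
  · rwa [← h']
  · rw [h'] at h
    simpa using h.neg_right

theorem jacobiSym_congr {x y : ℤ} {m : ℕ} (h : (m : ℤ) ∣ x - y) : J(x | m) = J(y | m) :=
  jacobiSym.mod_left' (Int.modEq_iff_dvd.mpr h).symm

theorem sq_add_sq_mod_four {N : ℕ} {x y : ℤ} (hN : (N : ℤ) = x ^ 2 + y ^ 2) (hx : Odd x)
    (hy : Even y) : N % 4 = 1 := by
  obtain ⟨a, rfl⟩ := hx
  obtain ⟨b, rfl⟩ := hy
  have : (N : ℤ) = 4 * (a ^ 2 + a + b ^ 2) + 1 := by rw [hN]; ring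
  omega

/-- After inverting the symbol, N is congruent to y² (or x²) modulo w, a square prime to w. -/
theorem jacobiSym_odd_of_sq_add_sq {N : ℕ} {x y : ℤ} (hN : (N : ℤ) = x ^ 2 + y ^ 2) (hx : Odd x)
    (hy : Even y) (hxy : IsCoprime x y) {w : ℤ} (hw : Odd w) (hwd : w ∣ x ∨ w ∣ y) :
    J(w | N) = 1 := by
  rw [jacobiSym_eq_jacobiSym_natAbs (sq_add_sq_mod_four hN hx hy) hw]
  rcases hwd with h | h
  · rw [← jacobiSym_sq_eq_one (isCoprime_natAbs (hxy.symm.of_isCoprime_of_dvd_right h))]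
    refine jacobiSym_congr ?_
    rw [Int.natAbs_dvd, hN]
    exact (h.mul_right x).trans ⟨1, by ring⟩
  · rw [← jacobiSym_sq_eq_one (isCoprime_natAbs (hxy.of_isCoprime_of_dvd_right h))]
    refine jacobiSym_congr ?_
    rw [Int.natAbs_dvd, hN]
    exact (h.mul_right y).trans ⟨1, by ring⟩

/-- Write y = 2^k w with w odd; w contributes 1, leaving J(2 | N)^k. For k = 1 this is the claim,
and for k ≥ 2 one has N ≡ 1 mod 8, so that J(2 | N) = 1. -/
theorem jacobiSym_even_of_sq_add_sq {N : ℕ} {x y : ℤ} (hN : (N : ℤ) = x ^ 2 + y ^ 2) (hx : Odd x)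
    (hy : Even y) (hxy : IsCoprime x y) : J(y | N) = J(2 | N) := by
  have hN4 := sq_add_sq_mod_four hN hx hy
  have hNo : Odd N := by rw [Nat.odd_iff]; omega
  rcases eq_or_ne y 0 with rfl | hy0
  · rw [isCoprime_zero_right, Int.isUnit_iff] at hxy
    have : N = 1 := by rcases hxy with rfl | rfl <;> norm_num at hN <;> exact_mod_cast hN
    simp [this]
  obtain ⟨k, m, hm, hk⟩ := Nat.exists_eq_two_pow_mul_odd (Int.natAbs_ne_zero.mpr hy0)
  obtain ⟨w, hw, hyw⟩ : ∃ w : ℤ, Odd w ∧ y = 2 ^ k * w := by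
    have hm' : Odd (m : ℤ) := by exact_mod_cast hm
    rcases Int.natAbs_eq y with h | h
    · exact ⟨m, hm', by rw [h, hk]; push_cast; ring⟩
    · exact ⟨-m, hm'.neg, by rw [h, hk]; push_cast; ring⟩
  have h1 := jacobiSym_odd_of_sq_add_sq hN hx hy hxy hw (Or.inr ⟨2 ^ k, by rw [hyw]; ring⟩)
  rw [hyw, jacobiSym.mul_left, h1, mul_one, jacobiSym.pow_left]
  rcases k with _ | _ | k
  · rw [hyw, pow_zero, one_mul] at hy
    exact absurd hw (Int.not_odd_iff_even.mpr hy)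
  · simp
  · have h8 : N % 8 = 1 := by
      obtain ⟨a, rfl⟩ := hx
      have h3 : (N : ℤ) = 4 * (a * (a + 1)) + 1 + 8 * (2 * 2 ^ (2 * k) * w ^ 2) := by
        rw [hN, hyw]; ring
      obtain ⟨c, hc⟩ := Int.even_mul_succ_self a
      rw [hc] at h3
      omega
    rw [jacobiSym.at_two hNo, ZMod.χ₈_nat_eq_if_mod_eight]
    have h2 : N % 2 ≠ 0 := by omega
    simp [h8, h2]

/-! ### Residue symbols at split and inert primes -/

/-- A prime divides its norm, hence some rational prime p, so its norm divides p². If the norm is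
p², the cofactor is a unit. -/
theorem prime_norm_or_inert {π : GaussianInt} (hπ : Prime π) :
    π.norm.natAbs.Prime ∨ ∃ p : ℕ, p.Prime ∧ p % 4 = 3 ∧ Associated π (p : GaussianInt) := by
  have h1 : π ∣ ((π.norm.natAbs : ℕ) : GaussianInt) := by
    refine ⟨star π, ?_⟩
    rw [← Zsqrtd.norm_eq_mul_conj, ← Int.cast_natCast, GaussianInt.abs_natCast_norm]
  have h0 : π.norm.natAbs ≠ 0 := by
    rw [Int.natAbs_ne_zero, Ne, GaussianInt.norm_eq_zero]
    exact hπ.ne_zero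
  obtain ⟨p, hp, hd⟩ : ∃ p : ℕ, p.Prime ∧ π ∣ (p : GaussianInt) := by
    have : ∀ n : ℕ, n ≠ 0 → π ∣ (n : GaussianInt) → ∃ p : ℕ, p.Prime ∧ π ∣ (p : GaussianInt) := by
      intro n
      induction n using Nat.recOnMul with
      | zero => intro h; exact absurd rfl h
      | one => intro _ h; exact absurd (isUnit_of_dvd_one (by simpa using h)) hπ.not_isUnit
      | prime p hp => intro _ h; exact ⟨p, hp, h⟩
      | mul a b iha ihb =>
        intro hab h
        rw [Nat.cast_mul] at h
        rcases hπ.dvd_or_dvd h with h | h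
        · exact iha (left_ne_zero_of_mul hab) h
        · exact ihb (right_ne_zero_of_mul hab) h
    exact this _ h0 h1
  obtain ⟨c, hc⟩ := hd
  have h2 := norm_natAbs_mul π c
  have h3 : ((p : GaussianInt)).norm.natAbs = p ^ 2 := by
    rw [Zsqrtd.norm_natCast, Int.natAbs_mul]; simp [sq]
  rw [← hc, h3] at h2
  have h4 : π.norm.natAbs ≠ 1 := fun h => hπ.not_isUnit (isUnit_iff_norm_natAbs.mpr h)
  obtain ⟨j, hj, hj'⟩ := (Nat.dvd_prime_pow hp).mp ⟨_, h2⟩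
  interval_cases j
  · simp at hj'; exact absurd hj' h4
  · left; rw [hj', pow_one]; exact hp
  · right
    rw [hj'] at h2
    have h5 : c.norm.natAbs = 1 :=
      Nat.eq_of_mul_eq_mul_left (pow_pos hp.pos 2) (by rw [← h2, mul_one])
    have ha : Associated π (p : GaussianInt) := by
      rw [hc]; exact associated_mul_unit_right _ _ (isUnit_iff_norm_natAbs.mpr h5)
    have := Fact.mk hp
    exact ⟨p, hp, GaussianInt.mod_four_eq_three_of_nat_prime_of_prime p (ha.prime hπ), ha⟩

theorem intCast_dvd_iff (p : ℤ) (z : GaussianInt) :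
    (p : GaussianInt) ∣ z ↔ p ∣ z.re ∧ p ∣ z.im := Zsqrtd.intCast_dvd p z

/-- At a prime of degree one, every Gaussian integer is congruent to a rational integer. -/
theorem primeSymbol_intCast {π : GaussianInt} (hπ : Prime π) (h : IsOddGaussian π)
    (hp : π.norm.natAbs.Prime) (r : ℤ) : primeSymbol r π = J(r | π.norm.natAbs) := by
  classical
  set p := π.norm.natAbs with hpdef
  have := Fact.mk hp
  have hN := coe_norm_natAbs π
  rw [← hpdef] at hN
  have hdvd : ∀ z : ℤ, π ∣ (z : GaussianInt) ↔ (p : ℤ) ∣ z := by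
    intro z
    constructor
    · rintro ⟨c, hc⟩
      have h2 := norm_natAbs_mul π c
      rw [← hc, Zsqrtd.norm_intCast, Int.natAbs_mul] at h2
      have h3 : p ∣ z.natAbs * z.natAbs := ⟨_, h2⟩
      rcases hp.dvd_mul.mp h3 with h | h <;> exact Int.natCast_dvd.mpr h
    · rintro ⟨c, rfl⟩
      refine ⟨star π * c, ?_⟩
      rw [← mul_assoc, ← Zsqrtd.norm_eq_mul_conj, hpdef, GaussianInt.abs_natCast_norm]
      push_cast; ring
  have hb : IsCoprime π.im (p : ℤ) := by
    rw [isCoprime_comm]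
    refine (Nat.prime_iff_prime_int.mp hp).irreducible.coprime_iff_not_dvd.mpr fun hd => ?_
    have hd2 : (p : ℤ) ∣ π.re := by
      refine (Nat.prime_iff_prime_int.mp hp).dvd_of_dvd_pow (n := 2) ?_
      rw [show π.re ^ 2 = (p : ℤ) - π.im * π.im by rw [hN]; ring]
      exact dvd_sub (dvd_refl _) (hd.mul_right _)
    have hd3 : (p : GaussianInt) ∣ π := by
      rw [← Int.cast_natCast, intCast_dvd_iff]; exact ⟨hd2, hd⟩
    obtain ⟨c, hc⟩ := hd3
    have h2 := norm_natAbs_mul (p : GaussianInt) c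
    rw [← hc, ← hpdef, Zsqrtd.norm_natCast, Int.natAbs_mul, Int.natAbs_natCast] at h2
    have h5 := hp.one_lt
    have : 1 = p * c.norm.natAbs := by
      apply Nat.eq_of_mul_eq_mul_left hp.pos
      rw [mul_one, ← mul_assoc]; exact h2
    have := Nat.dvd_one.mp ⟨_, this⟩
    omega
  have hint : ∀ x : GaussianInt, ∃ y : ℤ, π ∣ x - y := by
    intro x
    obtain ⟨u, v, huv⟩ := hb
    -- Here u inverts `π.im` modulo p, and i is congruent to -`π.re`/`π.im` modulo π; this is x with
    -- i so replaced.
    refine ⟨u * (π.im * x.re - π.re * x.im), ?_⟩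
    have h1 : π ∣ (u : GaussianInt) * ((π.im : GaussianInt) * x -
        ((π.im * x.re - π.re * x.im : ℤ) : GaussianInt)) := by
      refine Dvd.dvd.mul_left ⟨(x.im : GaussianInt), ?_⟩ _
      ext <;> simp
    have h2 : π ∣ ((v * p : ℤ) : GaussianInt) * x :=
      ((hdvd _).mpr (Dvd.intro_left _ rfl)).mul_right _
    have h3 := dvd_add h1 h2
    convert h3 using 1
    have h4 : ((u * π.im + v * p : ℤ) : GaussianInt) = 1 := by rw [huv]; simp
    push_cast at h4 ⊢
    linear_combination (-x) * h4
  rw [h.primeSymbol_eq hπ, hdvd, ← jacobiSym.legendreSym.to_jacobiSym]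
  split_ifs with h1 h2
  · exact ((legendreSym.eq_zero_iff p r).mpr ((ZMod.intCast_zmod_eq_zero_iff_dvd r p).mpr h1)).symm
  · symm
    rw [legendreSym.eq_one_iff p (by rwa [Ne, ZMod.intCast_zmod_eq_zero_iff_dvd])]
    obtain ⟨x, hx⟩ := h2
    obtain ⟨y, hy⟩ := hint x
    have h3 : π ∣ ((y ^ 2 - r : ℤ) : GaussianInt) := by
      have := dvd_sub hx (hy.mul_right (x + y))
      convert this using 1
      push_cast; ring
    rw [hdvd, ← ZMod.intCast_zmod_eq_zero_iff_dvd] at h3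
    push_cast at h3
    exact ⟨y, by linear_combination -h3⟩
  · symm
    rw [legendreSym.eq_neg_one_iff]
    rintro ⟨y, hy⟩
    obtain ⟨y, rfl⟩ := ZMod.intCast_surjective y
    refine h2 ⟨y, ?_⟩
    have : ((y ^ 2 - r : ℤ) : ZMod p) = 0 := by push_cast; rw [hy]; ring
    rw [ZMod.intCast_zmod_eq_zero_iff_dvd, ← hdvd] at this
    push_cast at this
    exact this

theorem isCoprime_re_im_of_prime_norm {π : GaussianInt} (hp : π.norm.natAbs.Prime) :
    IsCoprime π.re π.im := by
  rw [Int.isCoprime_iff_gcd_eq_one]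
  obtain ⟨g, hg⟩ : ∃ g : ℕ, g = Int.gcd π.re π.im := ⟨_, rfl⟩
  rw [← hg]
  have h1 : ((g ^ 2 : ℕ) : ℤ) ∣ ((π.norm.natAbs : ℕ) : ℤ) := by
    rw [coe_norm_natAbs]
    push_cast
    exact dvd_add (pow_dvd_pow_of_dvd (hg ▸ Int.gcd_dvd_left ..) 2)
      (pow_dvd_pow_of_dvd (hg ▸ Int.gcd_dvd_right ..) 2)
  have h2 := Int.natCast_dvd_natCast.mp h1
  rw [sq] at h2
  exact Nat.isUnit_iff.mp (hp.prime.squarefree g h2)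

/-- Modulo π, the product of m by the integer `π.im` is the rational integer in the right-hand
symbol. The factor J(2 | N(π)) is the symbol of `π.im` itself, by `jacobiSym_even_of_sq_add_sq`. -/
theorem primeSymbol_of_prime_norm {π : GaussianInt} (hπ : Prime π) (h : IsPrimary π)
    (hp : π.norm.natAbs.Prime) (m : GaussianInt) :
    primeSymbol m π = J(2 | π.norm.natAbs) * J(π.im * m.re - π.re * m.im | π.norm.natAbs) := by
  have h1 : primeSymbol ((π.im : GaussianInt) * m) π =
      primeSymbol ((π.im * m.re - π.re * m.im : ℤ) : GaussianInt) π :=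
    primeSymbol_congr hπ h.isOdd ⟨(m.im : GaussianInt), by ext <;> simp⟩
  rw [primeSymbol_mul hπ h.isOdd, primeSymbol_intCast hπ h.isOdd hp,
    primeSymbol_intCast hπ h.isOdd hp,
    jacobiSym_even_of_sq_add_sq (coe_norm_natAbs π) h.1 h.2 (isCoprime_re_im_of_prime_norm hp)] at h1
  rw [← h1, ← mul_assoc, ← sq, ← jacobiSym.pow_left, jacobiSym_sq_eq_one, one_mul]
  rw [Int.isCoprime_iff_gcd_eq_one]
  exact Nat.coprime_two_left.mpr h.isOdd.norm_odd

/-- The residue field is 𝔽_p(i), and an element of it is a square exactly when its norm is a square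
in 𝔽_p. -/
theorem primeSymbol_of_inert {p : ℕ} (hp : p.Prime) (hp4 : p % 4 = 3) (m : GaussianInt) :
    primeSymbol m (p : GaussianInt) = J(m.norm.natAbs | p) := by
  classical
  have := Fact.mk hp
  have hp2 : p ≠ 2 := by omega
  have hπ := GaussianInt.prime_of_nat_prime_of_mod_four_eq_three p hp4
  have hodd : IsOddGaussian (p : GaussianInt) := by
    rw [IsOddGaussian]
    simp only [Zsqrtd.re_natCast, Zsqrtd.im_natCast, add_zero, Int.odd_coe_nat]
    rw [Nat.odd_iff]; omega
  have hdvd : ∀ z : GaussianInt, (p : GaussianInt) ∣ z ↔ ((z.re : ZMod p) = 0 ∧ (z.im : ZMod p) = 0) := by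
    intro z
    rw [← Int.cast_natCast, intCast_dvd_iff, ZMod.intCast_zmod_eq_zero_iff_dvd,
      ZMod.intCast_zmod_eq_zero_iff_dvd]
  have hneg : ¬ IsSquare (-1 : ZMod p) := by
    rw [ZMod.exists_sq_eq_neg_one_iff]; omega
  have h2 : (2 : ZMod p) ≠ 0 := by
    have : ((2 : ℕ) : ZMod p) ≠ 0 := by
      rw [Ne, ZMod.natCast_eq_zero_iff]
      exact fun h => hp2 ((Nat.prime_dvd_prime_iff_eq hp Nat.prime_two).mp h)
    simpa using this
  have hN : (((m.norm.natAbs : ℕ) : ℤ) : ZMod p) = (m.re : ZMod p) ^ 2 + (m.im : ZMod p) ^ 2 := by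
    rw [coe_norm_natAbs]; push_cast; ring
  have hpm : ∀ z : ZMod p, IsSquare z ∨ IsSquare (-z) := by
    intro z
    by_contra! hz
    have h3 := quadraticChar_neg_one_iff_not_isSquare.mpr hz.2
    rw [neg_eq_neg_one_mul, map_mul, quadraticChar_neg_one_iff_not_isSquare.mpr hz.1,
      quadraticChar_neg_one_iff_not_isSquare.mpr hneg] at h3
    norm_num at h3
  have hsum : ∀ x y : ZMod p, x ^ 2 + y ^ 2 = 0 → x = 0 ∧ y = 0 := by
    intro x y hxy
    have hy : y = 0 := by
      by_contra hy
      exact hneg ⟨x / y, by field_simp; linear_combination -hxy⟩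
    refine ⟨?_, hy⟩
    rw [hy] at hxy
    simpa using hxy
  rw [hodd.primeSymbol_eq hπ, hdvd, ← jacobiSym.legendreSym.to_jacobiSym]
  set a : ZMod p := ((m.re : ℤ) : ZMod p)
  set b : ZMod p := ((m.im : ℤ) : ZMod p)
  split_ifs with h1 h3
  · symm
    rw [legendreSym.eq_zero_iff, hN, h1.1, h1.2]; ring
  · symm
    rw [legendreSym.eq_one_iff p (by rw [hN]; exact fun h => h1 (hsum _ _ h)), hN]
    obtain ⟨x, hx⟩ := h3
    rw [hdvd] at hx
    obtain ⟨h3, h4⟩ := hx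
    simp only [sq, Zsqrtd.re_sub, Zsqrtd.re_mul, Zsqrtd.im_sub, Zsqrtd.im_mul] at h3 h4
    push_cast at h3 h4
    have h3' : a = x.re ^ 2 - x.im ^ 2 := by linear_combination -h3
    have h4' : b = 2 * x.re * x.im := by linear_combination -h4
    exact ⟨x.re ^ 2 + x.im ^ 2, by rw [h3', h4']; ring⟩
  · symm
    rw [legendreSym.eq_neg_one_iff, hN]
    rintro ⟨r, hr⟩
    apply h3
    -- A square root x + iy of a + ib has x² = (a + r)/2 and y² = (r - a)/2. Since -1 is a
    -- nonresidue, (a + r)/2 or its negative is a square; the second case amounts to replacing r by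
    -- -r.
    have key : ∃ x y : ZMod p, x ^ 2 - y ^ 2 = a ∧ 2 * x * y = b := by
      rcases eq_or_ne b 0 with hb | hb
      · rw [hb] at hr ⊢
        rcases hpm a with ⟨x, hx⟩ | ⟨y, hy⟩
        · exact ⟨x, 0, by rw [hx]; ring, by ring⟩
        · exact ⟨0, y, by linear_combination hy, by ring⟩
      · have hst : (a + r) * (a - r) = - b ^ 2 := by linear_combination hr
        have hs0 : a + r ≠ 0 := by
          intro h
          rw [h, zero_mul] at hst
          exact hb (by simpa using hst.symm)
        rcases hpm ((a + r) / 2) with ⟨x, hx⟩ | ⟨y, hy⟩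
        · have hx' : a + r = 2 * (x * x) := by rw [← hx]; field_simp
          have hx0 : x ≠ 0 := by rintro rfl; simp at hx'; exact hs0 hx'
          refine ⟨x, b / (2 * x), ?_, by field_simp⟩
          field_simp
          rw [hx'] at hst
          have hr' : r = 2 * (x * x) - a := by rw [← hx']; ring
          rw [hr'] at hst
          linear_combination -hst
        · have hy' : a + r = -(2 * (y * y)) := by rw [← hy]; field_simp
          have hy0 : y ≠ 0 := by rintro rfl; simp at hy'; exact hs0 hy'
          refine ⟨b / (2 * y), y, ?_, by field_simp⟩
          field_simp
          have hr' : r = -(2 * (y * y)) - a := by rw [← hy']; ring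
          rw [hr'] at hst
          linear_combination hst
    obtain ⟨x, y, hx, hy⟩ := key
    obtain ⟨x, rfl⟩ := ZMod.intCast_surjective x
    obtain ⟨y, rfl⟩ := ZMod.intCast_surjective y
    refine ⟨⟨x, y⟩, (hdvd _).mpr ⟨?_, ?_⟩⟩
    · simp only [sq, Zsqrtd.re_sub, Zsqrtd.re_mul]
      push_cast
      linear_combination hx
    · simp only [sq, Zsqrtd.im_sub, Zsqrtd.im_mul]
      push_cast
      linear_combination hy

end GaussianQuadratic

namespace GaussianQuadratic

open NumberTheorySymbols

/-! ### Multiplicativity in the numerator and the supplementary laws -/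

theorem IsOddGaussian.ne_zero {n : GaussianInt} (h : IsOddGaussian n) : n ≠ 0 := by
  rintro rfl
  exact absurd h (by simp [IsOddGaussian])

/-- Induction on odd Gaussian integers through their factorization. -/
theorem IsOddGaussian.induction {P : GaussianInt → Prop} (hunit : ∀ u, IsUnit u → P u)
    (hmul : ∀ a p, IsOddGaussian a → Prime p → IsOddGaussian p → P a → P (p * a)) :
    ∀ n, IsOddGaussian n → P n := by
  intro n
  induction n using UniqueFactorizationMonoid.induction_on_prime with
  | h₁ => exact fun h => absurd rfl h.ne_zero
  | h₂ u hu => exact fun _ => hunit u hu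
  | h₃ a p ha hp ih =>
    intro h
    obtain ⟨h1, h2⟩ := isOddGaussian_mul.mp h
    exact hmul a p h2 hp h1 (ih h2)

theorem quadChar_mul_left {n : GaussianInt} (hn : IsOddGaussian n) (a b : GaussianInt) :
    quadChar (a * b) n = quadChar a n * quadChar b n := by
  refine IsOddGaussian.induction (P := fun n => quadChar (a * b) n = quadChar a n * quadChar b n)
    (fun u hu => by simp [quadChar_of_isUnit _ hu]) (fun m p hm hp hpo ih => ?_) n hn
  simp only [quadChar_mul _ p m, quadChar_of_prime _ hp, ih, primeSymbol_mul hp hpo]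
  ring

theorem quadChar_congr {n : GaussianInt} (hn : IsOddGaussian n) :
    ∀ {a b : GaussianInt}, n ∣ a - b → quadChar a n = quadChar b n := by
  refine IsOddGaussian.induction
    (P := fun n => ∀ {a b : GaussianInt}, n ∣ a - b → quadChar a n = quadChar b n)
    (fun u hu a b _ => by simp [quadChar_of_isUnit _ hu]) (fun m p hm hp hpo ih => ?_) n hn
  intro a b hab
  rw [quadChar_mul, quadChar_mul, quadChar_of_prime _ hp, quadChar_of_prime _ hp,
    ih ((dvd_mul_left m p).trans hab), primeSymbol_congr hp hpo ((dvd_mul_right p m).trans hab)]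

theorem quadChar_eq_zero_of_prime_dvd {D π n : GaussianInt} (hπ : Prime π) (h1 : π ∣ D)
    (h2 : π ∣ n) : quadChar D n = 0 := by
  obtain ⟨c, rfl⟩ := h2
  rw [quadChar_mul, quadChar_of_prime _ hπ, primeSymbol, if_pos h1, zero_mul]

theorem quadChar_ne_zero {n : GaussianInt} (hn : n ≠ 0) {D : GaussianInt} :
    IsCoprime D n → quadChar D n ≠ 0 := by
  classical
  induction n using UniqueFactorizationMonoid.induction_on_prime with
  | h₁ => exact absurd rfl hn
  | h₂ u hu => simp [quadChar_of_isUnit _ hu]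
  | h₃ a p ha hp ih =>
    intro h
    rw [quadChar_mul, quadChar_of_prime _ hp]
    refine mul_ne_zero ?_ (ih ha (IsCoprime.of_mul_right_right h))
    have h1 : ¬ p ∣ D := fun hd =>
      hp.not_isUnit ((IsCoprime.of_mul_right_left h).isUnit_of_dvd' hd dvd_rfl)
    unfold primeSymbol
    rw [if_neg h1]
    split_ifs <;> norm_num

theorem quadChar_sq_eq_one {n : GaussianInt} (hn : n ≠ 0) {D : GaussianInt} (h : IsCoprime D n) :
    quadChar D n ^ 2 = 1 := by
  have h1 := abs_le.mp (abs_quadChar_le_one D n)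
  have h2 := quadChar_ne_zero hn h
  have : quadChar D n = 1 ∨ quadChar D n = -1 := by omega
  rcases this with h | h <;> rw [h] <;> norm_num

theorem quadChar_one_left {n : GaussianInt} (hn : IsOddGaussian n) : quadChar 1 n = 1 := by
  have h1 := quadChar_mul_left hn 1 1
  have h2 := quadChar_ne_zero hn.ne_zero (isCoprime_one_left (x := n))
  rw [mul_one] at h1
  exact mul_left_cancel₀ h2 (by rw [← h1, mul_one])

/-- In ℤ[i] the unit -1 is the square of i. -/
theorem quadChar_neg_one_left {n : GaussianInt} (hn : IsOddGaussian n) : quadChar (-1) n = 1 := by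
  have h1 := quadChar_mul_left hn ⟨0, 1⟩ ⟨0, 1⟩
  have h2 : (⟨0, 1⟩ : GaussianInt) * ⟨0, 1⟩ = -1 := by ext <;> simp
  have h3 : IsCoprime (⟨0, 1⟩ : GaussianInt) n :=
    (isCoprime_one_left).of_isCoprime_of_dvd_left (isUnit_iff_dvd_one.mp (IsUnit.of_mul_eq_one (⟨0, -1⟩ : GaussianInt) (by ext <;> simp)))
  rw [← h2, h1, ← sq, quadChar_sq_eq_one hn.ne_zero h3]

theorem quadChar_neg_right (D n : GaussianInt) : quadChar D (-n) = quadChar D n :=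
  quadChar_eq_of_associated D (Associated.neg_left (Associated.refl n))

theorem quadChar_neg_left {n : GaussianInt} (hn : IsOddGaussian n) (D : GaussianInt) :
    quadChar (-D) n = quadChar D n := by
  rw [neg_eq_neg_one_mul, quadChar_mul_left hn, quadChar_neg_one_left hn, one_mul]

theorem jacobiSym_two_mul {m n : ℕ} : Odd m → Odd n → J(2 | m * n) = J(2 | m) * J(2 | n) :=
  fun hm hn => jacobiSym.mul_right' 2 hm.pos.ne' hn.pos.ne'

theorem IsPrimary.eq_of_associated_natCast {π : GaussianInt} (h : IsPrimary π) {p : ℕ}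
    (hp : Odd p) (ha : Associated π (p : GaussianInt)) :
    π = (p : GaussianInt) ∨ π = -(p : GaussianInt) := by
  obtain ⟨u, hu⟩ := ha
  have hpp : IsPrimary (p : GaussianInt) := ⟨by simpa using hp, by simp⟩
  rw [← hu] at hpp
  rcases (IsPrimary.of_mul h hpp).eq_one_or_neg_one u.isUnit with h1 | h1 <;> rw [h1] at hu
  · left; simpa using hu
  · right; rw [← hu]; simp

/-- At a split prime the second Jacobi symbol is that of -`π.re`, an odd divisor of a coordinate, so
it is 1. At an inert p both sides are 1, the norm being p². -/
theorem quadChar_I {n : GaussianInt} (hn : IsOddGaussian n) :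
    quadChar ⟨0, 1⟩ n = J(2 | n.norm.natAbs) := by
  obtain ⟨m, hm, hmp⟩ := hn.exists_primary
  rw [quadChar_eq_of_associated _ hm]
  have : n.norm.natAbs = m.norm.natAbs := by
    obtain ⟨u, rfl⟩ := hm
    rw [norm_natAbs_mul, isUnit_iff_norm_natAbs.mp u.isUnit, mul_one]
  rw [this]
  refine IsPrimary.induction (P := fun m => quadChar ⟨0, 1⟩ m = J(2 | m.norm.natAbs))
    ?_ ?_ (fun π hπ hp => ?_) (fun a b ha hb h1 h2 => ?_) m hmp
  · simp [quadChar_of_isUnit]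
  · simp [quadChar_of_isUnit]
  · rcases prime_norm_or_inert hπ with h | ⟨p, hpp, hp4, ha⟩
    · rw [quadChar_of_prime _ hπ, primeSymbol_of_prime_norm hπ hp h,
        show π.im * 0 - π.re * 1 = -π.re by ring,
        jacobiSym_odd_of_sq_add_sq (coe_norm_natAbs π) hp.1 hp.2 (isCoprime_re_im_of_prime_norm h)
          hp.1.neg (Or.inl (neg_dvd.mpr dvd_rfl)), mul_one]
    · rw [quadChar_of_prime _ hπ, primeSymbol_eq_of_associated _ ha, primeSymbol_of_inert hpp hp4]
      have hpo : Odd p := by rw [Nat.odd_iff]; omega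
      have h1 : π.norm.natAbs = p * p := by
        rcases hp.eq_of_associated_natCast hpo ha with rfl | rfl <;>
          simp [Zsqrtd.norm_def, Int.natAbs_mul]
      rw [h1, jacobiSym_two_mul hpo hpo, ← sq, ← jacobiSym.pow_left, jacobiSym_sq_eq_one]
      · simp [Zsqrtd.norm_def]
      · rw [Int.isCoprime_iff_gcd_eq_one]; exact Nat.coprime_two_left.mpr hpo
  · rw [quadChar_mul, h1, h2, norm_natAbs_mul,
      jacobiSym_two_mul ha.isOdd.norm_odd hb.isOdd.norm_odd]

theorem chi_eight_neg (x : ZMod 8) : ZMod.χ₈ (-x) = ZMod.χ₈ x := by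
  revert x; decide

theorem jacobiSym_two_natAbs {w : ℤ} (hw : Odd w) : J(2 | w.natAbs) = ZMod.χ₈ (w : ZMod 8) := by
  rw [jacobiSym.at_two (Int.natAbs_odd.mpr hw)]
  rcases Int.natAbs_eq w with h | h
  · conv_rhs => rw [h, Int.cast_natCast]
  · conv_rhs => rw [h, Int.cast_neg, chi_eight_neg, Int.cast_natCast]

/-- At a split prime a + bi of norm N, the identity 2N = (a + b)² + (b - a)² gives J(N | |b - a|) =
J(2 | |b - a|). The symbol then depends only on a and b modulo 8, and a finite check ends the proof.
Products are harmless: the imaginary parts are even, so re + im is multiplicative modulo 8. -/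
theorem quadChar_one_add_I {n : GaussianInt} (hn : IsPrimary n) :
    quadChar ⟨1, 1⟩ n = ZMod.χ₈ ((n.re + n.im : ℤ) : ZMod 8) := by
  refine IsPrimary.induction
    (P := fun n => quadChar ⟨1, 1⟩ n = ZMod.χ₈ ((n.re + n.im : ℤ) : ZMod 8))
    ?_ ?_ (fun π hπ hp => ?_) (fun a b ha hb h1 h2 => ?_) n hn
  · simp [quadChar_of_isUnit]
  · rw [quadChar_neg_right, quadChar_of_isUnit _ isUnit_one]
    decide
  · rcases prime_norm_or_inert hπ with h | ⟨p, hpp, hp4, ha⟩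
    · rw [quadChar_of_prime _ hπ, primeSymbol_of_prime_norm hπ hp h]
      have hN := coe_norm_natAbs π
      set N := π.norm.natAbs
      have hw : Odd (π.im - π.re) := hp.2.sub_odd hp.1
      have hNo : Odd N := hp.isOdd.norm_odd
      rw [show π.im * 1 - π.re * 1 = π.im - π.re by rw [mul_one, mul_one]]
      rw [jacobiSym_eq_jacobiSym_natAbs hp.norm_mod_four hw]
      have h2N : J(2 * N | (π.im - π.re).natAbs) = 1 := by
        have hcop := isCoprime_re_im_of_prime_norm h
        trans J((π.re + π.im) ^ 2 | (π.im - π.re).natAbs)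
        · refine jacobiSym_congr ?_
          rw [Int.natAbs_dvd, hN]
          exact ⟨π.im - π.re, by ring⟩
        · apply jacobiSym_sq_eq_one
          apply isCoprime_natAbs
          have h2 : IsCoprime (2 : ℤ) (π.im - π.re) :=
            Int.isCoprime_two_left.mpr hw
          have h3 : IsCoprime (2 * π.re) (π.im - π.re) := by
            refine IsCoprime.mul_left h2 ?_
            obtain ⟨u, v, huv⟩ := hcop
            exact ⟨u + v, v, by linear_combination huv⟩
          obtain ⟨u, v, huv⟩ := h3
          exact ⟨u, v - u, by linear_combination huv⟩
      rw [jacobiSym.mul_left] at h2N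
      have h4 : J(N | (π.im - π.re).natAbs) = J(2 | (π.im - π.re).natAbs) := by
        have h5 := jacobiSym.trichotomy 2 (π.im - π.re).natAbs
        rcases h5 with h5 | h5 | h5 <;> rw [h5] at h2N ⊢ <;> omega
      rw [h4, jacobiSym_two_natAbs hw, jacobiSym.at_two hNo, ← map_mul]
      have h6 : ((N : ℕ) : ZMod 8) = (π.re : ZMod 8) ^ 2 + (π.im : ZMod 8) ^ 2 := by
        rw [← Int.cast_natCast, hN]; push_cast; ring
      rw [h6]
      obtain ⟨a, ha⟩ := hp.1
      obtain ⟨b, hb⟩ := hp.2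
      rw [ha, hb]
      push_cast
      generalize (a : ZMod 8) = x
      generalize (b : ZMod 8) = y
      revert x y
      decide
    · have hpo : Odd p := by rw [Nat.odd_iff]; omega
      rw [quadChar_of_prime _ hπ, primeSymbol_eq_of_associated _ ha, primeSymbol_of_inert hpp hp4]
      have h1 : ((Zsqrtd.norm (⟨1, 1⟩ : GaussianInt)).natAbs : ℤ) = 2 := by simp [Zsqrtd.norm_def]
      rw [h1, jacobiSym.at_two hpo]
      rcases hp.eq_of_associated_natCast hpo ha with rfl | rfl
      · simp
      · rw [← chi_eight_neg]
        simp
  · rw [quadChar_mul, h1, h2, ← map_mul]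
    obtain ⟨x, hx⟩ := ha.2
    obtain ⟨y, hy⟩ := hb.2
    simp only [Zsqrtd.re_mul, Zsqrtd.im_mul, hx, hy]
    push_cast
    congr 1
    have : (8 : ZMod 8) = 0 := by decide
    linear_combination (x * y : ZMod 8) * this

/-! ### The quadratic reciprocity law -/

/-- For split primes of norms p and q put f + ie = π times the conjugate of ρ. The two symbols are
J(2 | q)J(e | q) and J(2 | p)J(e | p), and pq = f² + e² forces J(e | pq) = J(2 | pq), so their
product is 1. Split against inert is rational reciprocity. For two inert primes each norm is a
square, and both symbols are 1. -/
theorem primeSymbol_comm {π ρ : GaussianInt} (hπ : Prime π) (hπp : IsPrimary π) (hρ : Prime ρ)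
    (hρp : IsPrimary ρ) : primeSymbol π ρ = primeSymbol ρ π := by
  by_cases hd : π ∣ ρ
  · have hd' : ρ ∣ π := (hπ.irreducible.associated_of_dvd hρ.irreducible hd).dvd'
    rw [primeSymbol, primeSymbol, if_pos hd, if_pos hd']
  have hd' : ¬ ρ ∣ π := fun h => hd (hρ.irreducible.associated_of_dvd hπ.irreducible h).dvd'
  have hne : ∀ {α β : GaussianInt}, ¬ α ∣ β → primeSymbol β α ≠ 0 := by
    intro α β h
    rw [primeSymbol, if_neg h]
    split_ifs <;> norm_num
  have split_inert : ∀ {α β : GaussianInt}, Prime α → IsPrimary α → Prime β → IsPrimary β →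
      α.norm.natAbs.Prime → (∃ p : ℕ, p.Prime ∧ p % 4 = 3 ∧ Associated β (p : GaussianInt)) →
      primeSymbol α β = primeSymbol β α := by
    rintro α β hα hαp hβ hβp h ⟨p, hpp, hp4, ha⟩
    have hpo : Odd p := by rw [Nat.odd_iff]; omega
    rw [primeSymbol_eq_of_associated _ ha, primeSymbol_of_inert hpp hp4,
      jacobiSym.quadratic_reciprocity_one_mod_four hαp.norm_mod_four hpo,
      ← Int.cast_natCast (R := GaussianInt) p |> fun _ => primeSymbol_intCast hα hαp.isOdd h p]
    rcases hβp.eq_of_associated_natCast hpo ha with rfl | rfl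
    · simp
    · rw [← quadChar_of_prime _ hα, ← quadChar_of_prime _ hα, quadChar_neg_left hαp.isOdd]
      simp
  rcases prime_norm_or_inert hπ with h | h <;> rcases prime_norm_or_inert hρ with h' | h'
  · have e1 := primeSymbol_of_prime_norm hπ hπp h ρ
    have e2 := primeSymbol_of_prime_norm hρ hρp h' π
    have n1 := hne hd
    have n2 := hne hd'
    set p := π.norm.natAbs with hpdef
    set q := ρ.norm.natAbs with hqdef
    have hpo : Odd p := hπp.isOdd.norm_odd
    have hqo : Odd q := hρp.isOdd.norm_odd
    set e := π.im * ρ.re - π.re * ρ.im with he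
    have he2 : ρ.im * π.re - ρ.re * π.im = -e := by rw [he]; ring
    rw [he2, jacobiSym.neg _ hqo, ZMod.χ₄_nat_one_mod_four hρp.norm_mod_four, one_mul] at e2
    set f := π.re * ρ.re + π.im * ρ.im with hf
    have hpq : ((p * q : ℕ) : ℤ) = f ^ 2 + e ^ 2 := by
      push_cast
      rw [hpdef, hqdef, coe_norm_natAbs, coe_norm_natAbs]
      ring
    have hfo : Odd f := (hπp.1.mul hρp.1).add_even (hπp.2.mul_right _)
    have hee : Even e := (hπp.2.mul_right _).sub (hρp.2.mul_left _)
    have hcop : IsCoprime f e := by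
      have c1 : IsCoprime e (p : ℤ) := by
        rw [Int.isCoprime_iff_gcd_eq_one]
        by_contra hc
        rw [e1, jacobiSym.eq_zero_iff.mpr ⟨hpo.pos.ne', hc⟩, mul_zero] at n1
        exact n1 rfl
      have c2 : IsCoprime e (q : ℤ) := by
        rw [Int.isCoprime_iff_gcd_eq_one]
        by_contra hc
        rw [e2, jacobiSym.eq_zero_iff.mpr ⟨hqo.pos.ne', hc⟩, mul_zero] at n2
        exact n2 rfl
      obtain ⟨u, v, huv⟩ := c1.mul_right c2
      rw [← Nat.cast_mul, hpq] at huv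
      exact ⟨v * f, u + v * e, by linear_combination huv⟩
    have e3 := jacobiSym_even_of_sq_add_sq hpq hfo hee hcop
    rw [jacobiSym_two_mul hpo hqo, jacobiSym.mul_right' _ hpo.pos.ne' hqo.pos.ne'] at e3
    have two_ne : ∀ {N : ℕ}, Odd N → J(2 | N) ^ 2 = 1 := fun hN => by
      rw [← jacobiSym.pow_left, jacobiSym_sq_eq_one]
      rw [Int.isCoprime_iff_gcd_eq_one]; exact Nat.coprime_two_left.mpr hN
    have e4 : primeSymbol ρ π * primeSymbol π ρ = 1 := by
      rw [e1, e2]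
      calc _ = (J(2 | p) * J(2 | q)) * (J(e | p) * J(e | q)) := by ring
        _ = J(2 | p) ^ 2 * J(2 | q) ^ 2 := by rw [e3]; ring
        _ = 1 := by rw [two_ne hpo, two_ne hqo, one_mul]
    rcases primeSymbol_values ρ π with h1 | h1 | h1 <;> rw [h1] at e4 ⊢ <;> omega
  · exact split_inert hπ hπp hρ hρp h h'
  · exact (split_inert hρ hρp hπ hπp h' h).symm
  · obtain ⟨p, hpp, hp4, ha⟩ := h
    obtain ⟨q, hqq, hq4, hb⟩ := h'
    have one : ∀ {α β : GaussianInt} {a b : ℕ}, a.Prime → a % 4 = 3 → b.Prime → b % 4 = 3 →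
        IsPrimary α → Associated α (a : GaussianInt) → Associated β (b : GaussianInt) → ¬ β ∣ α →
        primeSymbol α β = 1 := by
      intro α β a b hap ha4 hbp hb4 hα ha hb hβα
      have hn := hne hβα
      rw [primeSymbol_eq_of_associated _ hb, primeSymbol_of_inert hbp hb4] at hn ⊢
      have h1 : (α.norm.natAbs : ℤ) = (a : ℤ) ^ 2 := by
        rcases hα.eq_of_associated_natCast (by rw [Nat.odd_iff]; omega) ha with rfl | rfl <;>
          simp [Zsqrtd.norm_def, sq]
      rw [h1, jacobiSym.pow_left] at hn ⊢
      rcases jacobiSym.trichotomy a b with h | h | h <;> rw [h] at hn ⊢ <;> simp_all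
    rw [one hpp hp4 hqq hq4 hπp ha hb hd', one hqq hq4 hpp hp4 hρp hb ha hd]

/-- Quadratic reciprocity for primary Gaussian integers. -/
theorem quadChar_comm {m n : GaussianInt} (hm : IsPrimary m) (hn : IsPrimary n) :
    quadChar m n = quadChar n m := by
  refine IsPrimary.induction (P := fun n => quadChar m n = quadChar n m) ?_ ?_
    (fun π hπ hp => ?_) (fun a b ha hb h1 h2 => ?_) n hn
  · rw [quadChar_of_isUnit _ isUnit_one, quadChar_one_left hm.isOdd]
  · rw [quadChar_neg_right, quadChar_of_isUnit _ isUnit_one, quadChar_neg_one_left hm.isOdd]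
  · refine IsPrimary.induction (P := fun m => quadChar m π = quadChar π m) ?_ ?_
      (fun ρ hρ hr => ?_) (fun a b ha hb h1 h2 => ?_) m hm
    · rw [quadChar_of_isUnit _ isUnit_one, quadChar_one_left hp.isOdd]
    · rw [quadChar_neg_right, quadChar_of_isUnit _ isUnit_one, quadChar_neg_one_left hp.isOdd]
    · rw [quadChar_of_prime _ hπ, quadChar_of_prime _ hρ, primeSymbol_comm hρ hr hπ hp]
    · rw [quadChar_mul_left hp.isOdd, h1, h2, quadChar_mul]
  · rw [quadChar_mul_left hm.isOdd, ← h1, ← h2, quadChar_mul]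

end GaussianQuadratic

namespace GaussianQuadratic

open NumberTheorySymbols

/-! ### Periodicity of the quadratic character -/

theorem isUnit_I : IsUnit (⟨0, 1⟩ : GaussianInt) :=
  IsUnit.of_mul_eq_one (⟨0, -1⟩ : GaussianInt) (by ext <;> simp)

theorem IsOddGaussian.primary_or_mul_I {n : GaussianInt} (h : IsOddGaussian n) :
    IsPrimary n ∨ IsPrimary (n * ⟨0, 1⟩) := by
  rcases Int.even_or_odd n.im with h2 | h2
  · rw [IsOddGaussian, Int.odd_add] at h
    exact Or.inl ⟨h.mpr h2, h2⟩
  · rw [IsOddGaussian, Int.odd_add'] at h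
    right
    constructor <;> simp [parity_simps, h2, h.mp h2]

theorem isOddGaussian_of_isUnit {u : GaussianInt} (hu : IsUnit u) : IsOddGaussian u := by
  obtain ⟨v, hv⟩ := hu.exists_right_inv
  have h : IsOddGaussian (u * v) := by rw [hv]; simp [IsOddGaussian]
  exact (isOddGaussian_mul.mp h).1

theorem eq_of_isUnit {u : GaussianInt} (hu : IsUnit u) :
    u = 1 ∨ u = -1 ∨ u = ⟨0, 1⟩ ∨ u = -⟨0, 1⟩ := by
  rcases (isOddGaussian_of_isUnit hu).primary_or_mul_I with h | h
  · rcases h.eq_one_or_neg_one hu with h | h <;> simp [h]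
  · have h2 : u = -(u * ⟨0, 1⟩ * ⟨0, 1⟩) := by ext <;> simp
    rcases h.eq_one_or_neg_one (hu.mul isUnit_I) with h | h <;> rw [h] at h2 <;> simp [h2]

theorem quadChar_mul_I_right (D n : GaussianInt) : quadChar D (n * ⟨0, 1⟩) = quadChar D n := by
  rw [quadChar_mul, quadChar_of_isUnit _ isUnit_I, mul_one]

theorem prime_one_add_I : Prime (⟨1, 1⟩ : GaussianInt) := by
  rw [← irreducible_iff_prime]
  have hn : (⟨1, 1⟩ : GaussianInt).norm.natAbs = 2 := by simp [Zsqrtd.norm_def]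
  constructor
  · rw [isUnit_iff_norm_natAbs, hn]; norm_num
  · intro a b hab
    rw [hab, norm_natAbs_mul] at hn
    rw [isUnit_iff_norm_natAbs, isUnit_iff_norm_natAbs]
    exact (Nat.prime_mul_iff.mp (hn ▸ Nat.prime_two)).elim (fun h => Or.inr h.2) (fun h => Or.inl h.2)

theorem one_add_I_dvd_iff {n : GaussianInt} : (⟨1, 1⟩ : GaussianInt) ∣ n ↔ ¬ IsOddGaussian n := by
  constructor
  · rintro ⟨c, rfl⟩ h
    exact absurd (isOddGaussian_mul.mp h).1 (by simp [IsOddGaussian])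
  · intro h
    rw [IsOddGaussian, Int.not_odd_iff_even] at h
    obtain ⟨k, hk⟩ := h
    refine ⟨⟨k, k - n.re⟩, ?_⟩
    ext <;> simp <;> omega

theorem associated_one_add_I {π : GaussianInt} (hπ : Prime π) (h : ¬ IsOddGaussian π) :
    Associated (⟨1, 1⟩ : GaussianInt) π :=
  prime_one_add_I.irreducible.associated_of_dvd hπ.irreducible (one_add_I_dvd_iff.mpr h)

theorem natCast_dvd_re_im {k : ℤ} {z : GaussianInt} (h : (k : GaussianInt) ∣ z) :
    k ∣ z.re ∧ k ∣ z.im := (intCast_dvd_iff k z).mp h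

theorem IsOddGaussian.add {n z : GaussianInt} (h : IsOddGaussian n) (hz : 8 ∣ z) :
    IsOddGaussian (n + z) := by
  obtain ⟨⟨a, ha⟩, ⟨b, hb⟩⟩ := natCast_dvd_re_im (k := 8) (by exact_mod_cast hz)
  obtain ⟨c, hc⟩ := h
  exact ⟨c + 4 * a + 4 * b, by simp only [Zsqrtd.re_add, Zsqrtd.im_add]; omega⟩

theorem IsPrimary.add {n z : GaussianInt} (h : IsPrimary n) (hz : 8 ∣ z) :
    IsPrimary (n + z) := by
  obtain ⟨⟨a, ha⟩, ⟨b, hb⟩⟩ := natCast_dvd_re_im (k := 8) (by exact_mod_cast hz)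
  obtain ⟨⟨c, hc⟩, ⟨d, hd⟩⟩ := h
  exact ⟨⟨c + 4 * a, by simp only [Zsqrtd.re_add]; omega⟩,
    ⟨d + 4 * b, by simp only [Zsqrtd.im_add]; omega⟩⟩

/-- Multiplying n and z by i leaves the values of χ_D unchanged and makes n primary if it was not.
-/
theorem quadChar_add_of_primary {D : GaussianInt} {z n : GaussianInt} (hn : IsOddGaussian n)
    (h : ∀ w m : GaussianInt, z ∣ w → IsPrimary m → quadChar D (m + w) = quadChar D m) :
    quadChar D (n + z) = quadChar D n := by
  rcases hn.primary_or_mul_I with h1 | h1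
  · exact h z n dvd_rfl h1
  · have h2 := h (z * ⟨0, 1⟩) _ (dvd_mul_right _ _) h1
    rwa [← add_mul, quadChar_mul_I_right, quadChar_mul_I_right] at h2

theorem jacobiSym_two_norm_add {n z : GaussianInt} (hn : IsOddGaussian n) (hz : 8 ∣ z) :
    J(2 | (n + z).norm.natAbs) = J(2 | n.norm.natAbs) := by
  rw [jacobiSym.at_two hn.norm_odd, jacobiSym.at_two (hn.add hz).norm_odd]
  congr 1
  rw [← Int.cast_natCast, ← Int.cast_natCast (R := ZMod 8) n.norm.natAbs, coe_norm_natAbs,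
    coe_norm_natAbs, ZMod.intCast_eq_intCast_iff_dvd_sub]
  obtain ⟨⟨a, ha⟩, ⟨b, hb⟩⟩ := natCast_dvd_re_im (k := 8) (by exact_mod_cast hz)
  simp only [Zsqrtd.re_add, Zsqrtd.im_add, ha, hb]
  exact ⟨-(2 * n.re * a + 8 * a ^ 2 + 2 * n.im * b + 8 * b ^ 2), by push_cast; ring⟩

theorem quadChar_unit_add {u n z : GaussianInt} (hu : IsUnit u) (hn : IsOddGaussian n)
    (hz : 8 ∣ z) : quadChar u (n + z) = quadChar u n := by
  have hn' := hn.add hz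
  rcases eq_of_isUnit hu with rfl | rfl | rfl | rfl
  · rw [quadChar_one_left hn, quadChar_one_left hn']
  · rw [quadChar_neg_one_left hn, quadChar_neg_one_left hn']
  · rw [quadChar_I hn, quadChar_I hn', jacobiSym_two_norm_add hn hz]
  · rw [quadChar_neg_left hn, quadChar_neg_left hn', quadChar_I hn, quadChar_I hn',
      jacobiSym_two_norm_add hn hz]

theorem quadChar_one_add_I_add {n z : GaussianInt} (hn : IsOddGaussian n) (hz : 8 ∣ z) :
    quadChar ⟨1, 1⟩ (n + z) = quadChar ⟨1, 1⟩ n := by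
  refine quadChar_add_of_primary hn fun w m hw hm => ?_
  have hw8 := hz.trans hw
  rw [quadChar_one_add_I hm, quadChar_one_add_I (hm.add hw8)]
  congr 1
  rw [ZMod.intCast_eq_intCast_iff_dvd_sub]
  obtain ⟨⟨a, ha⟩, ⟨b, hb⟩⟩ := natCast_dvd_re_im (k := 8) (by exact_mod_cast hw8)
  simp only [Zsqrtd.re_add, Zsqrtd.im_add, ha, hb]
  exact ⟨-(a + b), by push_cast; ring⟩

/-- On odd arguments, the symbol `(D / n)` depends only on `n` modulo `8` and `D`. -/
theorem quadChar_add_of_odd {D : GaussianInt} (hD : D ≠ 0) :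
    ∀ {n z : GaussianInt}, IsOddGaussian n → 8 ∣ z → D ∣ z →
      quadChar D (n + z) = quadChar D n := by
  induction D using UniqueFactorizationMonoid.induction_on_prime with
  | h₁ => exact absurd rfl hD
  | h₂ u hu => exact fun hn hz _ => quadChar_unit_add hu hn hz
  | h₃ a p ha hp ih =>
    intro n z hn hz hDz
    rw [quadChar_mul_left hn, quadChar_mul_left (hn.add hz),
      ih ha hn hz ((dvd_mul_left a p).trans hDz)]
    congr 1
    have hpz := (dvd_mul_right p a).trans hDz
    by_cases hpo : IsOddGaussian p
    · obtain ⟨ρ, hρ, hρp⟩ := hpo.exists_primary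
      obtain ⟨u, rfl⟩ := hρ.symm
      rw [quadChar_mul_left hn, quadChar_mul_left (hn.add hz), quadChar_unit_add u.isUnit hn hz]
      congr 1
      refine quadChar_add_of_primary hn fun w m hw hm => ?_
      -- Reciprocity turns ρ into the modulus, and ρ divides the increment w.
      rw [quadChar_comm hρp hm, quadChar_comm hρp (hm.add (hz.trans hw))]
      refine quadChar_congr hρp.isOdd ?_
      rw [add_sub_cancel_left]
      exact (hρ.symm.dvd.trans hpz).trans hw
    · obtain ⟨u, rfl⟩ := associated_one_add_I hp hpo
      rw [quadChar_mul_left hn, quadChar_mul_left (hn.add hz), quadChar_unit_add u.isUnit hn hz,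
        quadChar_one_add_I_add hn hz]

/-- D ≡ t² modulo 4 with t odd, so exactly one coordinate of t is odd and im t² = 2 re t im t is
divisible by 4. -/
theorem re_im_of_eq_sq_sub {D t c : GaussianInt} (h : D = t ^ 2 - 4 * c) (hD : IsOddGaussian D) :
    Odd D.re ∧ (4 : ℤ) ∣ D.im := by
  have hre : D.re = t.re ^ 2 - t.im ^ 2 - 4 * c.re := by rw [h, sq]; simp; ring
  have him : D.im = 2 * (t.re * t.im) - 4 * c.im := by rw [h, sq]; simp; ring
  have h4 : Even (t.re * t.im) := by
    rw [IsOddGaussian, hre, him] at hD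
    rw [Int.even_mul]
    by_contra! hc
    have e4 : Even (4 : ℤ) := ⟨2, rfl⟩
    simp [parity_simps, hc.1, hc.2, e4] at hD
  have hdvd : (4 : ℤ) ∣ D.im := by
    obtain ⟨k, hk⟩ := h4
    exact ⟨k - c.im, by rw [him, hk]; ring⟩
  refine ⟨?_, hdvd⟩
  obtain ⟨k, hk⟩ := hdvd
  rw [IsOddGaussian, hk] at hD
  have e4 : Even (4 : ℤ) := ⟨2, rfl⟩
  simpa [parity_simps, e4] using hD

/-- The Kronecker symbol at `1 + i` of an odd discriminant. -/
theorem primeSymbol_one_add_I {D : GaussianInt} (h1 : Odd D.re) (h4 : (4 : ℤ) ∣ D.im) :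
    primeSymbol D ⟨1, 1⟩ = ZMod.χ₈ ((D.re + D.im : ℤ) : ZMod 8) := by
  classical
  obtain ⟨b, hb⟩ := h4
  have hodd : IsOddGaussian D := h1.add_even ⟨2 * b, by omega⟩
  have hd4 : ∀ z : GaussianInt, 4 * (⟨1, 1⟩ : GaussianInt) ∣ z ↔
      ∃ u v : ℤ, z.re = 4 * (u - v) ∧ z.im = 4 * (u + v) := by
    intro z
    constructor
    · rintro ⟨c, rfl⟩
      exact ⟨c.re, c.im, by simp; ring, by simp; ring⟩
    · rintro ⟨u, v, hu, hv⟩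
      exact ⟨⟨u, v⟩, by ext <;> simp [hu, hv] <;> ring⟩
  rw [primeSymbol, if_neg (by rw [one_add_I_dvd_iff, not_not]; exact hodd),
    if_pos ⟨⟨1, -1⟩, by ext <;> simp⟩]
  have hs : ((D.re + D.im : ℤ) : ZMod 8) = (((D.re + D.im) % 8 : ℤ) : ZMod 8) := by
    rw [ZMod.intCast_eq_intCast_iff_dvd_sub]
    exact ⟨-((D.re + D.im) / 8), by push_cast; omega⟩
  have hval : (D.re + D.im) % 8 = 1 ∨ (D.re + D.im) % 8 = 3 ∨ (D.re + D.im) % 8 = 5 ∨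
      (D.re + D.im) % 8 = 7 := by
    obtain ⟨a, ha⟩ := h1
    omega
  -- Multiples of 4(1 + i) have re + im divisible by 8, while an odd square has re + im ≡ ±1 modulo
  -- 8. Conversely 1² = 1 and i² = -1 realise the two classes.
  have key : (∃ x : GaussianInt, 4 * (⟨1, 1⟩ : GaussianInt) ∣ x ^ 2 - D) →
      (D.re + D.im) % 8 = 1 ∨ (D.re + D.im) % 8 = 7 := by
    rintro ⟨x, hx⟩
    obtain ⟨u, v, hu, hv⟩ := (hd4 _).mp hx
    simp only [sq, Zsqrtd.re_sub, Zsqrtd.re_mul, Zsqrtd.im_sub, Zsqrtd.im_mul] at hu hv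
    have h5 : D.re + D.im = x.re * x.re - x.im * x.im + 2 * (x.re * x.im) - 8 * u := by
      linarith
    have h6 : Odd (x.re + x.im) := by
      have : Odd (x.re * x.re - x.im * x.im + 2 * (x.re * x.im) - 8 * u) := h5 ▸ hodd
      have e8 : Even (8 : ℤ) := ⟨4, rfl⟩
      rw [Int.odd_add]
      simpa [parity_simps, e8, Int.odd_mul] using this
    rcases Int.even_or_odd x.im with ⟨f, hf⟩ | ⟨f, hf⟩
    · have he : Odd x.re := by
        rw [hf] at h6
        simpa [parity_simps] using h6
      obtain ⟨e, he⟩ := he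
      left
      obtain ⟨k, hk⟩ := Int.even_mul_succ_self e
      obtain ⟨l, hl⟩ := Int.even_mul_succ_self (f - 1)
      have : D.re + D.im = 8 * (k - l - u + e * f) + 1 := by
        rw [h5, he, hf]; linear_combination 4 * hk - 4 * hl
      omega
    · obtain ⟨e, he⟩ : Even x.re := by
        rw [Int.odd_add'] at h6
        exact h6.mp ⟨f, hf⟩
      right
      obtain ⟨k, hk⟩ := Int.even_mul_succ_self e
      obtain ⟨l, hl⟩ := Int.even_mul_succ_self f
      have : D.re + D.im = 8 * (k - l - u + e * f - 1) + 7 := by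
        rw [h5, he, hf]; linear_combination 4 * hk - 4 * hl
      omega
  rw [hs]
  rcases hval with h | h | h | h
  · rw [if_pos, h]
    · decide
    · refine ⟨1, (hd4 _).mpr ?_⟩
      refine ⟨-((D.re + D.im) / 8), -(b - (D.re + D.im) / 8), ?_, ?_⟩ <;>
        simp <;> omega
  · rw [if_neg, h]
    · decide
    · intro hx
      have := key hx
      omega
  · rw [if_neg, h]
    · decide
    · intro hx
      have := key hx
      omega
  · rw [if_pos, h]
    · decide
    · refine ⟨⟨0, 1⟩, (hd4 _).mpr ?_⟩
      refine ⟨-((D.re + D.im) / 8) - 1, -(b - (D.re + D.im) / 8 - 1), ?_, ?_⟩ <;>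
        simp [sq] <;> omega

/-- Reciprocity in the form `χ_D(n) = (n / D)` for an odd discriminant `D`. -/
theorem quadChar_eq_quadChar_swap {D : GaussianInt} (h1 : Odd D.re) (h4 : (4 : ℤ) ∣ D.im)
    (hsq : ¬ IsSquare D) (n : GaussianInt) : quadChar D n = quadChar n D := by
  have hp : IsPrimary D := ⟨h1, by obtain ⟨k, hk⟩ := h4; exact ⟨2 * k, by omega⟩⟩
  -- Since 4 divides im D, the norm of D is 1 modulo 8. So i has trivial symbol, and n may be made
  -- primary at no cost.
  have hI : quadChar ⟨0, 1⟩ D = 1 := by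
    rw [quadChar_I hp.isOdd, jacobiSym.at_two hp.isOdd.norm_odd, ← Int.cast_natCast,
      coe_norm_natAbs]
    obtain ⟨a, ha⟩ := h1
    obtain ⟨b, hb⟩ := h4
    rw [ha, hb]
    push_cast
    generalize (a : ZMod 8) = x
    generalize (b : ZMod 8) = y
    revert x y
    decide
  have hodd : ∀ n, IsOddGaussian n → quadChar D n = quadChar n D := by
    intro n hn
    rcases hn.primary_or_mul_I with h | h
    · exact quadChar_comm hp h
    · rw [← quadChar_mul_I_right, quadChar_comm hp h, quadChar_mul_left hp.isOdd, hI, mul_one]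
  induction n using UniqueFactorizationMonoid.induction_on_prime with
  | h₁ =>
    -- At n = 0 the right side vanishes only because D is not a unit: the primary units 1 and -1 =
    -- i² are squares.
    have hu : ¬ IsUnit D := fun hu => by
      rcases hp.eq_one_or_neg_one hu with h | h
      · exact hsq ⟨1, by rw [h, one_mul]⟩
      · exact hsq ⟨⟨0, 1⟩, by rw [h]; ext <;> simp⟩
    obtain ⟨π, hπ, hd⟩ := WfDvdMonoid.exists_irreducible_factor hu hp.isOdd.ne_zero
    rw [quadChar_zero, quadChar_eq_zero_of_prime_dvd hπ.prime (dvd_zero π) hd]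
  | h₂ u hu => exact hodd u (isOddGaussian_of_isUnit hu)
  | h₃ a p ha hpr ih =>
    rw [quadChar_mul, quadChar_mul_left hp.isOdd, ih]
    congr 1
    by_cases hpo : IsOddGaussian p
    · exact hodd p hpo
    · obtain ⟨u, rfl⟩ := associated_one_add_I hpr hpo
      rw [quadChar_mul, quadChar_mul_left hp.isOdd,
        hodd (u : GaussianInt) (isOddGaussian_of_isUnit u.isUnit), quadChar_of_prime _ prime_one_add_I,
        primeSymbol_one_add_I h1 h4, quadChar_one_add_I hp]

/-- The quadratic character of a discriminant `D` is periodic modulo `8 D`. -/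
theorem IsFundamentalDiscriminant.quadChar_add {D : GaussianInt} (hD : IsFundamentalDiscriminant D)
    (n : GaussianInt) {z : GaussianInt} (h8 : 8 ∣ z) (hz : D ∣ z) :
    quadChar D (n + z) = quadChar D n := by
  have hsq := hD.not_isSquare
  have h0 : D ≠ 0 := by rintro rfl; exact hsq (IsSquare.zero)
  by_cases hodd : IsOddGaussian D
  · obtain ⟨t, c, htc⟩ := hD.eq_sq_sub
    obtain ⟨h1, h4⟩ := re_im_of_eq_sq_sub htc hodd
    rw [quadChar_eq_quadChar_swap h1 h4 hsq, quadChar_eq_quadChar_swap h1 h4 hsq]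
    exact quadChar_congr hodd (by rwa [add_sub_cancel_left])
  · by_cases hn : IsOddGaussian n
    · exact quadChar_add_of_odd h0 hn h8 hz
    · have hw := one_add_I_dvd_iff.mpr hodd
      have hn' := one_add_I_dvd_iff.mpr hn
      rw [quadChar_eq_zero_of_prime_dvd prime_one_add_I hw hn',
        quadChar_eq_zero_of_prime_dvd prime_one_add_I hw (dvd_add hn' (hw.trans hz))]

end GaussianQuadratic

namespace GaussianQuadratic

open NumberTheorySymbols

/-! ### Nontriviality of the quadratic character -/

theorem exists_eq_mul_sq {D : GaussianInt} (hD : D ≠ 0) :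
    ∃ E F : GaussianInt, D = E * F ^ 2 ∧ ∀ π, Prime π → ¬ π ^ 2 ∣ E := by
  induction hk : D.norm.natAbs using Nat.strong_induction_on generalizing D with
  | _ k ih =>
  by_cases h : ∀ π, Prime π → ¬ π ^ 2 ∣ D
  · exact ⟨D, 1, by ring, h⟩
  push Not at h
  obtain ⟨π, hπ, E, rfl⟩ := h
  have hE : E ≠ 0 := right_ne_zero_of_mul hD
  obtain ⟨E', F, hEF, h⟩ := ih E.norm.natAbs (by
    rw [← hk, norm_natAbs_mul, sq, norm_natAbs_mul]
    have h1 : π.norm.natAbs ≠ 1 := fun h => hπ.not_isUnit (isUnit_iff_norm_natAbs.mpr h)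
    have h2 : π.norm.natAbs ≠ 0 := by
      rw [Int.natAbs_ne_zero, Ne, GaussianInt.norm_eq_zero]; exact hπ.ne_zero
    have h3 : 0 < E.norm.natAbs := by
      rw [Nat.pos_iff_ne_zero, Int.natAbs_ne_zero, Ne, GaussianInt.norm_eq_zero]; exact hE
    have h4 : 2 ≤ π.norm.natAbs := by omega
    exact lt_mul_left h3 (by nlinarith)) hE rfl
  exact ⟨E', π * F, by rw [hEF]; ring, h⟩

theorem exists_eq_pow_mul_not_dvd {π Q : GaussianInt} (hπ : Prime π) (hQ : Q ≠ 0) :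
    ∃ (k : ℕ) (M : GaussianInt), Q = π ^ k * M ∧ IsCoprime π M := by
  obtain ⟨M, h, hM⟩ := (FiniteMultiplicity.of_prime_left hπ hQ).exists_eq_pow_mul_and_not_dvd
  exact ⟨_, M, h, hπ.irreducible.coprime_iff_not_dvd.mpr hM⟩

theorem dvd_of_dvd_pow_mul {π x M : GaussianInt} {k : ℕ} (h : x ∣ π ^ k * M)
    (hx : IsCoprime π x) : x ∣ M :=
  (hx.symm.pow_right).dvd_of_dvd_mul_left h

theorem isCoprime_of_dvd_sub {a b m : GaussianInt} (h : m ∣ a - b) (hb : IsCoprime b m) :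
    IsCoprime a m := by
  obtain ⟨c, hc⟩ := h
  have : a = b + m * c := by rw [← hc]; ring
  rw [this]
  exact hb.add_mul_left_left c

theorem exists_primeSymbol_eq_neg_one {π : GaussianInt} (hπ : Prime π) (h : IsOddGaussian π) :
    ∃ r, primeSymbol r π = -1 := by
  classical
  have := finite_quotient_span hπ.ne_zero
  have hmax : (Ideal.span {π}).IsMaximal :=
    PrincipalIdealRing.isMaximal_of_irreducible hπ.irreducible
  let _ := Ideal.Quotient.field (Ideal.span {π})
  have h2 : ringChar (GaussianInt ⧸ Ideal.span {π}) ≠ 2 := by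
    intro hc
    have h3 : ((2 : ℕ) : GaussianInt ⧸ Ideal.span {π}) = 0 := by
      rw [← hc]; exact CharP.cast_eq_zero _ _
    rw [← map_natCast (Ideal.Quotient.mk (Ideal.span {π})), Ideal.Quotient.eq_zero_iff_mem,
      Ideal.mem_span_singleton] at h3
    exact h.not_dvd_two hπ (by exact_mod_cast h3)
  obtain ⟨y, hy⟩ := FiniteField.exists_nonsquare h2
  obtain ⟨r, rfl⟩ := Ideal.Quotient.mk_surjective y
  refine ⟨r, ?_⟩
  rw [h.primeSymbol_eq hπ, if_neg, if_neg]
  · rintro ⟨x, hx⟩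
    refine hy ⟨Ideal.Quotient.mk _ x, ?_⟩
    rw [← map_mul, Ideal.Quotient.eq, Ideal.mem_span_singleton, ← dvd_neg]
    convert hx using 1; ring
  · intro hd
    refine hy ⟨0, ?_⟩
    rw [mul_zero, Ideal.Quotient.eq_zero_iff_mem, Ideal.mem_span_singleton]
    exact hd

theorem isCoprime_eight_of_isOdd {π : GaussianInt} (h : IsOddGaussian π) : IsCoprime π 8 := by
  have h1 : IsCoprime π ⟨1, 1⟩ := by
    rw [isCoprime_comm, prime_one_add_I.irreducible.coprime_iff_not_dvd, one_add_I_dvd_iff, not_not]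
    exact h
  -- Here (1 + i)^6 = -8i.
  refine h1.pow_right (n := 6) |>.of_isCoprime_of_dvd_right ⟨⟨0, -1⟩, ?_⟩
  ext <;> simp [pow_succ]

theorem IsFundamentalDiscriminant.ne_zero {D : GaussianInt} (hD : IsFundamentalDiscriminant D) :
    D ≠ 0 := by
  rintro rfl
  exact hD.not_isSquare IsSquare.zero

/-- A quadratic character `χ_D` of nonsquare `D` takes the value `-1`. -/
theorem exists_quadChar_eq_neg_one {D : GaussianInt} (hsq : ¬ IsSquare D)
    {Q : GaussianInt} (hQ : Q ≠ 0) (h8Q : 8 ∣ Q) (hDQ : D ∣ Q) :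
    ∃ c, IsCoprime c Q ∧ quadChar D c = -1 := by
  have hD : D ≠ 0 := by rintro rfl; exact hsq IsSquare.zero
  obtain ⟨E, F, rfl, hE⟩ := exists_eq_mul_sq hD
  have hE0 : E ≠ 0 := left_ne_zero_of_mul hD
  have hEQ : E ∣ Q := (dvd_mul_right _ _).trans hDQ
  have hFQ : F ∣ Q := (dvd_pow_self F two_ne_zero).trans ((dvd_mul_left _ _).trans hDQ)
  have hred : ∀ c, IsCoprime c Q → IsOddGaussian c ∧ quadChar (E * F ^ 2) c = quadChar E c := by
    intro c hc
    have hco : IsOddGaussian c := by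
      by_contra h
      refine prime_one_add_I.not_isUnit (hc.isUnit_of_dvd' (one_add_I_dvd_iff.mpr h) ?_)
      exact (one_add_I_dvd_iff.mpr (by simp only [IsOddGaussian]; decide)).trans h8Q
    refine ⟨hco, ?_⟩
    rw [quadChar_mul_left hco, sq, quadChar_mul_left hco, ← sq,
      quadChar_sq_eq_one hco.ne_zero (hc.of_isCoprime_of_dvd_right hFQ).symm, mul_one]
  -- If the squarefree part E has an odd prime factor ρ, take c to be a nonresidue modulo ρ and 1
  -- modulo the ρ-free part of Q, by the Chinese remainder theorem. Otherwise E is a unit or an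
  -- associate of 1 + i.
  by_cases hodd : ∃ π, Prime π ∧ IsOddGaussian π ∧ π ∣ E
  · obtain ⟨π, hπ, hπo, hπE⟩ := hodd
    obtain ⟨ρ, hρ, hρp⟩ := hπo.exists_primary
    have hρ' : Prime ρ := hρ.prime hπ
    obtain ⟨E', rfl⟩ := hρ.dvd_iff_dvd_left.mp hπE
    have hE'0 : E' ≠ 0 := right_ne_zero_of_mul hE0
    have hE' : IsCoprime ρ E' := by
      rw [hρ'.irreducible.coprime_iff_not_dvd]
      rintro ⟨c, rfl⟩
      exact hE ρ hρ' ⟨c, by ring⟩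
    obtain ⟨k, M, rfl, hM⟩ := exists_eq_pow_mul_not_dvd hρ' hQ
    have h8M : 8 ∣ M := dvd_of_dvd_pow_mul h8Q (isCoprime_eight_of_isOdd hρp.isOdd)
    have hE'M : E' ∣ M := dvd_of_dvd_pow_mul ((dvd_mul_left _ _).trans hEQ) hE'
    obtain ⟨r, hr⟩ := exists_primeSymbol_eq_neg_one hρ' hρp.isOdd
    obtain ⟨u, v, huv⟩ := hM
    have hc1 : ρ ∣ (1 + (r - 1) * (v * M)) - r := ⟨u * (1 - r), by linear_combination (r - 1) * huv⟩
    have hMz : M ∣ (r - 1) * (v * M) := (dvd_mul_left _ _).mul_left _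
    have hrρ : IsCoprime r ρ := by
      rw [isCoprime_comm, hρ'.irreducible.coprime_iff_not_dvd]
      intro h
      rw [primeSymbol, if_pos h] at hr
      norm_num at hr
    have hcop : IsCoprime (1 + (r - 1) * (v * M)) (ρ ^ k * M) := by
      refine IsCoprime.mul_right (isCoprime_of_dvd_sub hc1 hrρ).pow_right ?_
      exact isCoprime_of_dvd_sub (b := 1) (by rwa [add_sub_cancel_left]) isCoprime_one_left
    refine ⟨_, hcop, ?_⟩
    obtain ⟨hco, hF⟩ := hred _ hcop
    have h1p : IsPrimary 1 := ⟨by simp, by simp⟩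
    rw [hF, quadChar_mul_left hco, quadChar_add_of_odd hE'0 h1p.isOdd (h8M.trans hMz)
      (hE'M.trans hMz), quadChar_of_isUnit _ isUnit_one, mul_one,
      quadChar_comm hρp (h1p.add (h8M.trans hMz)), quadChar_of_prime _ hρ',
      primeSymbol_congr hρ' hρp.isOdd hc1, hr]
  · push Not at hodd
    -- Test points: 1 + 2i detects i, its norm being 5; 3 detects 1 + i and all its associates, as i
    -- has symbol 1 there.
    have key : ∃ c₀, IsOddGaussian c₀ ∧ quadChar E c₀ = -1 ∧ E ∣ 8 := by
      have hw8 : (⟨1, 1⟩ : GaussianInt) ∣ 8 := one_add_I_dvd_iff.mpr (by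
        simp only [IsOddGaussian]; decide)
      have o1 : IsOddGaussian ⟨1, 2⟩ := by simp only [IsOddGaussian]; decide
      have p3 : IsPrimary ⟨3, 0⟩ := ⟨by decide, by decide⟩
      have hI1 : quadChar ⟨0, 1⟩ ⟨1, 2⟩ = -1 := by
        rw [quadChar_I o1, show (Zsqrtd.norm (⟨1, 2⟩ : GaussianInt)).natAbs = 5 by rfl,
          jacobiSym.at_two (by decide)]
        decide
      have hI3 : quadChar ⟨0, 1⟩ ⟨3, 0⟩ = 1 := by
        rw [quadChar_I p3.isOdd, show (Zsqrtd.norm (⟨3, 0⟩ : GaussianInt)).natAbs = 9 by rfl,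
          jacobiSym.at_two (by decide)]
        decide
      have hw3 : quadChar ⟨1, 1⟩ ⟨3, 0⟩ = -1 := by
        rw [quadChar_one_add_I p3]
        decide
      by_cases hu : IsUnit E
      · refine ⟨⟨1, 2⟩, o1, ?_, hu.dvd⟩
        rcases eq_of_isUnit hu with rfl | rfl | rfl | rfl
        · exact absurd ⟨F, by ring⟩ hsq
        · exact absurd ⟨⟨0, 1⟩ * F, by
            have : (-1 : GaussianInt) = ⟨0, 1⟩ * ⟨0, 1⟩ := by ext <;> simp
            rw [this]; ring⟩ hsq
        · exact hI1
        · rw [quadChar_neg_left o1, hI1]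
      · obtain ⟨π, hπ, hπE⟩ := WfDvdMonoid.exists_irreducible_factor hu hE0
        have hass := associated_one_add_I hπ.prime (fun h => hodd π hπ.prime h hπE)
        obtain ⟨v, rfl⟩ := hass.dvd_iff_dvd_left.mpr hπE
        have hv : IsUnit v := by
          by_contra hv
          obtain ⟨ρ, hρ, hρv⟩ := WfDvdMonoid.exists_irreducible_factor hv (right_ne_zero_of_mul hE0)
          have hass' := associated_one_add_I hρ.prime
            (fun h => hodd ρ hρ.prime h (hρv.mul_left _))
          refine hE _ prime_one_add_I ?_
          rw [sq]
          exact mul_dvd_mul_left _ (hass'.dvd_iff_dvd_left.mpr hρv)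
        refine ⟨⟨3, 0⟩, p3.isOdd, ?_, (hv.mul_right_dvd).mpr hw8⟩
        rw [quadChar_mul_left p3.isOdd, hw3]
        rcases eq_of_isUnit hv with rfl | rfl | rfl | rfl
        · rw [quadChar_one_left p3.isOdd]; norm_num
        · rw [quadChar_neg_one_left p3.isOdd]; norm_num
        · rw [hI3]; norm_num
        · rw [quadChar_neg_left p3.isOdd, hI3]; norm_num
    obtain ⟨c₀, hc₀, hval, hE8⟩ := key
    obtain ⟨k, M, rfl, hM⟩ := exists_eq_pow_mul_not_dvd prime_one_add_I hQ
    have hMo : IsOddGaussian M := by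
      by_contra h
      exact prime_one_add_I.not_isUnit (hM.isUnit_of_dvd (one_add_I_dvd_iff.mpr h))
    obtain ⟨u, v, huv⟩ := isCoprime_eight_of_isOdd hMo
    have h8z : 8 ∣ (1 - c₀) * (v * 8) := (dvd_mul_left _ _).mul_left _
    have hcop : IsCoprime (c₀ + (1 - c₀) * (v * 8)) (⟨1, 1⟩ ^ k * M) := by
      refine IsCoprime.mul_right ?_ ?_
      · refine IsCoprime.pow_right ?_
        rw [isCoprime_comm, prime_one_add_I.irreducible.coprime_iff_not_dvd, one_add_I_dvd_iff,
          not_not]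
        exact hc₀.add h8z
      · exact isCoprime_of_dvd_sub (b := 1) ⟨u * (c₀ - 1), by linear_combination (1 - c₀) * huv⟩
          isCoprime_one_left
    refine ⟨_, hcop, ?_⟩
    rw [(hred _ hcop).2, quadChar_add_of_odd hE0 hc₀ h8z (hE8.trans h8z), hval]

/-! ### The character as a periodic function of two coordinates -/

/-- The modulus `8 N(D)`, of which `χ_D` is a periodic function in both coordinates. -/
def charModulus (D : GaussianInt) : ℕ := 8 * D.norm.natAbs

theorem charModulus_pos {D : GaussianInt} (hD : D ≠ 0) : 0 < charModulus D := by
  have : D.norm.natAbs ≠ 0 := by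
    rw [Int.natAbs_ne_zero, Ne, GaussianInt.norm_eq_zero]; exact hD
  unfold charModulus; omega

theorem eight_dvd_charModulus (D : GaussianInt) : 8 ∣ (charModulus D : GaussianInt) :=
  ⟨(D.norm.natAbs : ℕ), by unfold charModulus; push_cast; ring⟩

theorem dvd_charModulus (D : GaussianInt) : D ∣ (charModulus D : GaussianInt) := by
  refine ⟨star D * 8, ?_⟩
  rw [← mul_assoc, ← Zsqrtd.norm_eq_mul_conj, charModulus, Nat.cast_mul,
    ← Int.cast_natCast D.norm.natAbs, GaussianInt.abs_natCast_norm]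
  push_cast; ring

/-- The character `χ_D` on residues modulo `8 N(D)`. -/
noncomputable def residueChar (D : GaussianInt) (x : ZMod (charModulus D) × ZMod (charModulus D)) :
    ℤ :=
  quadChar D ⟨x.1.cast, x.2.cast⟩

theorem IsFundamentalDiscriminant.residueChar_mk {D : GaussianInt}
    (hD : IsFundamentalDiscriminant D) (n : GaussianInt) :
    residueChar D ((n.re : ZMod (charModulus D)), (n.im : ZMod (charModulus D))) =
      quadChar D n := by
  set Q := charModulus D with hQ
  obtain ⟨a, ha⟩ : (Q : ℤ) ∣ n.re - ((n.re : ZMod Q).cast : ℤ) := by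
    rw [← ZMod.intCast_eq_intCast_iff_dvd_sub]; simp
  obtain ⟨b, hb⟩ : (Q : ℤ) ∣ n.im - ((n.im : ZMod Q).cast : ℤ) := by
    rw [← ZMod.intCast_eq_intCast_iff_dvd_sub]; simp
  have hd : (Q : GaussianInt) ∣ (Q : GaussianInt) * ⟨a, b⟩ := dvd_mul_right _ _
  have h := hD.quadChar_add ⟨(n.re : ZMod Q).cast, (n.im : ZMod Q).cast⟩
    ((eight_dvd_charModulus D).trans hd) ((dvd_charModulus D).trans hd)
  rw [residueChar, ← h]
  congr 1
  ext
  · simp; linarith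
  · simp; linarith

/-- Multiplication by an invertible residue c with χ_D(c) = -1 permutes the residues and changes the
sign of the sum. -/
theorem IsFundamentalDiscriminant.sum_residueChar {D : GaussianInt}
    (hD : IsFundamentalDiscriminant D) [NeZero (charModulus D)] :
    ∑ x, residueChar D x = 0 := by
  set Q := charModulus D with hQ
  have hQ0 : (Q : GaussianInt) ≠ 0 := by
    rw [Ne, Nat.cast_eq_zero]; exact (charModulus_pos hD.ne_zero).ne'
  obtain ⟨c, hc, hval⟩ := exists_quadChar_eq_neg_one hD.not_isSquare hQ0
    (eight_dvd_charModulus D) (dvd_charModulus D)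
  obtain ⟨u, v, huv⟩ := hc
  have hre : ((u.re * c.re - u.im * c.im : ℤ) : ZMod Q) = 1 := by
    have h1 := congrArg Zsqrtd.re huv
    have h2 : u.re * c.re - u.im * c.im = 1 - v.re * Q := by
      simp at h1; linarith
    rw [h2]; simp
  have him : ((u.re * c.im + u.im * c.re : ℤ) : ZMod Q) = 0 := by
    have h1 := congrArg Zsqrtd.im huv
    have h2 : u.re * c.im + u.im * c.re = - v.im * Q := by
      simp at h1; linarith
    rw [h2]; simp
  push_cast at hre him
  let act : GaussianInt → ZMod Q × ZMod Q → ZMod Q × ZMod Q := fun w x =>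
    (w.re * x.1 - w.im * x.2, w.re * x.2 + w.im * x.1)
  have h1 : ∀ x, act u (act c x) = x := by
    intro x
    ext
    · simp only [act]; linear_combination x.1 * hre - x.2 * him
    · simp only [act]; linear_combination x.2 * hre + x.1 * him
  have h2 : ∀ x, act c (act u x) = x := by
    intro x
    ext
    · simp only [act]; linear_combination x.1 * hre - x.2 * him
    · simp only [act]; linear_combination x.2 * hre + x.1 * him
  have h3 : ∀ x, residueChar D (act c x) = -residueChar D x := by
    intro x
    have hx : x = (((x.1.cast : ℤ) : ZMod Q), ((x.2.cast : ℤ) : ZMod Q)) := by ext <;> simp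
    have e1 : act c x = (((c * ⟨x.1.cast, x.2.cast⟩ : GaussianInt).re : ZMod Q),
        ((c * ⟨x.1.cast, x.2.cast⟩ : GaussianInt).im : ZMod Q)) := by
      ext
      · simp [act]; ring
      · simp [act]
    rw [e1, hD.residueChar_mk, quadChar_mul, hval, residueChar]
    ring
  have h4 : ∑ x, residueChar D (act c x) = ∑ x, residueChar D x :=
    Equiv.sum_comp (⟨act c, act u, h1, h2⟩ : Equiv.Perm (ZMod Q × ZMod Q)) _
  simp only [h3, Finset.sum_neg_distrib] at h4
  exact self_eq_neg.mp h4.symm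

end GaussianQuadratic

namespace GaussianQuadratic

open MeasureTheory Real

/-! ### The Fourier transform of the disc -/

/-- The half-length of the chord of the disc of radius `R` at abscissa `x`. -/
noncomputable def halfChord (R x : ℝ) : ℝ := √(R ^ 2 - x ^ 2)

theorem continuous_halfChord (R : ℝ) : Continuous (halfChord R) := by
  unfold halfChord; fun_prop

theorem halfChord_eq_zero {R x : ℝ} (hR : 0 ≤ R) (h : R ≤ |x|) : halfChord R x = 0 :=
  Real.sqrt_eq_zero'.mpr (by nlinarith [sq_abs x])

theorem integrable_halfChord {R : ℝ} (hR : 0 ≤ R) : Integrable (halfChord R) := by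
  refine (continuous_halfChord R).integrable_of_hasCompactSupport ?_
  refine HasCompactSupport.intro (isCompact_Icc (a := -R) (b := R)) fun x hx => ?_
  refine halfChord_eq_zero hR ?_
  by_contra! h
  exact hx ⟨(abs_lt.mp h).1.le, (abs_lt.mp h).2.le⟩

/-- Near the edge, R² - x² = (R - |x|)(R + |x|) ≤ 2τ · 2R. -/
theorem halfChord_le {R τ x : ℝ} (hR : 0 ≤ R) (hτ : 0 ≤ τ) (h : R - 2 * τ ≤ |x|) :
    halfChord R x ≤ 2 * √(R * τ) := by
  rcases le_total R |x| with h' | h'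
  · rw [halfChord_eq_zero hR h']; positivity
  · have h2 : (2 : ℝ) = √(2 ^ 2) := by rw [Real.sqrt_sq]; norm_num
    rw [h2, ← Real.sqrt_mul (by norm_num)]
    refine Real.sqrt_le_sqrt ?_
    rw [← sq_abs x]
    nlinarith [abs_nonneg x]

/-- Concavity of the half circle. -/
theorem halfChord_midpoint {R τ x : ℝ} (h1 : |x| ≤ R) (h2 : |x + 2 * τ| ≤ R) :
    halfChord R x - 2 * halfChord R (x + τ) + halfChord R (x + 2 * τ) ≤ 0 := by
  have hA : 0 ≤ R ^ 2 - x ^ 2 := by nlinarith [sq_abs x, abs_nonneg x]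
  have hC : 0 ≤ R ^ 2 - (x + 2 * τ) ^ 2 := by
    nlinarith [sq_abs (x + 2 * τ), abs_nonneg (x + 2 * τ)]
  have hB : 0 ≤ R ^ 2 - (x + τ) ^ 2 := by nlinarith [sq_nonneg τ]
  unfold halfChord
  have h3 := Real.sq_sqrt hA
  have h4 := Real.sq_sqrt hB
  have h5 := Real.sq_sqrt hC
  have : √(R ^ 2 - x ^ 2) + √(R ^ 2 - (x + 2 * τ) ^ 2) ≤ 2 * √(R ^ 2 - (x + τ) ^ 2) := by
    refine abs_le_of_sq_le_sq' ?_ (by positivity) |>.2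
    nlinarith [sq_nonneg (√(R ^ 2 - x ^ 2) - √(R ^ 2 - (x + 2 * τ) ^ 2)), sq_nonneg τ]
  linarith

/-- The `L¹` norm of the second difference of the chord function. -/
theorem integral_abs_second_difference_le {R τ : ℝ} (hR : 0 ≤ R) (hτ : 0 ≤ τ) :
    ∫ x, |halfChord R x - 2 * halfChord R (x + τ) + halfChord R (x + 2 * τ)| ≤
      64 * τ * √(R * τ) := by
  set G : ℝ → ℝ := fun x => halfChord R x - 2 * halfChord R (x + τ) + halfChord R (x + 2 * τ)
  have hF := integrable_halfChord hR
  have i1 : Integrable fun x => 2 * halfChord R (x + τ) := (hF.comp_add_right τ).const_mul 2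
  have i2 : Integrable fun x => halfChord R (x + 2 * τ) := hF.comp_add_right (2 * τ)
  have i3 : Integrable fun x => halfChord R x - 2 * halfChord R (x + τ) := hF.sub i1
  have hG : Integrable G := i3.add i2
  have hG0 : ∫ x, G x = 0 := by
    simp only [G]
    rw [integral_add i3 i2, integral_sub hF i1, integral_const_mul,
      integral_add_right_eq_self, integral_add_right_eq_self]
    ring
  set S : Set ℝ := Set.Icc (-R - 2 * τ) (-R) ∪ Set.Icc (R - 2 * τ) R
  have hS : volume.real S ≤ 4 * τ := by
    refine (measureReal_union_le _ _).trans ?_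
    rw [Real.volume_real_Icc_of_le (by linarith), Real.volume_real_Icc_of_le (by linarith)]
    linarith
  have hSm : MeasurableSet S := measurableSet_Icc.union measurableSet_Icc
  have hSfin : volume S ≠ ⊤ := by
    refine ((measure_union_le _ _).trans_lt ?_).ne
    simp only [Real.volume_Icc]
    exact ENNReal.add_lt_top.mpr ⟨ENNReal.ofReal_lt_top, ENNReal.ofReal_lt_top⟩
  -- Since G has integral zero, its L¹ norm is the integral of |G| + G, twice the positive part.
  -- Concavity confines the positive part to S, two edge zones of length 2τ.
  have hpt : ∀ x, |G x| + G x ≤ S.indicator (fun _ => 16 * √(R * τ)) x := by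
    intro x
    have hle : ∀ y, R - 2 * τ ≤ |y| → halfChord R y ≤ 2 * √(R * τ) := fun y hy =>
      halfChord_le hR hτ hy
    have hnn : ∀ y, 0 ≤ halfChord R y := fun y => Real.sqrt_nonneg _
    by_cases hxS : x ∈ S
    · rw [Set.indicator_of_mem hxS]
      have h3 : R - 2 * τ ≤ |x| ∧ R - 2 * τ ≤ |x + τ| ∧ R - 2 * τ ≤ |x + 2 * τ| := by
        rcases hxS with ⟨h1, h2⟩ | ⟨h1, h2⟩
        · exact ⟨by rw [le_abs]; right; linarith, by rw [le_abs]; right; linarith,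
            by rw [le_abs]; right; linarith⟩
        · exact ⟨by rw [le_abs]; left; linarith, by rw [le_abs]; left; linarith,
            by rw [le_abs]; left; linarith⟩
      have h4 := hle _ h3.1
      have h5 := hle _ h3.2.1
      have h6 := hle _ h3.2.2
      have h7 : |G x| ≤ 8 * √(R * τ) := by
        rw [abs_le]
        constructor <;> simp only [G] <;> linarith [hnn x, hnn (x + τ), hnn (x + 2 * τ)]
      linarith [le_abs_self (G x)]
    · rw [Set.indicator_of_notMem hxS]
      have hneg : G x ≤ 0 := by
        by_cases h1 : |x| ≤ R ∧ |x + 2 * τ| ≤ R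
        · exact halfChord_midpoint h1.1 h1.2
        · have h0 : R ≤ |x| ∧ R ≤ |x + τ| ∧ R ≤ |x + 2 * τ| := by
            simp only [S, Set.mem_union, Set.mem_Icc, not_or, not_and, not_le] at hxS
            obtain ⟨h2, h3⟩ := hxS
            rcases lt_or_ge x (-R - 2 * τ) with h4 | h4
            · exact ⟨by rw [le_abs]; right; linarith, by rw [le_abs]; right; linarith,
                by rw [le_abs]; right; linarith⟩
            · have h5 := h2 h4
              rcases le_or_gt (R - 2 * τ) x with h6 | h6
              · have h7 := h3 h6
                exact ⟨by rw [le_abs]; left; linarith, by rw [le_abs]; left; linarith,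
                  by rw [le_abs]; left; linarith⟩
              · exact absurd ⟨abs_le.mpr ⟨by linarith, by linarith⟩,
                  abs_le.mpr ⟨by linarith, by linarith⟩⟩ h1
          simp only [G, halfChord_eq_zero hR h0.1, halfChord_eq_zero hR h0.2.1,
            halfChord_eq_zero hR h0.2.2]
          norm_num
      rw [abs_of_nonpos hneg]
      linarith
  calc ∫ x, |G x| = ∫ x, (|G x| + G x) := by rw [integral_add hG.abs hG, hG0, add_zero]
    _ ≤ ∫ x, S.indicator (fun _ => 16 * √(R * τ)) x := by
        refine integral_mono (hG.abs.add hG) ?_ hpt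
        exact (integrable_indicator_iff hSm).mpr (integrableOn_const hSfin)
    _ = volume.real S * (16 * √(R * τ)) := by
        rw [integral_indicator hSm, setIntegral_const, smul_eq_mul]
    _ ≤ 4 * τ * (16 * √(R * τ)) := by gcongr
    _ = _ := by ring

/-- A shift by half a period, τ = π/λ, changes the sign of the exponential. So four times the
integral is the exponential tested against the second difference of the chord, whose L¹ norm is
known. Decay in λ is discarded, only τ ≤ 1/2 being used. -/
theorem norm_integral_halfChord_le {R lam : ℝ} (hR : 0 ≤ R) (hl : 2 * π ≤ lam) :
    ‖∫ x : ℝ, (halfChord R x : ℂ) * Complex.exp (lam * x * Complex.I)‖ ≤ 8 * √R := by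
  have hl0 : 0 < lam := by linarith [pi_pos]
  set τ : ℝ := π / lam with hτ
  have hτ0 : 0 ≤ τ := by positivity
  have hτ1 : τ ≤ 1 / 2 := by
    rw [hτ, div_le_iff₀ hl0]; linarith
  set g : ℝ → ℂ := fun x => (halfChord R x : ℂ) * Complex.exp (lam * x * Complex.I) with hg
  set I := ∫ x, g x
  have hF := integrable_halfChord hR
  have hgi : Integrable g := by
    refine hF.ofReal.mul_bdd (c := 1) (by fun_prop) (Filter.Eventually.of_forall fun x => ?_)
    rw [← Complex.ofReal_mul, Complex.norm_exp_ofReal_mul_I]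
  have hexp : ∀ x : ℝ, Complex.exp (lam * (x + τ : ℝ) * Complex.I) =
      -Complex.exp (lam * x * Complex.I) := by
    intro x
    have : (lam * (x + τ : ℝ) * Complex.I : ℂ) = lam * x * Complex.I + π * Complex.I := by
      have : (lam : ℂ) ≠ 0 := by exact_mod_cast hl0.ne'
      rw [hτ]; push_cast; field_simp
    rw [this, Complex.exp_add, Complex.exp_pi_mul_I]; ring
  have h4 : 4 * I = ∫ x : ℝ, ((halfChord R x - 2 * halfChord R (x + τ) +
      halfChord R (x + 2 * τ) : ℝ) : ℂ) * Complex.exp (lam * x * Complex.I) := by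
    have e : ∀ x : ℝ, ((halfChord R x - 2 * halfChord R (x + τ) +
        halfChord R (x + 2 * τ) : ℝ) : ℂ) * Complex.exp (lam * x * Complex.I) =
        g x + 2 * g (x + τ) + g (x + 2 * τ) := by
      intro x
      have h2 := hexp (x + τ)
      rw [hexp x, neg_neg, add_assoc, ← two_mul] at h2
      simp only [hg, hexp x, h2]
      push_cast; ring
    simp only [e]
    have i1 : Integrable fun x => 2 * g (x + τ) := (hgi.comp_add_right τ).const_mul 2
    have i2 : Integrable fun x => g (x + 2 * τ) := hgi.comp_add_right (2 * τ)
    have i3 : Integrable fun x => g x + 2 * g (x + τ) := hgi.add i1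
    rw [integral_add i3 i2, integral_add hgi i1, integral_const_mul,
      integral_add_right_eq_self, integral_add_right_eq_self]
    ring
  have h5 : ‖4 * I‖ ≤ 64 * τ * √(R * τ) := by
    rw [h4]
    refine (norm_integral_le_integral_norm _).trans
      (le_trans (le_of_eq ?_) (integral_abs_second_difference_le hR hτ0))
    refine integral_congr_ae (Filter.Eventually.of_forall fun x => ?_)
    simp only
    rw [norm_mul, Complex.norm_real, Real.norm_eq_abs, ← Complex.ofReal_mul,
      Complex.norm_exp_ofReal_mul_I, mul_one]
  rw [norm_mul, Complex.norm_ofNat] at h5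
  have h6 : √(R * τ) ≤ √R := Real.sqrt_le_sqrt (by nlinarith)
  have h7 : 64 * τ * √(R * τ) ≤ 32 * √R := by
    have := Real.sqrt_nonneg (R * τ)
    nlinarith
  linarith

/-- Square-root cancellation in the Fourier transform of the disc of radius `R`, uniformly in
frequencies of absolute value at least `1`. -/
theorem norm_integral_disc_le {R : ℝ} (hR : 0 ≤ R) {κ : ℂ} (hκ : 1 ≤ ‖κ‖) :
    ‖∫ u in Metric.closedBall (0 : ℂ) R,
      Complex.exp (2 * π * (κ.re * u.re + κ.im * u.im : ℝ) * Complex.I)‖ ≤ 16 * √R := by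
  set lam : ℝ := 2 * π * ‖κ‖ with hlam
  set B := Metric.closedBall (0 : ℂ) R
  have hBm : MeasurableSet B := Metric.isClosed_closedBall.measurableSet
  set c : Circle := Circle.exp κ.arg with hc
  have hcκ : (‖κ‖ : ℂ) * c = κ := by
    rw [hc, Circle.coe_exp, Complex.norm_mul_exp_arg_mul_I]
  have hcc : (c : ℂ).re * (c : ℂ).re + (c : ℂ).im * (c : ℂ).im = 1 := by
    rw [← Complex.normSq_apply, Circle.normSq_coe]
  have hκre : κ.re = ‖κ‖ * (c : ℂ).re := by rw [← Complex.re_ofReal_mul, hcκ]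
  have hκim : κ.im = ‖κ‖ * (c : ℂ).im := by rw [← Complex.im_ofReal_mul, hcκ]
  -- The disc is invariant under rotation, so the frequency may be taken real.
  have h1 : ∫ u in B, Complex.exp (2 * π * (κ.re * u.re + κ.im * u.im : ℝ) * Complex.I) =
      ∫ v in B, Complex.exp (lam * v.re * Complex.I) := by
    have hT := (rotation c).measurePreserving.setIntegral_preimage_emb
      (rotation c).toHomeomorph.measurableEmbedding
      (fun u => Complex.exp (2 * π * (κ.re * u.re + κ.im * u.im : ℝ) * Complex.I)) B
    have hB : (rotation c) ⁻¹' B = B := by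
      ext v
      rw [Set.mem_preimage, mem_closedBall_zero_iff, LinearIsometryEquiv.norm_map,
        mem_closedBall_zero_iff]
    rw [← hT, hB]
    refine setIntegral_congr_fun hBm fun v _ => ?_
    have : κ.re * (rotation c v).re + κ.im * (rotation c v).im = ‖κ‖ * v.re := by
      rw [rotation_apply, Complex.mul_re, Complex.mul_im, hκre, hκim]
      linear_combination (‖κ‖ * v.re) * hcc
    simp only [this, hlam]
    push_cast; ring_nf
  have h2 : ∫ v in B, Complex.exp (lam * v.re * Complex.I) =
      2 * ∫ x : ℝ, (halfChord R x : ℂ) * Complex.exp (lam * x * Complex.I) := by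
    set e := Complex.measurableEquivRealProd.symm
    have he := Complex.volume_preserving_equiv_real_prod.symm.setIntegral_preimage_emb
      e.measurableEmbedding (fun v => Complex.exp (lam * v.re * Complex.I)) B
    have hmem : ∀ x y : ℝ, (x, y) ∈ e ⁻¹' B ↔ x ^ 2 + y ^ 2 ≤ R ^ 2 := by
      intro x y
      have : e (x, y) = ⟨x, y⟩ := rfl
      rw [Set.mem_preimage, this, mem_closedBall_zero_iff,
        ← sq_le_sq₀ (norm_nonneg _) hR, Complex.sq_norm, Complex.normSq_mk, ← sq, ← sq]
    have hm : MeasurableSet (e ⁻¹' B) := e.measurable hBm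
    rw [← he, ← integral_indicator hm, Measure.volume_eq_prod, integral_prod]
    · rw [← integral_const_mul]
      refine integral_congr_ae (Filter.Eventually.of_forall fun x => ?_)
      simp only
      set Sx : Set ℝ := {y | x ^ 2 + y ^ 2 ≤ R ^ 2} with hSx
      have hSm : MeasurableSet Sx := measurableSet_le (by fun_prop) (by fun_prop)
      have h3 : (fun y => (e ⁻¹' B).indicator (fun p => Complex.exp (lam * (e p).re * Complex.I))
          (x, y)) = Sx.indicator fun _ => Complex.exp (lam * x * Complex.I) := by
        ext y
        by_cases hy : y ∈ Sx
        · rw [Set.indicator_of_mem hy, Set.indicator_of_mem ((hmem x y).mpr hy)]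
          rfl
        · rw [Set.indicator_of_notMem hy, Set.indicator_of_notMem fun h => hy ((hmem x y).mp h)]
      rw [h3, integral_indicator hSm, setIntegral_const]
      have h4 : volume.real Sx = 2 * halfChord R x := by
        rcases le_or_gt |x| R with hx | hx
        · have h0 : 0 ≤ R ^ 2 - x ^ 2 := by nlinarith [sq_abs x, abs_nonneg x]
          have : Sx = Set.Icc (-halfChord R x) (halfChord R x) := by
            ext y
            rw [hSx, Set.mem_ofPred_eq, Set.mem_Icc, ← abs_le, halfChord, Real.le_sqrt (abs_nonneg _) h0, sq_abs]
            constructor <;> intro h <;> linarith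
          rw [this, Real.volume_real_Icc_of_le]
          · ring
          · linarith [show 0 ≤ halfChord R x from Real.sqrt_nonneg _]
        · have : Sx = ∅ := by
            ext y
            simp only [hSx, Set.mem_ofPred_eq, Set.mem_empty_iff_false, iff_false, not_le]
            nlinarith [sq_abs x, sq_nonneg y]
          rw [this, halfChord_eq_zero hR hx.le]
          simp
      rw [h4, Complex.real_smul]
      push_cast; ring
    · rw [← Measure.volume_eq_prod, integrable_indicator_iff hm]
      refine (Complex.volume_preserving_equiv_real_prod.symm.integrableOn_comp_preimage
        e.measurableEmbedding (f := fun v : ℂ => Complex.exp (lam * v.re * Complex.I))).mpr ?_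
      exact (by fun_prop : Continuous fun v : ℂ => Complex.exp (lam * v.re * Complex.I)).continuousOn
        |>.integrableOn_compact (isCompact_closedBall _ _)
  rw [h1, h2, norm_mul, Complex.norm_ofNat]
  have := norm_integral_halfChord_le hR (lam := lam) (by rw [hlam]; nlinarith [pi_pos])
  linarith

end GaussianQuadratic

namespace GaussianQuadratic

open MeasureTheory Real HurwitzZeta

/-! ### Gaussian mollification and lattice points in a shifted disc -/

theorem cosKernel_eq (x : ℝ) {s : ℝ} (hs : 0 < s) :
    cosKernel (x : UnitAddCircle) s = s ^ (-(1 / 2) : ℝ) * evenKernel (x : UnitAddCircle) (1 / s) := by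
  rw [evenKernel_functional_equation, one_div_one_div, one_div s, Real.inv_rpow hs.le,
    one_div (_⁻¹), inv_inv, ← mul_assoc, ← Real.rpow_add hs]
  norm_num

theorem hasSum_cosKernel_gaussian (x : ℝ) {s : ℝ} (hs : 0 < s) :
    HasSum (fun n : ℤ => s ^ (-(1 / 2) : ℝ) * rexp (-π * (n + x) ^ 2 * (1 / s)))
      (cosKernel (x : UnitAddCircle) s) := by
  rw [cosKernel_eq x hs]
  exact (hasSum_int_evenKernel x (by positivity)).mul_left _

theorem hasSum_cosKernel_zero {s : ℝ} (hs : 0 < s) :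
    HasSum (fun n : ℤ => rexp (-π * n ^ 2 * s)) (cosKernel 0 s) := by
  have h := hasSum_int_cosKernel 0 hs
  simp only [Complex.ofReal_zero, mul_zero, zero_mul, Complex.exp_zero, one_mul] at h
  exact_mod_cast h

theorem norm_char_mul_exp (x : ℝ) (n : ℤ) (s : ℝ) :
    ‖Complex.exp (2 * π * Complex.I * x * n) * (rexp (-π * n ^ 2 * s) : ℂ)‖ =
      rexp (-π * n ^ 2 * s) := by
  rw [norm_mul, Complex.norm_real, Real.norm_of_nonneg (Real.exp_pos _).le,
    show (2 * π * Complex.I * x * n : ℂ) = ((2 * π * x * n : ℝ) : ℂ) * Complex.I by push_cast; ring,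
    Complex.norm_exp_ofReal_mul_I, one_mul]

theorem cosKernel_nonneg (x : ℝ) {s : ℝ} (hs : 0 < s) : 0 ≤ cosKernel (x : UnitAddCircle) s :=
  (hasSum_cosKernel_gaussian x hs).nonneg fun _ => by positivity

theorem cosKernel_le_zero (x : ℝ) {s : ℝ} (hs : 0 < s) :
    cosKernel (x : UnitAddCircle) s ≤ cosKernel 0 s := by
  have h := (hasSum_int_cosKernel x hs).norm_le_of_bounded (hasSum_cosKernel_zero hs)
    fun n => (norm_char_mul_exp x n s).le
  rw [Complex.norm_real] at h
  exact (le_abs_self _).trans h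

theorem cosKernel_zero_antitone {s t : ℝ} (hs : 0 < s) (hst : s ≤ t) :
    cosKernel 0 t ≤ cosKernel 0 s :=
  hasSum_le (fun n => Real.exp_le_exp.mpr (by
    have : 0 ≤ π * (n : ℝ) ^ 2 := by positivity
    nlinarith)) (hasSum_cosKernel_zero (hs.trans_le hst)) (hasSum_cosKernel_zero hs)

/-- By the functional equation `cosKernel 0 s` is s^(-1/2) times the theta value at 1/s ≥ 1, and
theta is decreasing. -/
theorem cosKernel_zero_sq_le {s : ℝ} (hs : 0 < s) (hs1 : s ≤ 1) :
    cosKernel 0 s ^ 2 ≤ evenKernel 0 1 ^ 2 / s := by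
  have h0 := cosKernel_eq 0 hs
  have hz : ((0 : ℝ) : UnitAddCircle) = 0 := by simp
  rw [hz] at h0
  have hk := fun t (ht : 0 < t) => hz ▸ hasSum_int_evenKernel 0 (t := t) ht
  have hmono : evenKernel 0 (1 / s) ≤ evenKernel 0 1 := by
    refine hasSum_le (fun n => Real.exp_le_exp.mpr ?_) (hk (1 / s) (by positivity)) (hk 1 one_pos)
    have h1 : 1 ≤ 1 / s := by rw [le_div_iff₀ hs]; linarith
    have : 0 ≤ π * ((n : ℝ) + 0) ^ 2 := by positivity
    nlinarith
  have hnn : 0 ≤ evenKernel 0 (1 / s) :=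
    (hk (1 / s) (by positivity)).nonneg fun _ => (Real.exp_pos _).le
  have e : s ^ (-(1 / 2) * ((2 : ℕ) : ℝ)) = s⁻¹ := by norm_num [Real.rpow_neg_one]
  rw [h0, mul_pow, ← Real.rpow_natCast (s ^ _), ← Real.rpow_mul hs.le, e, div_eq_inv_mul (_ ^ 2)]
  gcongr

/-- The periodization of the Gaussian `s⁻¹ exp (-π |z|² / s)` over `ℤ[i]`. -/
noncomputable def periodicGaussian (s : ℝ) (z : ℂ) : ℝ :=
  cosKernel (z.re : UnitAddCircle) s * cosKernel (z.im : UnitAddCircle) s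

/-- The Gaussian probability density `s⁻¹ exp (-π |z|² / s)`. -/
noncomputable def gaussianDensity (s : ℝ) (z : ℂ) : ℝ := s⁻¹ * rexp (-(π / s) * ‖z‖ ^ 2)

/-- The lattice point with the given coordinates. -/
def latticePoint (p : ℤ × ℤ) : ℂ := ⟨p.1, p.2⟩

theorem hasSum_of_eq {ι α : Type*} [AddCommMonoid α] [TopologicalSpace α] {f g : ι → α} {a : α}
    (h : HasSum f a) (e : ∀ i, g i = f i) : HasSum g a :=
  (funext e : g = f) ▸ h

/-- Together with `hasSum_periodicGaussian_freq` this is Poisson summation for the Gaussian on ℤ[i].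
-/
theorem hasSum_periodicGaussian_space {s : ℝ} (hs : 0 < s) (z : ℂ) :
    HasSum (fun p : ℤ × ℤ => gaussianDensity s (latticePoint p + z)) (periodicGaussian s z) := by
  have h1 := hasSum_cosKernel_gaussian z.re hs
  have h2 := hasSum_cosKernel_gaussian z.im hs
  have h := h1.mul h2 (h1.summable.mul_of_nonneg h2.summable (fun _ => by positivity)
    (fun _ => by positivity))
  refine hasSum_of_eq h fun p => ?_
  have e1 : s ^ (-(1 / 2) : ℝ) * s ^ (-(1 / 2) : ℝ) = s⁻¹ := by
    rw [← Real.rpow_add hs]; norm_num [Real.rpow_neg_one]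
  have e2 : ‖latticePoint p + z‖ ^ 2 = (p.1 + z.re) ^ 2 + (p.2 + z.im) ^ 2 := by
    rw [Complex.sq_norm, Complex.normSq_apply, latticePoint]
    simp only [Complex.add_re, Complex.add_im]; ring
  rw [mul_mul_mul_comm, e1, ← Real.exp_add, gaussianDensity, e2]
  congr 2
  ring

theorem hasSum_mul_of_summable_norm {ι κ : Type*} {f : ι → ℂ} {g : κ → ℂ} {a b : ℂ}
    (hf : HasSum f a) (hg : HasSum g b) (hf' : Summable fun i => ‖f i‖)
    (hg' : Summable fun i => ‖g i‖) : HasSum (fun x : ι × κ => f x.1 * g x.2) (a * b) :=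
  hf.mul hg (summable_mul_of_summable_norm hf' hg')

theorem hasSum_periodicGaussian_freq {s : ℝ} (hs : 0 < s) (z : ℂ) :
    HasSum (fun k : ℤ × ℤ => (rexp (-π * (k.1 ^ 2 + k.2 ^ 2) * s) : ℂ) *
      Complex.exp (2 * π * (k.1 * z.re + k.2 * z.im : ℝ) * Complex.I))
      (periodicGaussian s z : ℂ) := by
  have h1 := hasSum_int_cosKernel z.re hs
  have h2 := hasSum_int_cosKernel z.im hs
  have h3 : ∀ x : ℝ, Summable fun n : ℤ =>
      ‖Complex.exp (2 * π * Complex.I * x * n) * (rexp (-π * n ^ 2 * s) : ℂ)‖ := fun x => by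
    simp only [norm_char_mul_exp]
    exact (hasSum_cosKernel_zero hs).summable
  have h := hasSum_mul_of_summable_norm h1 h2 (h3 _) (h3 _)
  rw [periodicGaussian, Complex.ofReal_mul]
  refine hasSum_of_eq h fun k => ?_
  rw [mul_mul_mul_comm, ← Complex.exp_add, ← Complex.ofReal_mul, ← Real.exp_add, mul_comm]
  refine congrArg₂ (· * ·) (congrArg Complex.exp ?_)
    (congrArg Complex.ofReal (congrArg rexp (by ring)))
  push_cast; ring

theorem hasSum_gaussian_freq {s : ℝ} (hs : 0 < s) :
    HasSum (fun k : ℤ × ℤ => rexp (-π * (k.1 ^ 2 + k.2 ^ 2) * s)) (cosKernel 0 s ^ 2) := by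
  have h1 := hasSum_cosKernel_zero hs
  have h := h1.mul h1 (h1.summable.mul_of_nonneg h1.summable (fun _ => (Real.exp_pos _).le)
    (fun _ => (Real.exp_pos _).le))
  rw [sq]
  refine hasSum_of_eq h fun k => ?_
  rw [← Real.exp_add]
  congr 1; ring

theorem periodicGaussian_le {s : ℝ} (hs : 0 < s) (z : ℂ) :
    periodicGaussian s z ≤ cosKernel 0 s ^ 2 := by
  rw [periodicGaussian, sq]
  exact mul_le_mul (cosKernel_le_zero _ hs) (cosKernel_le_zero _ hs) (cosKernel_nonneg _ hs)
    ((cosKernel_nonneg z.re hs).trans (cosKernel_le_zero _ hs))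

theorem continuous_periodicGaussian {s : ℝ} (hs : 0 < s) : Continuous (periodicGaussian s) := by
  have h : Continuous fun z : ℂ => ∑' k : ℤ × ℤ, (rexp (-π * (k.1 ^ 2 + k.2 ^ 2) * s) : ℂ) *
      Complex.exp (2 * π * (k.1 * z.re + k.2 * z.im : ℝ) * Complex.I) := by
    refine continuous_tsum (fun k => by fun_prop) (hasSum_gaussian_freq hs).summable fun k z => ?_
    rw [norm_mul, ← Complex.ofReal_ofNat, ← Complex.ofReal_mul, ← Complex.ofReal_mul,
      Complex.norm_exp_ofReal_mul_I, mul_one, Complex.norm_real,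
      Real.norm_of_nonneg (Real.exp_pos _).le]
  simp only [fun z => (hasSum_periodicGaussian_freq hs z).tsum_eq] at h
  exact Complex.continuous_re.comp h


end GaussianQuadratic

namespace GaussianQuadratic

open MeasureTheory Real HurwitzZeta

/-- Serves to split off the zero frequency, which carries the main term π ρ². -/
theorem abs_sub_le_of_hasSum {ι : Type*} {c : ι → ℂ} {b : ι → ℝ} {x v y : ℝ} (i₀ : ι)
    (h : HasSum c (x : ℂ)) (hb : HasSum b y) (h0 : c i₀ = v) (hb0 : 0 ≤ b i₀)
    (hle : ∀ i, i ≠ i₀ → ‖c i‖ ≤ b i) : |x - v| ≤ y := by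
  classical
  have h1 := (hasSum_ite_sub_hasSum h i₀).norm_le_of_bounded hb fun i => by
    split_ifs with hi
    · rw [norm_zero, hi]; exact hb0
    · exact hle i hi
  rwa [h0, ← Complex.ofReal_sub, Complex.norm_real] at h1

/-- The mollified lattice point count in a shifted disc. -/
theorem abs_integral_periodicGaussian_sub_le {s ρ : ℝ} (hs : 0 < s) (hρ : 0 ≤ ρ) (a : ℂ) :
    |(∫ u in Metric.closedBall (0 : ℂ) ρ, periodicGaussian s (a - u)) - π * ρ ^ 2| ≤
      16 * √ρ * cosKernel 0 s ^ 2 := by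
  set B := Metric.closedBall (0 : ℂ) ρ
  have hBfin : volume B ≠ ⊤ := (isCompact_closedBall (0 : ℂ) ρ).measure_lt_top.ne
  have hBvol : volume.real B = π * ρ ^ 2 := by
    rw [measureReal_def, Complex.volume_closedBall, ENNReal.toReal_mul, ENNReal.toReal_pow,
      ENNReal.toReal_ofReal hρ]
    simp [mul_comm]
  set F : ℤ × ℤ → ℂ → ℂ := fun k u => (rexp (-π * (k.1 ^ 2 + k.2 ^ 2) * s) : ℂ) *
      Complex.exp (2 * π * (k.1 * (a - u).re + k.2 * (a - u).im : ℝ) * Complex.I) with hF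
  have hFc : ∀ k, Continuous (F k) := fun k => by
    simp only [F]; fun_prop
  have hnorm : ∀ k u, ‖F k u‖ = rexp (-π * (k.1 ^ 2 + k.2 ^ 2) * s) := by
    intro k u
    simp only [F]
    rw [norm_mul, ← Complex.ofReal_ofNat, ← Complex.ofReal_mul, ← Complex.ofReal_mul,
      Complex.norm_exp_ofReal_mul_I, mul_one, Complex.norm_real,
      Real.norm_of_nonneg (Real.exp_pos _).le]
  have hsum := hasSum_integral_of_summable_integral_norm (μ := volume.restrict B) (F := F)
    (fun k => (hFc k).continuousOn.integrableOn_compact (isCompact_closedBall _ _)) (by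
      simp only [hnorm, setIntegral_const, smul_eq_mul]
      exact (hasSum_gaussian_freq hs).summable.mul_left _)
  have hval : ∀ u, ∑' k, F k u = (periodicGaussian s (a - u) : ℂ) := fun u =>
    (hasSum_periodicGaussian_freq hs (a - u)).tsum_eq
  have hF0 : ∫ u in B, F (0, 0) u = (π * ρ ^ 2 : ℝ) := by
    simp [F, hBvol]
  have hFk : ∀ k, k ≠ (0, 0) → ‖∫ u in B, F k u‖ ≤
      16 * √ρ * rexp (-π * (k.1 ^ 2 + k.2 ^ 2) * s) := by
    intro k hk
    obtain ⟨κ, hre, him⟩ : ∃ κ : ℂ, κ.re = -k.1 ∧ κ.im = -k.2 := ⟨⟨-k.1, -k.2⟩, rfl, rfl⟩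
    have e : ∀ u : ℂ, F k u = ((rexp (-π * (k.1 ^ 2 + k.2 ^ 2) * s) : ℂ) *
        Complex.exp ((2 * π * (k.1 * a.re + k.2 * a.im) : ℝ) * Complex.I)) *
        Complex.exp (2 * π * (κ.re * u.re + κ.im * u.im : ℝ) * Complex.I) := by
      intro u
      rw [mul_assoc, ← Complex.exp_add]
      simp only [F]
      congr 2
      rw [Complex.sub_re, Complex.sub_im, hre, him]
      push_cast; ring
    simp only [e]
    rw [integral_const_mul, norm_mul, norm_mul,
      Complex.norm_exp_ofReal_mul_I, mul_one, Complex.norm_real,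
      Real.norm_of_nonneg (Real.exp_pos _).le, mul_comm]
    refine mul_le_mul_of_nonneg_right (norm_integral_disc_le hρ ?_) (Real.exp_pos _).le
    have h1 : (1 : ℝ) ≤ (k.1 : ℝ) ^ 2 + (k.2 : ℝ) ^ 2 := by
      have : (1 : ℤ) ≤ k.1 ^ 2 + k.2 ^ 2 := by
        by_contra! h
        have h2 : k.1 ^ 2 = 0 := by nlinarith [sq_nonneg k.1, sq_nonneg k.2]
        have h3 : k.2 ^ 2 = 0 := by nlinarith [sq_nonneg k.1, sq_nonneg k.2]
        exact hk (Prod.ext (pow_eq_zero_iff two_ne_zero |>.mp h2)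
          (pow_eq_zero_iff two_ne_zero |>.mp h3))
      exact_mod_cast this
    rw [← sq_le_sq₀ zero_le_one (norm_nonneg _), Complex.sq_norm, Complex.normSq_apply, hre, him]
    linarith
  clear_value F
  simp only [hval] at hsum
  rw [integral_complex_ofReal] at hsum
  exact abs_sub_le_of_hasSum (0, 0) hsum ((hasSum_gaussian_freq hs).mul_left (16 * √ρ)) hF0
    (by positivity) hFk

end GaussianQuadratic

/-! ### Counting lattice points in a shifted disc -/

namespace GaussianQuadratic

open MeasureTheory Real HurwitzZeta

theorem gaussianDensity_nonneg {s : ℝ} (hs : 0 < s) (z : ℂ) : 0 ≤ gaussianDensity s z := by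
  unfold gaussianDensity; positivity

theorem continuous_gaussianDensity (s : ℝ) : Continuous (gaussianDensity s) := by
  unfold gaussianDensity; fun_prop

theorem integral_gaussianDensity {s : ℝ} (hs : 0 < s) : ∫ z, gaussianDensity s z = 1 := by
  unfold gaussianDensity
  rw [integral_const_mul, GaussianFourier.integral_rexp_neg_mul_sq_norm (by positivity),
    Complex.finrank_real_complex]
  norm_num
  field_simp

/-- Otherwise the integral would have the default value 0 instead of 1. -/
theorem integrable_gaussianDensity {s : ℝ} (hs : 0 < s) : Integrable (gaussianDensity s) := by
  by_contra h
  have := integral_gaussianDensity hs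
  rw [integral_undef h] at this
  norm_num at this

/-- Decay of the Gaussian density away from a disc of radius `r`. -/
theorem gaussianDensity_le {s r : ℝ} (hs : 0 < s) (hr : 0 ≤ r) {z : ℂ} (hz : r ≤ ‖z‖) :
    gaussianDensity s z ≤ 2 * rexp (-π * r ^ 2 / (2 * s)) * gaussianDensity (2 * s) z := by
  have h1 : -(π / s) * ‖z‖ ^ 2 ≤ -π * r ^ 2 / (2 * s) + -(π / (2 * s)) * ‖z‖ ^ 2 := by
    have h2 : r ^ 2 ≤ ‖z‖ ^ 2 := by gcongr
    have h3 : 0 ≤ π / (2 * s) * (‖z‖ ^ 2 - r ^ 2) :=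
      mul_nonneg (by positivity) (by linarith)
    have h4 : -π * r ^ 2 / (2 * s) = -(π / (2 * s)) * r ^ 2 := by ring
    have h5 : π / s = 2 * (π / (2 * s)) := by field_simp
    rw [h4, h5]
    linarith
  unfold gaussianDensity
  calc s⁻¹ * rexp (-(π / s) * ‖z‖ ^ 2)
      ≤ s⁻¹ * rexp (-π * r ^ 2 / (2 * s) + -(π / (2 * s)) * ‖z‖ ^ 2) := by gcongr
    _ = _ := by
      rw [Real.exp_add, mul_inv]
      ring

/-- The disc contains the disc of radius r about z, and beyond distance r the density is dominated
by a small multiple of the one with parameter 2s. -/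
theorem integral_disc_gaussianDensity_ge {s r ρ : ℝ} (hs : 0 < s) (hr : 0 ≤ r) {z : ℂ}
    (hz : ‖z‖ + r ≤ ρ) :
    1 - 2 * rexp (-π * r ^ 2 / (2 * s)) ≤
      ∫ u in Metric.closedBall (0 : ℂ) ρ, gaussianDensity s (z - u) := by
  set η := 2 * rexp (-π * r ^ 2 / (2 * s))
  set B := Metric.closedBall (0 : ℂ) ρ
  have hB : MeasurableSet B := Metric.isClosed_closedBall.measurableSet
  have hη : 0 ≤ η := by positivity
  have i1 := integrable_gaussianDensity hs
  have i2 := (integrable_gaussianDensity (s := 2 * s) (by positivity)).const_mul η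
  have e1 : ∫ v, (gaussianDensity s v - η * gaussianDensity (2 * s) v) = 1 - η := by
    rw [integral_sub i1 i2, integral_const_mul, integral_gaussianDensity hs,
      integral_gaussianDensity (by positivity), mul_one]
  have e2 : ∫ u in B, gaussianDensity s (z - u) =
      ∫ v, (B.indicator (fun u => gaussianDensity s (z - u))) (z - v) := by
    rw [integral_sub_left_eq_self (fun u => B.indicator (fun u => gaussianDensity s (z - u)) u)
      volume z, integral_indicator hB]
  rw [← e1, e2]
  have i3 : Integrable (B.indicator fun u => gaussianDensity s (z - u)) :=
    (integrable_indicator_iff hB).mpr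
      (((continuous_gaussianDensity s).comp (continuous_const.sub continuous_id)).continuousOn
        |>.integrableOn_compact (isCompact_closedBall _ _))
  refine integral_mono (i1.sub i2) (i3.comp_sub_left z) fun v => ?_
  simp only
  by_cases hv : z - v ∈ B
  · rw [Set.indicator_of_mem hv, sub_sub_cancel]
    have := mul_nonneg hη (gaussianDensity_nonneg (s := 2 * s) (by positivity) v)
    linarith
  · rw [Set.indicator_of_notMem hv]
    have h1 : r ≤ ‖v‖ := by
      by_contra! h
      refine hv (mem_closedBall_zero_iff.mpr ?_)
      linarith [norm_sub_le z v]
    linarith [gaussianDensity_le hs hr h1]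

theorem integral_disc_gaussianDensity_le {s : ℝ} (hs : 0 < s) (ρ : ℝ) (z : ℂ) :
    ∫ u in Metric.closedBall (0 : ℂ) ρ, gaussianDensity s (z - u) ≤ 1 := by
  have i1 := (integrable_gaussianDensity hs).comp_sub_left z
  calc _ ≤ ∫ u, gaussianDensity s (z - u) :=
        setIntegral_le_integral i1 (Filter.Eventually.of_forall fun u => gaussianDensity_nonneg hs _)
    _ = 1 := by rw [integral_sub_left_eq_self, integral_gaussianDensity hs]

section

variable {R r s : ℝ} {a : ℂ} {F : Finset (ℤ × ℤ)}

theorem integrableOn_gaussianDensity (s ρ : ℝ) (z : ℂ) :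
    IntegrableOn (fun u => gaussianDensity s (z - u)) (Metric.closedBall (0 : ℂ) ρ) :=
  ((continuous_gaussianDensity s).comp (continuous_const.sub continuous_id)).continuousOn
    |>.integrableOn_compact (isCompact_closedBall _ _)

theorem integrableOn_periodicGaussian (hs : 0 < s) (ρ : ℝ) :
    IntegrableOn (fun u => periodicGaussian s (a - u)) (Metric.closedBall (0 : ℂ) ρ) :=
  ((continuous_periodicGaussian hs).comp (continuous_const.sub continuous_id)).continuousOn
    |>.integrableOn_compact (isCompact_closedBall _ _)

/-- Upper bound for the number of lattice points in a shifted disc. -/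
theorem card_mul_le_integral (hs : 0 < s) (hr : 0 ≤ r) (hF : ∀ p ∈ F, ‖latticePoint p + a‖ ≤ R) :
    F.card * (1 - 2 * rexp (-π * r ^ 2 / (2 * s))) ≤
      ∫ u in Metric.closedBall (0 : ℂ) (R + r), periodicGaussian s (a - u) := by
  set B := Metric.closedBall (0 : ℂ) (R + r)
  calc F.card * (1 - 2 * rexp (-π * r ^ 2 / (2 * s)))
      = ∑ _p ∈ F, (1 - 2 * rexp (-π * r ^ 2 / (2 * s))) := by rw [Finset.sum_const, nsmul_eq_mul]
    _ ≤ ∑ p ∈ F, ∫ u in B, gaussianDensity s (latticePoint p + a - u) :=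
        Finset.sum_le_sum fun p hp =>
          integral_disc_gaussianDensity_ge hs hr (by linarith [hF p hp])
    _ = ∫ u in B, ∑ p ∈ F, gaussianDensity s (latticePoint p + a - u) :=
        (integral_finsetSum _ fun p _ => integrableOn_gaussianDensity s _ _).symm
    _ ≤ ∫ u in B, periodicGaussian s (a - u) := by
        refine setIntegral_mono (integrable_finsetSum _ fun p _ =>
          integrableOn_gaussianDensity s _ _) (integrableOn_periodicGaussian hs _) fun u => ?_
        simp only [add_sub_assoc]
        exact sum_le_hasSum F (fun p _ => gaussianDensity_nonneg hs _)
          (hasSum_periodicGaussian_space hs (a - u))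

/-- Lower bound for the number of lattice points in a shifted disc. -/
theorem integral_le_card_add (hs : 0 < s) (hr : 0 ≤ r) (hrR : r ≤ R)
    (hF : ∀ p, ‖latticePoint p + a‖ ≤ R → p ∈ F) :
    ∫ u in Metric.closedBall (0 : ℂ) (R - r), periodicGaussian s (a - u) ≤
      F.card + π * R ^ 2 * (2 * rexp (-π * r ^ 2 / (2 * s)) * cosKernel 0 s ^ 2) := by
  classical
  set B := Metric.closedBall (0 : ℂ) (R - r)
  set η := 2 * rexp (-π * r ^ 2 / (2 * s))
  have hη : 0 ≤ η := by positivity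
  have hBfin : volume B ≠ ⊤ := (isCompact_closedBall (0 : ℂ) _).measure_lt_top.ne
  have hBvol : volume.real B ≤ π * R ^ 2 := by
    rw [measureReal_def, Complex.volume_closedBall, ENNReal.toReal_mul, ENNReal.toReal_pow,
      ENNReal.toReal_ofReal (by linarith), mul_comm]
    have : (R - r) ^ 2 ≤ R ^ 2 := by
      apply pow_le_pow_left₀ <;> linarith
    simpa using mul_le_mul_of_nonneg_left this pi_pos.le
  -- Lattice points outside radius R lie at distance at least r from every u, so their total is a
  -- small multiple of the periodic Gaussian with parameter 2s.
  have hpt : ∀ u ∈ B, periodicGaussian s (a - u) ≤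
      ∑ p ∈ F, gaussianDensity s (latticePoint p + a - u) + η * cosKernel 0 s ^ 2 := by
    intro u hu
    have h2 := hasSum_periodicGaussian_space (s := 2 * s) (by positivity) (a - u)
    have h3 : periodicGaussian (2 * s) (a - u) ≤ cosKernel 0 s ^ 2 := by
      refine (periodicGaussian_le (by positivity) _).trans ?_
      have h0 : 0 ≤ cosKernel 0 (2 * s) := (hasSum_cosKernel_zero (by positivity)).nonneg
        fun _ => (Real.exp_pos _).le
      exact pow_le_pow_left₀ h0 (cosKernel_zero_antitone hs (by linarith)) 2
    have h4 : HasSum (fun p => if p ∈ F then gaussianDensity s (latticePoint p + (a - u)) else 0)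
        (∑ p ∈ F, gaussianDensity s (latticePoint p + (a - u))) := by
      have : HasSum (fun p => if p ∈ F then gaussianDensity s (latticePoint p + (a - u)) else 0)
          (∑ p ∈ F, if p ∈ F then gaussianDensity s (latticePoint p + (a - u)) else 0) :=
        hasSum_sum_of_ne_finset_zero fun p hp => if_neg hp
      rwa [Finset.sum_congr rfl fun p hp => if_pos hp] at this
    have h5 := hasSum_le (fun p => ?_) (hasSum_periodicGaussian_space hs (a - u))
      (h4.add (h2.mul_left η))
    · simp only [add_sub_assoc]
      refine h5.trans (by gcongr)
    · split_ifs with hp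
      · have := mul_nonneg hη (gaussianDensity_nonneg (s := 2 * s) (by positivity)
          (latticePoint p + (a - u)))
        linarith
      · rw [zero_add]
        refine gaussianDensity_le hs hr ?_
        have h6 : R < ‖latticePoint p + a‖ := by
          by_contra! h
          exact hp (hF p h)
        have h7 := mem_closedBall_zero_iff.mp hu
        have h8 := norm_sub_norm_le (latticePoint p + a) u
        rw [add_sub_assoc] at h8
        linarith
  have i1 : IntegrableOn (fun u => ∑ p ∈ F, gaussianDensity s (latticePoint p + a - u)) B :=
    integrable_finsetSum _ fun p _ => integrableOn_gaussianDensity s _ _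
  have i2 : IntegrableOn (fun _ : ℂ => η * cosKernel 0 s ^ 2) B := integrableOn_const hBfin
  calc ∫ u in B, periodicGaussian s (a - u)
      ≤ ∫ u in B, (∑ p ∈ F, gaussianDensity s (latticePoint p + a - u) + η * cosKernel 0 s ^ 2) :=
        setIntegral_mono_on (integrableOn_periodicGaussian hs _) (i1.add i2)
          Metric.isClosed_closedBall.measurableSet hpt
    _ = (∑ p ∈ F, ∫ u in B, gaussianDensity s (latticePoint p + a - u)) +
          volume.real B * (η * cosKernel 0 s ^ 2) := by
        rw [integral_add i1 i2, integral_finsetSum _ fun p _ => integrableOn_gaussianDensity s _ _,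
          setIntegral_const, smul_eq_mul]
    _ ≤ F.card + π * R ^ 2 * (η * cosKernel 0 s ^ 2) := by
        gcongr
        calc _ ≤ ∑ _p ∈ F, (1 : ℝ) :=
              Finset.sum_le_sum fun p _ => integral_disc_gaussianDensity_le hs _ _
          _ = F.card := by simp

end

/-- Lattice points in a shifted disc of radius `t ^ 16`, with a power-saving error term that is
uniform in the shift. -/
theorem exists_lattice_disc_bound : ∃ C : ℝ, 0 < C ∧ ∀ (t : ℝ), 1 ≤ t → ∀ (a : ℂ)
    (F : Finset (ℤ × ℤ)), (∀ p, p ∈ F ↔ ‖latticePoint p + a‖ ≤ t ^ 16) →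
      |(F.card : ℝ) - π * t ^ 32| ≤ C * t ^ 15 := by
  set A := evenKernel 0 1 ^ 2 with hA
  have hA0 : 0 ≤ A := by positivity
  -- The sharp upper bound contains the error `F.card * η`, so a count of the right order is needed
  -- beforehand; fixed smoothing s = 1, r = 2 provides it.
  have crude : ∀ (t : ℝ), 1 ≤ t → ∀ (a : ℂ) (F : Finset (ℤ × ℤ)),
      (∀ p, p ∈ F ↔ ‖latticePoint p + a‖ ≤ t ^ 16) → (F.card : ℝ) ≤ (72 + 64 * A) * t ^ 32 := by
    intro t ht a F hF
    have h1 := card_mul_le_integral (s := 1) (r := 2) one_pos two_pos.le (fun p hp => (hF p).mp hp)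
    have ht16 : 1 ≤ t ^ 16 := one_le_pow₀ ht
    have h2 := abs_le.mp (abs_integral_periodicGaussian_sub_le (s := 1) (ρ := t ^ 16 + 2) one_pos
      (by positivity) a)
    have h3 := cosKernel_zero_sq_le one_pos le_rfl
    rw [div_one] at h3
    have h4 : rexp (-π * 2 ^ 2 / (2 * 1)) ≤ 1 / 4 := by
      have h5 := Real.add_one_le_exp (2 * π)
      rw [show -π * 2 ^ 2 / (2 * 1) = -(2 * π) by ring, Real.exp_neg, inv_le_comm₀ (Real.exp_pos _)
        (by norm_num)]
      linarith [pi_gt_three]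
    have h6 : √(t ^ 16 + 2) ≤ 2 * t ^ 32 := by
      rw [Real.sqrt_le_left (by positivity)]
      have : t ^ 32 = t ^ 16 * t ^ 16 := by ring
      rw [this]
      nlinarith [mul_le_mul ht16 ht16 zero_le_one (by positivity), sq_nonneg (t ^ 16)]
    have h7 : (F.card : ℝ) * (1 / 2) ≤ F.card * (1 - 2 * rexp (-π * 2 ^ 2 / (2 * 1))) := by
      gcongr; linarith
    have h8 : π * (t ^ 16 + 2) ^ 2 ≤ 36 * t ^ 32 := by
      have h9 : (t ^ 16 + 2) ^ 2 ≤ 9 * t ^ 32 := by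
        have : t ^ 32 = t ^ 16 * t ^ 16 := by ring
        rw [this]
        nlinarith
      calc π * (t ^ 16 + 2) ^ 2 ≤ 4 * (9 * t ^ 32) := by
            gcongr; exact pi_le_four
        _ = _ := by ring
    have h10 : 16 * √(t ^ 16 + 2) * cosKernel 0 1 ^ 2 ≤ 16 * (2 * t ^ 32) * A := by gcongr
    linarith
  set K : ℝ := 2 * (Nat.factorial 20 : ℝ) with hK
  have hK0 : 0 ≤ K := by positivity
  refine ⟨8 * π + 64 * A + K * (72 + 64 * A) + 4 * K * A + 1, by positivity, fun t ht a F hF => ?_⟩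
  have ht0 : 0 < t := by linarith
  have hpow : ∀ m n : ℕ, m ≤ n → t ^ m ≤ t ^ n := fun m n h => pow_le_pow_right₀ ht h
  -- With R = t^16, widening the disc by r costs rR = t^15, and the nonzero frequencies cost √R/s =
  -- t^12. As r²/s = t², the Gaussian tail η is exponentially small.
  set s : ℝ := (t ^ 4)⁻¹ with hs
  set r : ℝ := t⁻¹ with hr
  have hs0 : 0 < s := by positivity
  have hs1 : s ≤ 1 := inv_le_one_of_one_le₀ (one_le_pow₀ ht)
  have hr0 : 0 ≤ r := by positivity
  have hr1 : r ≤ 1 := inv_le_one_of_one_le₀ ht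
  have ht16 : 1 ≤ t ^ 16 := one_le_pow₀ ht
  have hrR : r * t ^ 16 = t ^ 15 := by rw [hr]; field_simp
  set η := 2 * rexp (-π * r ^ 2 / (2 * s)) with hη
  have hη0 : 0 ≤ η := by positivity
  -- The tail meets at most t^32 · t^4, area times frequency sum, so any power from t^36 on would
  -- do.
  have hη40 : η * t ^ 40 ≤ K := by
    have e1 : -π * r ^ 2 / (2 * s) = -(π / 2 * t ^ 2) := by
      rw [hr, hs]; field_simp
    have h1 := Real.pow_div_factorial_le_exp (t ^ 2) (by positivity) 20
    have h2 : rexp (t ^ 2) ≤ rexp (π / 2 * t ^ 2) := by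
      apply Real.exp_le_exp.mpr
      nlinarith [pi_gt_three, sq_nonneg t]
    have h3 : t ^ 40 ≤ (Nat.factorial 20 : ℝ) * rexp (π / 2 * t ^ 2) := by
      rw [div_le_iff₀ (by positivity), ← pow_mul] at h1
      calc t ^ 40 ≤ rexp (t ^ 2) * (Nat.factorial 20 : ℝ) := h1
        _ ≤ rexp (π / 2 * t ^ 2) * (Nat.factorial 20 : ℝ) := by gcongr
        _ = _ := mul_comm _ _
    rw [hη, e1, Real.exp_neg, hK]
    have h4 := Real.exp_pos (π / 2 * t ^ 2)
    rw [mul_assoc, inv_mul_eq_div]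
    gcongr
    rw [div_le_iff₀ h4]
    exact h3
  have hcos : cosKernel 0 s ^ 2 ≤ A * t ^ 4 := by
    refine (cosKernel_zero_sq_le hs0 hs1).trans (le_of_eq ?_)
    rw [hs, div_inv_eq_mul]
  have hη32 : η * t ^ 32 ≤ K := by
    refine le_trans ?_ hη40
    exact mul_le_mul_of_nonneg_left (hpow _ _ (by norm_num)) hη0
  have hη36 : η * t ^ 36 ≤ K := by
    refine le_trans ?_ hη40
    exact mul_le_mul_of_nonneg_left (hpow _ _ (by norm_num)) hη0
  have hone : 1 ≤ t ^ 15 := one_le_pow₀ ht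
  rw [abs_le]
  constructor
  · have h1 := integral_le_card_add hs0 hr0 (R := t ^ 16) (by linarith) fun p hp => (hF p).mpr hp
    have h2 := abs_le.mp (abs_integral_periodicGaussian_sub_le (s := s) (ρ := t ^ 16 - r) hs0
      (by linarith) a)
    have h3 : 16 * √(t ^ 16 - r) * cosKernel 0 s ^ 2 ≤ 16 * t ^ 8 * (A * t ^ 4) := by
      have : √(t ^ 16 - r) ≤ t ^ 8 := by
        rw [Real.sqrt_le_left (by positivity)]
        ring_nf; linarith
      gcongr
    have h4 : t ^ 32 - 2 * t ^ 15 ≤ (t ^ 16 - r) ^ 2 := by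
      have : (t ^ 16 - r) ^ 2 = t ^ 32 - 2 * (r * t ^ 16) + r ^ 2 := by ring
      rw [this, hrR]
      nlinarith
    have h5 : π * (t ^ 16) ^ 2 * (η * cosKernel 0 s ^ 2) ≤ 4 * K * A := by
      calc π * (t ^ 16) ^ 2 * (η * cosKernel 0 s ^ 2)
          ≤ 4 * (t ^ 16) ^ 2 * (η * (A * t ^ 4)) := by
            gcongr; exact pi_le_four
        _ = 4 * (η * t ^ 36) * A := by ring
        _ ≤ _ := by gcongr
    have h6 : t ^ 12 ≤ t ^ 15 := hpow _ _ (by norm_num)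
    have h7 := mul_le_mul_of_nonneg_left h4 pi_pos.le
    have h8 : 16 * t ^ 8 * (A * t ^ 4) ≤ 16 * A * t ^ 15 := by
      calc _ = 16 * A * t ^ 12 := by ring
        _ ≤ _ := by gcongr
    have h9 : 4 * K * A ≤ 4 * K * A * t ^ 15 := le_mul_of_one_le_right (by positivity) hone
    have h10 : 0 ≤ (6 * π + 48 * A + K * (72 + 64 * A) + 1) * t ^ 15 := by positivity
    linarith
  · have h1 := card_mul_le_integral hs0 hr0 fun p hp => (hF p).mp hp
    have h2 := abs_le.mp (abs_integral_periodicGaussian_sub_le (s := s) (ρ := t ^ 16 + r) hs0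
      (by linarith) a)
    have h3 : 16 * √(t ^ 16 + r) * cosKernel 0 s ^ 2 ≤ 16 * (2 * t ^ 8) * (A * t ^ 4) := by
      have : √(t ^ 16 + r) ≤ 2 * t ^ 8 := by
        rw [Real.sqrt_le_left (by positivity)]
        ring_nf; linarith
      gcongr
    have h4 : (t ^ 16 + r) ^ 2 ≤ t ^ 32 + 3 * t ^ 15 := by
      have : (t ^ 16 + r) ^ 2 = t ^ 32 + 2 * (r * t ^ 16) + r ^ 2 := by ring
      rw [this, hrR]
      nlinarith
    have h5 : F.card * η ≤ K * (72 + 64 * A) := by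
      calc F.card * η ≤ (72 + 64 * A) * t ^ 32 * η := by
            gcongr; exact crude t ht a F hF
        _ = (72 + 64 * A) * (η * t ^ 32) := by ring
        _ ≤ (72 + 64 * A) * K := by gcongr
        _ = _ := mul_comm _ _
    have h6 : t ^ 12 ≤ t ^ 15 := hpow _ _ (by norm_num)
    have h7 := mul_le_mul_of_nonneg_left h4 pi_pos.le
    have h8 : 16 * (2 * t ^ 8) * (A * t ^ 4) ≤ 32 * A * t ^ 15 := by
      calc _ = 32 * A * t ^ 12 := by ring
        _ ≤ _ := by gcongr
    have h9 : K * (72 + 64 * A) ≤ K * (72 + 64 * A) * t ^ 15 :=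
      le_mul_of_one_le_right (by positivity) hone
    have h10 : 0 ≤ (5 * π + 32 * A + 4 * K * A + 1) * t ^ 15 := by positivity
    linarith

end GaussianQuadratic

/-! ### Character sums over discs and the circle problem -/

namespace GaussianQuadratic

open Real

theorem mem_normLE {x : ℝ} {n : GaussianInt} : n ∈ normLE x ↔ ((n.norm : ℤ) : ℝ) ≤ x := by
  simp [normLE]

theorem norm_cast_eq (n : GaussianInt) :
    ((n.norm : ℤ) : ℝ) = (n.re : ℝ) ^ 2 + (n.im : ℝ) ^ 2 := by
  rw [Zsqrtd.norm_def]; push_cast; ring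

theorem finite_lattice_disc (R : ℝ) (a : ℂ) : {p : ℤ × ℤ | ‖latticePoint p + a‖ ≤ R}.Finite := by
  refine ((Set.finite_Icc (-⌈R + ‖a‖⌉) ⌈R + ‖a‖⌉).prod
    (Set.finite_Icc (-⌈R + ‖a‖⌉) ⌈R + ‖a‖⌉)).subset fun p hp => ?_
  have h1 : ‖latticePoint p‖ ≤ R + ‖a‖ := by
    have := norm_sub_le (latticePoint p + a) a
    rw [add_sub_cancel_right] at this
    linarith [Set.mem_ofPred_eq ▸ hp]
  have h2 : |(p.1 : ℝ)| ≤ ⌈R + ‖a‖⌉ :=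
    ((Complex.abs_re_le_norm (latticePoint p)).trans h1).trans (Int.le_ceil _)
  have h3 : |(p.2 : ℝ)| ≤ ⌈R + ‖a‖⌉ :=
    ((Complex.abs_im_le_norm (latticePoint p)).trans h1).trans (Int.le_ceil _)
  exact ⟨Set.mem_Icc.mpr (abs_le.mp (by exact_mod_cast h2)),
    Set.mem_Icc.mpr (abs_le.mp (by exact_mod_cast h3))⟩

/-- Lattice points in a shifted disc of any radius, uniformly in the shift. -/
theorem exists_lattice_disc_bound_rpow : ∃ C : ℝ, 0 < C ∧ ∀ (M R : ℝ), 1 ≤ M → 0 ≤ R → R ≤ M →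
    ∀ a : ℂ, |((finite_lattice_disc R a).toFinset.card : ℝ) - π * R ^ 2| ≤
      C * M ^ (15 / 16 : ℝ) := by
  obtain ⟨C, hC, h⟩ := exists_lattice_disc_bound
  refine ⟨C + 2 * π, by positivity, fun M R hM hR hRM a => ?_⟩
  set F := (finite_lattice_disc R a).toFinset
  have hF : ∀ p, p ∈ F ↔ ‖latticePoint p + a‖ ≤ R := fun p => by simp [F]
  have hM1 : 1 ≤ M ^ (15 / 16 : ℝ) := one_le_rpow hM (by norm_num)
  rcases le_or_gt 1 R with hR1 | hR1
  · have ht : 1 ≤ R ^ (1 / 16 : ℝ) := one_le_rpow hR1 (by norm_num)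
    have e : ∀ m : ℕ, (R ^ (1 / 16 : ℝ)) ^ m = R ^ ((m : ℝ) / 16) := fun m => by
      rw [← rpow_natCast, ← rpow_mul hR]; congr 1; ring
    have e16 : (R ^ (1 / 16 : ℝ)) ^ 16 = R := by rw [e]; norm_num
    have e32 : (R ^ (1 / 16 : ℝ)) ^ 32 = R ^ 2 := by
      rw [e, ← rpow_natCast]; norm_num
    have h1 := h _ ht a F (by rwa [e16])
    rw [e32, e] at h1
    refine h1.trans ?_
    have h2 : R ^ (((15 : ℕ) : ℝ) / 16) ≤ M ^ (15 / 16 : ℝ) := by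
      push_cast; exact rpow_le_rpow hR hRM (by norm_num)
    refine mul_le_mul (by linarith [pi_pos]) h2 (by positivity) (by positivity)
  · have h1 := h 1 le_rfl a (finite_lattice_disc 1 a).toFinset (by simp)
    have h2 : F.card ≤ (finite_lattice_disc 1 a).toFinset.card :=
      Finset.card_le_card fun p hp => by
        simpa using ((hF p).mp hp).trans hR1.le
    have h3 : (F.card : ℝ) ≤ (finite_lattice_disc 1 a).toFinset.card := by exact_mod_cast h2
    have h4 : R ^ 2 ≤ 1 := pow_le_one₀ hR hR1.le
    have h5 : π * R ^ 2 ≤ π := mul_le_of_le_one_right pi_pos.le h4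
    have h6 : 0 ≤ π * R ^ 2 := by positivity
    have h7 : (C + 2 * π) ≤ (C + 2 * π) * M ^ (15 / 16 : ℝ) :=
      le_mul_of_one_le_right (by positivity) hM1
    have h8 : (0 : ℝ) ≤ F.card := by positivity
    rw [one_pow, one_pow, mul_one, mul_one] at h1
    have h9 := abs_le.mp h1
    rw [abs_le]
    constructor <;> linarith

/-- The number of Gaussian integers of bounded norm in a residue class. -/
theorem card_filter_residue (Q : ℕ) [NeZero Q] (a b : ℤ) {x : ℝ} (hx : 0 ≤ x)
    [DecidablePred fun n : GaussianInt => (n.re : ZMod Q) = a ∧ (n.im : ZMod Q) = b] :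
    ((normLE x).filter fun n => (n.re : ZMod Q) = a ∧ (n.im : ZMod Q) = b).card =
      (finite_lattice_disc (√x / Q) (⟨a / Q, b / Q⟩ : ℂ)).toFinset.card := by
  have hQ : (0 : ℝ) < Q := by exact_mod_cast Nat.pos_of_ne_zero (NeZero.ne Q)
  have key : ∀ m : ℤ × ℤ, ‖latticePoint m + (⟨a / Q, b / Q⟩ : ℂ)‖ ≤ √x / Q ↔
      (⟨a + Q * m.1, b + Q * m.2⟩ : GaussianInt) ∈ normLE x := by
    intro m
    rw [mem_normLE, norm_cast_eq, Complex.norm_def, Complex.normSq_apply, le_div_iff₀ hQ,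
      Real.le_sqrt (by positivity) hx, mul_pow,
      Real.sq_sqrt (add_nonneg (mul_self_nonneg _) (mul_self_nonneg _))]
    have e : (latticePoint m + (⟨a / Q, b / Q⟩ : ℂ)).re = m.1 + a / Q ∧
        (latticePoint m + (⟨a / Q, b / Q⟩ : ℂ)).im = m.2 + b / Q := ⟨rfl, rfl⟩
    rw [e.1, e.2]
    push_cast
    have : (((m.1 : ℝ) + a / Q) * (m.1 + a / Q) + (m.2 + b / Q) * (m.2 + b / Q)) * (Q : ℝ) ^ 2 =
        (a + Q * m.1) ^ 2 + (b + Q * m.2) ^ 2 := by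
      field_simp; ring
    rw [this]
  symm
  refine Finset.card_bij (fun m _ => (⟨a + Q * m.1, b + Q * m.2⟩ : GaussianInt)) ?_ ?_ ?_
  · intro m hm
    rw [Set.Finite.mem_toFinset, Set.mem_ofPred_eq, key] at hm
    rw [Finset.mem_filter]
    exact ⟨hm, by simp, by simp⟩
  · intro m _ m' _ h
    have hQz : (Q : ℤ) ≠ 0 := by exact_mod_cast NeZero.ne Q
    have h1 := congrArg Zsqrtd.re h
    have h2 := congrArg Zsqrtd.im h
    simp only [add_right_inj] at h1 h2
    exact Prod.ext (mul_left_cancel₀ hQz h1) (mul_left_cancel₀ hQz h2)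
  · intro n hn
    rw [Finset.mem_filter] at hn
    obtain ⟨h0, h1, h2⟩ := hn
    rw [eq_comm, ZMod.intCast_eq_intCast_iff_dvd_sub] at h1 h2
    obtain ⟨c, hc⟩ := h1
    obtain ⟨d, hd⟩ := h2
    have e : (⟨a + Q * c, b + Q * d⟩ : GaussianInt) = n := by
      ext <;> simp <;> linarith
    refine ⟨(c, d), ?_, e⟩
    rw [Set.Finite.mem_toFinset, Set.mem_ofPred_eq, key, e]
    exact h0

/-- Cancellation in character sums over discs, with a fixed power of the conductor. -/
theorem exists_abs_sum_quadChar_le : ∃ C : ℝ, 0 < C ∧ ∀ D : GaussianInt,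
    IsFundamentalDiscriminant D → ∀ x : ℝ, 1 ≤ x →
      |∑ n ∈ normLE x, (quadChar D n : ℝ)| ≤
        C * (charModulus D : ℝ) ^ 2 * x ^ (15 / 32 : ℝ) := by
  classical
  obtain ⟨C, hC, h⟩ := exists_lattice_disc_bound_rpow
  refine ⟨C, hC, fun D hD x hx => ?_⟩
  set Q := charModulus D with hQ
  have hQpos : 0 < Q := charModulus_pos hD.ne_zero
  have : NeZero Q := ⟨hQpos.ne'⟩
  have hQ1 : (1 : ℝ) ≤ Q := by exact_mod_cast hQpos
  let cl : GaussianInt → ZMod Q × ZMod Q := fun n => (n.re, n.im)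
  let N : ZMod Q × ZMod Q → ℝ := fun c => ((normLE x).filter fun n => cl n = c).card
  have h1 : ∑ n ∈ normLE x, (quadChar D n : ℝ) = ∑ c, (residueChar D c : ℝ) * N c := by
    rw [← Finset.sum_fiberwise (normLE x) cl]
    refine Finset.sum_congr rfl fun c _ => ?_
    have : ∀ n ∈ (normLE x).filter (fun n => cl n = c), (quadChar D n : ℝ) = residueChar D c := by
      intro n hn
      rw [← hD.residueChar_mk n, ← (Finset.mem_filter.mp hn).2]
    rw [Finset.sum_congr rfl this, Finset.sum_const, nsmul_eq_mul, mul_comm]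
  -- The main term is the same for every residue class, so the vanishing sum of the character
  -- removes it.
  have h2 : ∑ c, (residueChar D c : ℝ) * (π * (√x / Q) ^ 2) = 0 := by
    rw [← Finset.sum_mul]
    have := hD.sum_residueChar
    rw [← Int.cast_sum, this, Int.cast_zero, zero_mul]
  have hN : ∀ c, |N c - π * (√x / Q) ^ 2| ≤ C * x ^ (15 / 32 : ℝ) := by
    intro c
    have e : N c = ((finite_lattice_disc (√x / Q)
        (⟨(c.1.cast : ℤ) / Q, (c.2.cast : ℤ) / Q⟩ : ℂ)).toFinset.card : ℝ) := by
      rw [← card_filter_residue Q _ _ (by linarith)]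
      simp only [N, cl, Prod.ext_iff, ZMod.intCast_cast, ZMod.cast_id', id]
    have hsx : 1 ≤ √x := Real.one_le_sqrt.mpr hx
    have h3 := h (√x) (√x / Q) hsx (by positivity) (div_le_self (by positivity) hQ1)
      (⟨(c.1.cast : ℤ) / Q, (c.2.cast : ℤ) / Q⟩ : ℂ)
    rw [← e] at h3
    refine h3.trans (le_of_eq ?_)
    rw [Real.sqrt_eq_rpow, ← rpow_mul (by linarith)]
    norm_num
  rw [h1, ← sub_zero (∑ c, _), ← h2, ← Finset.sum_sub_distrib]
  calc |∑ c, ((residueChar D c : ℝ) * N c - residueChar D c * (π * (√x / Q) ^ 2))|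
      ≤ ∑ c, |(residueChar D c : ℝ) * N c - residueChar D c * (π * (√x / Q) ^ 2)| :=
        Finset.abs_sum_le_sum_abs _ _
    _ ≤ ∑ _c : ZMod Q × ZMod Q, C * x ^ (15 / 32 : ℝ) := by
        refine Finset.sum_le_sum fun c _ => ?_
        rw [← mul_sub, abs_mul]
        have h4 : |(residueChar D c : ℝ)| ≤ 1 := by
          exact_mod_cast abs_quadChar_le_one D _
        calc _ ≤ 1 * (C * x ^ (15 / 32 : ℝ)) :=
              mul_le_mul h4 (hN c) (abs_nonneg _) zero_le_one
          _ = _ := one_mul _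
    _ = _ := by
        rw [Finset.sum_const, Finset.card_univ, Fintype.card_prod, ZMod.card, nsmul_eq_mul]
        push_cast; ring

/-- The Gauss circle problem with a power-saving error term. -/
theorem exists_abs_card_normLE_sub_le : ∃ C : ℝ, 0 < C ∧ ∀ M x : ℝ, 1 ≤ M → 0 ≤ x → x ≤ M →
    |((normLE x).card : ℝ) - π * x| ≤ C * M ^ (15 / 32 : ℝ) := by
  classical
  obtain ⟨C, hC, h⟩ := exists_lattice_disc_bound_rpow
  refine ⟨C, hC, fun M x hM hx hxM => ?_⟩
  have e := card_filter_residue 1 0 0 hx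
  rw [Finset.filter_true_of_mem fun n _ => ⟨Subsingleton.elim _ _, Subsingleton.elim _ _⟩] at e
  have h3 := h (√M) (√x / (1 : ℕ)) (Real.one_le_sqrt.mpr hM) (by positivity)
    (by rw [Nat.cast_one, div_one]; exact Real.sqrt_le_sqrt hxM)
    (⟨(0 : ℤ) / (1 : ℕ), (0 : ℤ) / (1 : ℕ)⟩ : ℂ)
  rw [← e, Nat.cast_one, div_one, Real.sq_sqrt hx] at h3
  refine h3.trans (le_of_eq ?_)
  rw [Real.sqrt_eq_rpow, ← rpow_mul (by linarith)]
  norm_num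

end GaussianQuadratic

/-! ### Theta function and entire continuation of the L-series -/

namespace GaussianQuadratic

open Real Filter Asymptotics Topology MeasureTheory HurwitzZeta

theorem isBigO_evenKernel_sub (a : UnitAddCircle) (r : ℝ) :
    (fun t => evenKernel a t - if a = 0 then 1 else 0) =O[atTop] (fun t : ℝ => t ^ r) := by
  obtain ⟨p, hp, h⟩ := isBigO_atTop_evenKernel_sub a
  exact h.trans (isLittleO_exp_neg_mul_rpow_atTop hp r).isBigO

theorem isBigO_cosKernel_sub (a : UnitAddCircle) (r : ℝ) :
    (fun t => cosKernel a t - 1) =O[atTop] (fun t : ℝ => t ^ r) := by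
  obtain ⟨p, hp, h⟩ := isBigO_atTop_cosKernel_sub a
  exact h.trans (isLittleO_exp_neg_mul_rpow_atTop hp r).isBigO

/-- Products of functions that converge rapidly at infinity converge rapidly. -/
theorem isBigO_mul_sub_mul {f g : ℝ → ℝ} {u v r : ℝ}
    (hf : ∀ r : ℝ, (fun t => f t - u) =O[atTop] (fun t : ℝ => t ^ r))
    (hg : ∀ r : ℝ, (fun t => g t - v) =O[atTop] (fun t : ℝ => t ^ r)) :
    (fun t => f t * g t - u * v) =O[atTop] (fun t : ℝ => t ^ r) := by
  have hg1 : g =O[atTop] (fun _ : ℝ => (1 : ℝ)) := by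
    have h1 : (fun t => g t - v) =O[atTop] (fun _ : ℝ => (1 : ℝ)) := by
      simpa using hg 0
    have h2 := h1.add (isBigO_const_const v (one_ne_zero (α := ℝ)) atTop)
    simpa using h2
  have h3 := (((hf r).mul hg1).congr_right fun t => mul_one _).add ((hg r).const_mul_left u)
  refine h3.congr_left fun t => ?_
  ring

section

variable {D : GaussianInt}

/-- The theta function of the character `χ_D`, at argument `t / (8 N(D))²`. -/
noncomputable def quadTheta (D : GaussianInt) [NeZero (charModulus D)] (t : ℝ) : ℝ :=
  ∑ c, (residueChar D c : ℝ) *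
    (evenKernel (ZMod.toAddCircle c.1) t * evenKernel (ZMod.toAddCircle c.2) t)

/-- Only the class (0, 0) has a kernel product that does not tend to 0, and there the character
vanishes. -/
theorem isBigO_quadTheta_atTop [NeZero (charModulus D)] (r : ℝ) :
    quadTheta D =O[atTop] (fun t : ℝ => t ^ r) := by
  refine IsBigO.fun_sum fun c _ => ?_
  have h := (isBigO_mul_sub_mul (r := r) (isBigO_evenKernel_sub (ZMod.toAddCircle c.1))
    (isBigO_evenKernel_sub (ZMod.toAddCircle c.2))).const_mul_left (residueChar D c : ℝ)
  refine h.congr_left fun t => ?_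
  simp only [ZMod.toAddCircle_eq_zero]
  by_cases h1 : c.1 = 0
  · by_cases h2 : c.2 = 0
    · have : residueChar D c = 0 := by
        rw [residueChar, h1, h2]
        simp only [ZMod.cast_zero]
        exact quadChar_zero D
      simp [this]
    · simp [h2]
  · simp [h1]

theorem quadTheta_eq [NeZero (charModulus D)] {t : ℝ} (ht : 0 < t) :
    quadTheta D t = t⁻¹ * ∑ c, (residueChar D c : ℝ) *
      (cosKernel (ZMod.toAddCircle c.1) t⁻¹ * cosKernel (ZMod.toAddCircle c.2) t⁻¹) := by
  rw [quadTheta, Finset.mul_sum]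
  refine Finset.sum_congr rfl fun c _ => ?_
  have e : 1 / t ^ (1 / 2 : ℝ) * (1 / t ^ (1 / 2 : ℝ)) = t⁻¹ := by
    rw [one_div_mul_one_div, ← rpow_add ht]; norm_num
  rw [evenKernel_functional_equation, evenKernel_functional_equation (ZMod.toAddCircle c.2),
    mul_mul_mul_comm, e, one_div]
  ring

/-- After the functional equation every class contributes 1 up to rapid decay, and the character
sums to zero over the classes. -/
theorem IsFundamentalDiscriminant.isBigO_quadTheta_zero (hD : IsFundamentalDiscriminant D)
    [NeZero (charModulus D)] (r : ℝ) :
    quadTheta D =O[𝓝[>] 0] (fun t : ℝ => t ^ (-r)) := by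
  have h1 : (fun t : ℝ => ∑ c, (residueChar D c : ℝ) *
      (cosKernel (ZMod.toAddCircle c.1) t * cosKernel (ZMod.toAddCircle c.2) t))
      =O[atTop] (fun t : ℝ => t ^ (r - 1)) := by
    have h2 : (fun t : ℝ => ∑ c, (residueChar D c : ℝ) *
        (cosKernel (ZMod.toAddCircle c.1) t * cosKernel (ZMod.toAddCircle c.2) t - 1 * 1))
        =O[atTop] (fun t : ℝ => t ^ (r - 1)) :=
      IsBigO.fun_sum fun c _ => (isBigO_mul_sub_mul (isBigO_cosKernel_sub _)
        (isBigO_cosKernel_sub _)).const_mul_left _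
    refine h2.congr_left fun t => ?_
    simp only [mul_sub, mul_one, Finset.sum_sub_distrib]
    rw [← Int.cast_sum, hD.sum_residueChar, Int.cast_zero, sub_zero]
  have h3 := (isBigO_refl (fun t : ℝ => t⁻¹) (𝓝[>] 0)).mul
    (h1.comp_tendsto tendsto_inv_nhdsGT_zero)
  refine h3.congr' ?_ ?_
  · filter_upwards [self_mem_nhdsWithin] with t ht
    exact (quadTheta_eq ht).symm
  · filter_upwards [self_mem_nhdsWithin] with t ht
    have ht : 0 < t := ht
    simp only [Function.comp_apply]
    rw [inv_rpow ht.le, ← rpow_neg ht.le, ← rpow_neg_one, ← rpow_add ht]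
    congr 1; ring

theorem continuousOn_quadTheta [NeZero (charModulus D)] :
    ContinuousOn (quadTheta D) (Set.Ioi 0) :=
  continuousOn_finsetSum _ fun _ _ => continuousOn_const.mul
    ((continuousOn_evenKernel _).mul (continuousOn_evenKernel _))

/-- Rapid decay at both ends makes the Mellin integral converge for every s. -/
theorem IsFundamentalDiscriminant.differentiable_mellin_quadTheta
    (hD : IsFundamentalDiscriminant D) [NeZero (charModulus D)] :
    Differentiable ℂ (mellin fun t => (quadTheta D t : ℂ)) := by
  intro s
  refine mellin_differentiableAt_of_isBigO_rpow (a := s.re + 1) (b := s.re - 1) ?_ ?_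
    (by linarith) ?_ (by linarith)
  · exact (Complex.continuous_ofReal.comp_continuousOn continuousOn_quadTheta).locallyIntegrableOn
      measurableSet_Ioi
  · exact Complex.isBigO_ofReal_left.mpr (isBigO_quadTheta_atTop _)
  · exact Complex.isBigO_ofReal_left.mpr (hD.isBigO_quadTheta_zero _)

theorem residue_eq_iff {Q : ℕ} (n : GaussianInt) (a b : ℤ) :
    ((n.re : ZMod Q) = a ∧ (n.im : ZMod Q) = b) ↔
      ∃ m : ℤ × ℤ, (⟨a + Q * m.1, b + Q * m.2⟩ : GaussianInt) = n := by
  constructor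
  · rintro ⟨h1, h2⟩
    rw [eq_comm, ZMod.intCast_eq_intCast_iff_dvd_sub] at h1 h2
    obtain ⟨c, hc⟩ := h1
    obtain ⟨d, hd⟩ := h2
    exact ⟨(c, d), by ext <;> simp <;> linarith⟩
  · rintro ⟨m, rfl⟩
    constructor <;> simp

theorem IsFundamentalDiscriminant.hasSum_quadTheta (hD : IsFundamentalDiscriminant D)
    [NeZero (charModulus D)] {t : ℝ} (ht : 0 < t) :
    HasSum (fun n : GaussianInt => (quadChar D n : ℝ) *
      rexp (-π * (((n.norm : ℤ) : ℝ) / (charModulus D : ℝ) ^ 2) * t)) (quadTheta D t) := by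
  classical
  set Q := charModulus D with hQ
  have hQ0 : (Q : ℝ) ≠ 0 := by exact_mod_cast NeZero.ne Q
  have hQz : (Q : ℤ) ≠ 0 := by exact_mod_cast NeZero.ne Q
  let cl : GaussianInt → ZMod Q × ZMod Q := fun n => (n.re, n.im)
  let e : GaussianInt → ℝ := fun n => rexp (-π * (((n.norm : ℤ) : ℝ) / (Q : ℝ) ^ 2) * t)
  have key : ∀ c : ZMod Q × ZMod Q, HasSum
      (fun n : GaussianInt => if cl n = c then (residueChar D c : ℝ) * e n else 0)
      ((residueChar D c : ℝ) *
        (evenKernel (ZMod.toAddCircle c.1) t * evenKernel (ZMod.toAddCircle c.2) t)) := by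
    intro c
    obtain ⟨a, ha⟩ : ∃ a : ℤ, (a : ZMod Q) = c.1 := ⟨c.1.cast, by simp⟩
    obtain ⟨b, hb⟩ : ∃ b : ℤ, (b : ZMod Q) = c.2 := ⟨c.2.cast, by simp⟩
    have hcl : ∀ n, cl n = c ↔
        ∃ m : ℤ × ℤ, (⟨a + Q * m.1, b + Q * m.2⟩ : GaussianInt) = n := by
      intro n
      rw [← residue_eq_iff, ha, hb, Prod.ext_iff]
    let i : ℤ × ℤ → GaussianInt := fun m => ⟨a + Q * m.1, b + Q * m.2⟩
    have hi : Function.Injective i := by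
      intro m m' h
      have h1 := congrArg Zsqrtd.re h
      have h2 := congrArg Zsqrtd.im h
      simp only [i, add_right_inj] at h1 h2
      exact Prod.ext (mul_left_cancel₀ hQz h1) (mul_left_cancel₀ hQz h2)
    rw [← hi.hasSum_iff]
    · have h1 := hasSum_int_evenKernel (a / Q : ℝ) ht
      have h2 := hasSum_int_evenKernel (b / Q : ℝ) ht
      have h3 := (h1.mul h2 (h1.summable.mul_of_nonneg h2.summable (fun _ => (Real.exp_pos _).le)
        (fun _ => (Real.exp_pos _).le))).mul_left (residueChar D c : ℝ)
      rw [← ZMod.toAddCircle_intCast, ← ZMod.toAddCircle_intCast, ha, hb] at h3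
      refine hasSum_of_eq h3 fun m => ?_
      simp only [Function.comp_apply]
      rw [if_pos ((hcl _).mpr ⟨m, rfl⟩), ← Real.exp_add]
      simp only [e, i]
      rw [norm_cast_eq]
      congr 2
      push_cast
      field_simp
      ring
    · intro n hn
      rw [if_neg]
      rw [hcl]
      exact hn
  refine hasSum_of_eq (hasSum_sum fun c (_ : c ∈ Finset.univ) => key c) fun n => ?_
  rw [Finset.sum_ite_eq, if_pos (Finset.mem_univ _)]
  simp only [cl, e]
  rw [hD.residueChar_mk]

end

theorem norm_pos_of_ne_zero {n : GaussianInt} (hn : n ≠ 0) : 1 ≤ ((n.norm : ℤ) : ℝ) := by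
  have := GaussianInt.norm_pos.mpr hn
  exact_mod_cast this

theorem summable_norm_rpow {σ : ℝ} (hσ : 1 < σ) :
    Summable fun n : GaussianInt => ((n.norm : ℤ) : ℝ) ^ (-σ) := by
  have h := EisensteinSeries.summable_one_div_norm_rpow (k := 2 * σ) (by linarith)
  let e : GaussianInt ≃ (Fin 2 → ℤ) :=
    ⟨fun n => ![n.re, n.im], fun x => ⟨x 0, x 1⟩, fun n => rfl, fun x => by
      ext j; fin_cases j <;> rfl⟩
  rw [← e.summable_iff] at h
  refine Summable.of_nonneg_of_le (fun n => ?_) (fun n => ?_) h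
  · exact rpow_nonneg (by exact_mod_cast GaussianInt.norm_nonneg n) _
  · by_cases hn : n = 0
    · subst hn
      rw [Zsqrtd.norm_zero, Int.cast_zero, zero_rpow (by linarith)]
      exact rpow_nonneg (norm_nonneg _) _
    have hN := norm_pos_of_ne_zero hn
    have h1 : ‖e n‖ ^ 2 ≤ ((n.norm : ℤ) : ℝ) := by
      have h2 : ‖e n‖ ≤ √((n.norm : ℤ) : ℝ) := by
        refine (pi_norm_le_iff_of_nonneg (Real.sqrt_nonneg _)).mpr fun j => ?_
        rw [norm_cast_eq, Int.norm_eq_abs]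
        apply Real.abs_le_sqrt
        fin_cases j
        · exact le_add_of_nonneg_right (sq_nonneg (n.im : ℝ))
        · exact le_add_of_nonneg_left (sq_nonneg (n.re : ℝ))
      calc _ ≤ √((n.norm : ℤ) : ℝ) ^ 2 := by gcongr
        _ = _ := Real.sq_sqrt (by linarith)
    have h3 : 0 < ‖e n‖ := by
      rw [norm_pos_iff]
      intro h4
      exact hn (e.injective (by rw [h4]; ext j; fin_cases j <;> rfl))
    have h5 : ‖e n‖ ^ (2 * σ) = (‖e n‖ ^ 2) ^ σ := by
      rw [← rpow_natCast, ← rpow_mul h3.le]; norm_num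
    rw [Function.comp_apply, rpow_neg (by linarith), rpow_neg h3.le, h5]
    gcongr

theorem norm_quadChar_le_one (D n : GaussianInt) : ‖(quadChar D n : ℂ)‖ ≤ 1 := by
  rw [Complex.norm_intCast]
  exact_mod_cast abs_quadChar_le_one D n

theorem quadChar_eq_zero_or (D n : GaussianInt) :
    (quadChar D n : ℂ) = 0 ∨ 0 < ((n.norm : ℤ) : ℝ) := by
  by_cases hn : n = 0
  · exact Or.inl (by rw [hn, quadChar_zero, Int.cast_zero])
  · exact Or.inr (by linarith [norm_pos_of_ne_zero hn])

theorem summable_quadChar_div (D : GaussianInt) {σ : ℝ} (hσ : 1 < σ) :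
    Summable fun n : GaussianInt => ‖(quadChar D n : ℂ)‖ / ((n.norm : ℤ) : ℝ) ^ σ := by
  have h0 : ∀ n : GaussianInt, 0 ≤ ((n.norm : ℤ) : ℝ) := fun n => by
    exact_mod_cast GaussianInt.norm_nonneg n
  refine Summable.of_nonneg_of_le (fun n => ?_) (fun n => ?_) (summable_norm_rpow hσ)
  · exact div_nonneg (norm_nonneg _) (rpow_nonneg (h0 n) _)
  · rw [rpow_neg (h0 n), div_eq_mul_inv]
    exact mul_le_of_le_one_left (inv_nonneg.mpr (rpow_nonneg (h0 n) _)) (norm_quadChar_le_one D n)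

/-- The Mellin transform of theta is the L-series times Γ(s) and exponential factors; these can be
divided out because 1/Γ is entire. -/
theorem IsFundamentalDiscriminant.exists_continuation {D : GaussianInt}
    (hD : IsFundamentalDiscriminant D) :
    ∃ F : ℂ → ℂ, Differentiable ℂ F ∧ ∀ s : ℂ, 1 < s.re → F s = quadLSeries D s := by
  have : NeZero (charModulus D) := ⟨(charModulus_pos hD.ne_zero).ne'⟩
  set Q : ℝ := (charModulus D : ℝ) with hQdef
  have hQ : 0 < Q := Nat.cast_pos.mpr (charModulus_pos hD.ne_zero)
  have hq : 0 < (Q ^ 2)⁻¹ := by positivity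
  have hq0 : (((Q ^ 2)⁻¹ : ℝ) : ℂ) ≠ 0 := by exact_mod_cast hq.ne'
  have hπ0 : (π : ℂ) ≠ 0 := by exact_mod_cast pi_ne_zero
  refine ⟨fun s => (π : ℂ) ^ s * (((Q ^ 2)⁻¹ : ℝ) : ℂ) ^ s * (Complex.Gamma s)⁻¹ *
    mellin (fun t => (quadTheta D t : ℂ)) s, ?_, fun s hs => ?_⟩
  · refine Differentiable.mul (Differentiable.mul (Differentiable.mul ?_ ?_)
      Complex.differentiable_one_div_Gamma) hD.differentiable_mellin_quadTheta
    · exact differentiable_id.const_cpow (Or.inl hπ0)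
    · exact differentiable_id.const_cpow (Or.inl hq0)
  · have h0 : ∀ n : GaussianInt, 0 ≤ ((n.norm : ℤ) : ℝ) := fun n => by
      exact_mod_cast GaussianInt.norm_nonneg n
    have hΓ : Complex.Gamma s ≠ 0 := Complex.Gamma_ne_zero_of_re_pos (by linarith)
    have : Countable GaussianInt :=
      Function.Injective.countable (f := fun n : GaussianInt => (n.re, n.im)) fun a b h =>
        Zsqrtd.ext (Prod.ext_iff.mp h).1 (Prod.ext_iff.mp h).2
    have h := hasSum_mellin_pi_mul (s := s) (a := fun n : GaussianInt => (quadChar D n : ℂ))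
      (q := fun n => ((n.norm : ℤ) : ℝ) * (Q ^ 2)⁻¹) (F := fun t => (quadTheta D t : ℂ))
      (fun n => (quadChar_eq_zero_or D n).imp_right fun h => by positivity) (by linarith)
      (fun t ht => by
        have h1 := Complex.hasSum_ofReal.mpr (hD.hasSum_quadTheta ht)
        refine hasSum_of_eq h1 fun n => ?_
        push_cast
        rfl)
      (by
        refine ((summable_quadChar_div D hs).mul_right (((Q ^ 2)⁻¹ ^ s.re)⁻¹)).congr fun n => ?_
        rw [mul_rpow (h0 n) hq.le, div_mul_eq_div_div, div_eq_mul_inv _ ((Q ^ 2)⁻¹ ^ s.re)])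
    have h2 := h.mul_left ((π : ℂ) ^ s * (((Q ^ 2)⁻¹ : ℝ) : ℂ) ^ s * (Complex.Gamma s)⁻¹)
    refine (HasSum.tsum_eq (hasSum_of_eq h2 fun n => ?_)).symm
    rw [Complex.ofReal_mul, Complex.mul_cpow_ofReal_nonneg (h0 n) hq.le, Complex.cpow_neg]
    have e1 : (π : ℂ) ^ s ≠ 0 := by simp [Complex.cpow_eq_zero_iff, hπ0]
    have e2 : (((Q ^ 2)⁻¹ : ℝ) : ℂ) ^ s ≠ 0 := by rw [Ne, Complex.cpow_eq_zero_iff]; tauto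
    rw [Complex.ofReal_intCast]
    generalize (((Q ^ 2)⁻¹ : ℝ) : ℂ) ^ s = y at *
    generalize (π : ℂ) ^ s = w at *
    -- This covers n = 0, where division by zero makes both sides 0.
    by_cases e3 : (n.norm : ℂ) ^ s = 0
    · rw [e3, div_zero, zero_mul, div_zero, mul_zero]
    · field_simp

theorem IsFundamentalDiscriminant.quadLFunction_spec {D : GaussianInt}
    (hD : IsFundamentalDiscriminant D) :
    Differentiable ℂ (quadLFunction D) ∧
      ∀ s : ℂ, 1 < s.re → quadLFunction D s = quadLSeries D s := by
  rw [quadLFunction, dif_pos hD.exists_continuation]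
  exact hD.exists_continuation.choose_spec

end GaussianQuadratic

/-! ### The L-function as a Mellin transform of the character sum -/

namespace GaussianQuadratic

open Real Filter Asymptotics Topology MeasureTheory

/-- The character sum over `0 < N(n) ≤ x`. -/
noncomputable def charSum (D : GaussianInt) (x : ℝ) : ℝ := ∑ n ∈ normLE x, (quadChar D n : ℝ)

theorem normLE_floor (x : ℝ) : normLE ⌊x⌋ = normLE x := by
  ext n
  rw [mem_normLE, mem_normLE, Int.cast_le, Int.le_floor]

theorem charSum_of_lt_one (D : GaussianInt) {x : ℝ} (hx : x < 1) : charSum D x = 0 := by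
  refine Finset.sum_eq_zero fun n hn => ?_
  by_cases h : n = 0
  · rw [h, quadChar_zero, Int.cast_zero]
  · linarith [norm_pos_of_ne_zero h, mem_normLE.mp hn]

/-- The sum depends on x only through its integer part. -/
theorem measurable_charSum (D : GaussianInt) : Measurable (charSum D) := by
  have : charSum D = (fun k : ℤ => charSum D k) ∘ Int.floor := by
    funext x
    simp only [Function.comp_apply, charSum, normLE_floor]
  rw [this]
  exact (measurable_of_countable _).comp Int.measurable_floor

theorem abs_charSum_le_card (D : GaussianInt) (x : ℝ) : |charSum D x| ≤ (normLE x).card := by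
  refine (Finset.abs_sum_le_sum_abs _ _).trans ?_
  calc _ ≤ ∑ _n ∈ normLE x, (1 : ℝ) :=
        Finset.sum_le_sum fun _ _ => by exact_mod_cast abs_quadChar_le_one D _
    _ = _ := by simp

theorem normLE_mono {x y : ℝ} (h : x ≤ y) : normLE x ⊆ normLE y := fun _ hn =>
  mem_normLE.mpr ((mem_normLE.mp hn).trans h)

theorem locallyIntegrable_charSum (D : GaussianInt) : LocallyIntegrable (charSum D) := by
  rw [locallyIntegrable_iff]
  intro k hk
  obtain ⟨M, hM⟩ := hk.bddAbove
  refine Measure.integrableOn_of_bounded (M := ((normLE M).card : ℝ)) hk.measure_lt_top.ne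
    (measurable_charSum D).aestronglyMeasurable ?_
  refine (ae_restrict_iff' hk.measurableSet).mpr (Eventually.of_forall fun x hx => ?_)
  refine (abs_charSum_le_card D x).trans ?_
  exact_mod_cast Finset.card_le_card (normLE_mono (hM hx))

theorem IsFundamentalDiscriminant.charSum_isBigO {D : GaussianInt}
    (hD : IsFundamentalDiscriminant D) :
    (fun x => (charSum D x : ℂ)) =O[atTop] (fun x : ℝ => x ^ (-(-(15 / 32 : ℝ)))) := by
  obtain ⟨C, -, h⟩ := exists_abs_sum_quadChar_le
  refine IsBigO.of_bound (C * (charModulus D : ℝ) ^ 2) ?_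
  filter_upwards [eventually_ge_atTop 1] with x hx
  rw [Complex.norm_real, Real.norm_eq_abs, neg_neg,
    Real.norm_of_nonneg (rpow_nonneg (by linarith) _)]
  exact h D hD x hx

theorem charSum_isBigO_zero (D : GaussianInt) (r : ℝ) :
    (fun x => (charSum D x : ℂ)) =O[𝓝[>] 0] (fun x : ℝ => x ^ r) := by
  have : (fun x => (charSum D x : ℂ)) =ᶠ[𝓝[>] 0] fun _ => 0 := by
    filter_upwards [mem_nhdsWithin_of_mem_nhds (Iio_mem_nhds one_pos)] with x hx
    rw [charSum_of_lt_one D hx, Complex.ofReal_zero]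
  exact this.trans_isBigO (isBigO_zero _ _)

theorem locallyIntegrableOn_charSum (D : GaussianInt) :
    LocallyIntegrableOn (fun x => (charSum D x : ℂ)) (Set.Ioi 0) := by
  refine LocallyIntegrable.locallyIntegrableOn (locallyIntegrable_iff.mpr fun k hk => ?_) _
  exact (locallyIntegrable_iff.mp (locallyIntegrable_charSum D) k hk).ofReal

theorem IsFundamentalDiscriminant.differentiableAt_mellin_charSum {D : GaussianInt}
    (hD : IsFundamentalDiscriminant D) {s : ℂ} (hs : s.re < -(15 / 32)) :
    DifferentiableAt ℂ (mellin fun x => (charSum D x : ℂ)) s :=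
  mellin_differentiableAt_of_isBigO_rpow (a := -(15 / 32)) (b := s.re - 1)
    (locallyIntegrableOn_charSum D) hD.charSum_isBigO hs (charSum_isBigO_zero D _) (by linarith)

/-- Summation by parts for the Dirichlet series. -/
theorem quadLSeries_eq_mellin (D : GaussianInt) {s : ℂ} (hs : 1 < s.re) :
    quadLSeries D s = s * mellin (fun x => (charSum D x : ℂ)) (-s) := by
  have hs0 : s ≠ 0 := by rintro rfl; simp at hs; linarith
  have : Countable GaussianInt :=
    Function.Injective.countable (f := fun n : GaussianInt => (n.re, n.im)) fun a b h =>
      Zsqrtd.ext (Prod.ext_iff.mp h).1 (Prod.ext_iff.mp h).2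
  let N : GaussianInt → ℝ := fun n => ((n.norm : ℤ) : ℝ)
  -- The identity used is N(n)^(-s) = s ∫ t^(-s-1) dt over t ≥ N(n); exchanging sum and integral
  -- collects the n with N(n) ≤ t.
  let G : GaussianInt → ℝ → ℂ := fun n => (Set.Ici (N n)).indicator fun t => (t : ℂ) ^ (-s - 1)
  have hre : (-s - 1).re < -1 := by simp; linarith
  have hre' : -s.re - 1 < -1 := by linarith
  have hinter : ∀ n, 0 < N n → Set.Ioi 0 ∩ Set.Ici (N n) = Set.Ici (N n) := fun n hn =>
    Set.inter_eq_right.mpr fun t ht => hn.trans_le ht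
  have hint : ∀ n, 0 < N n → IntegrableOn (G n) (Set.Ioi 0) := fun n hn => by
    rw [IntegrableOn, integrable_indicator_iff measurableSet_Ici, IntegrableOn,
      Measure.restrict_restrict measurableSet_Ici, Set.inter_comm, hinter n hn, ← IntegrableOn,
      integrableOn_Ici_iff_integrableOn_Ioi]
    exact integrableOn_Ioi_cpow_of_lt hre hn
  have hval : ∀ n, 0 < N n → ∫ t in Set.Ioi 0, G n t = (N n : ℂ) ^ (-s) / s := fun n hn => by
    rw [setIntegral_indicator measurableSet_Ici, hinter n hn, integral_Ici_eq_integral_Ioi,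
      integral_Ioi_cpow_of_lt hre hn, sub_add_cancel, neg_div_neg_eq]
  have hnorm : ∀ n, 0 < N n → ∫ t in Set.Ioi 0, ‖G n t‖ = (N n) ^ (-s.re) / s.re := fun n hn => by
    have e : ∀ t ∈ Set.Ici (N n), ‖(t : ℂ) ^ (-s - 1)‖ = t ^ (-s.re - 1) := fun t ht => by
      rw [Complex.norm_cpow_eq_rpow_re_of_pos (hn.trans_le ht)]; simp
    simp only [G, norm_indicator_eq_indicator_norm]
    rw [setIntegral_indicator measurableSet_Ici, hinter n hn, setIntegral_congr_fun
      measurableSet_Ici e, integral_Ici_eq_integral_Ioi, integral_Ioi_rpow_of_lt hre' hn,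
      sub_add_cancel, neg_div_neg_eq]
  have h := hasSum_integral_of_summable_integral_norm (μ := volume.restrict (Set.Ioi 0))
    (F := fun (n : GaussianInt) t => (quadChar D n : ℂ) * G n t) (fun n => by
      rcases quadChar_eq_zero_or D n with h0 | h0
      · simp only [h0, zero_mul]; exact integrable_zero _ _ _
      · exact (hint n h0).const_mul _) (by
      refine ((summable_quadChar_div D hs).mul_right s.re⁻¹).congr fun n => ?_
      simp only [norm_mul, integral_const_mul]
      rcases quadChar_eq_zero_or D n with h0 | h0
      · rw [h0, norm_zero]; simp
      · rw [hnorm n h0, rpow_neg h0.le]; ring)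
  have e1 : ∀ t, ∑' n, (quadChar D n : ℂ) * G n t = (t : ℂ) ^ (-s - 1) • (charSum D t : ℂ) := by
    intro t
    rw [tsum_eq_sum (s := normLE t), charSum, Complex.ofReal_sum, smul_eq_mul, Finset.mul_sum]
    · refine Finset.sum_congr rfl fun n hn => ?_
      simp only [G]
      rw [Set.indicator_of_mem (Set.mem_Ici.mpr (mem_normLE.mp hn)), mul_comm]
      norm_cast
    · intro n hn
      simp only [G]
      rw [Set.indicator_of_notMem (s := Set.Ici (N n)) (fun h => hn (mem_normLE.mpr h)), mul_zero]
  simp only [e1] at h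
  rw [← mellin] at h
  refine HasSum.tsum_eq (hasSum_of_eq (h.mul_left s) fun n => ?_)
  rw [integral_const_mul]
  rcases quadChar_eq_zero_or D n with h0 | h0
  · simp [h0]
  · rw [hval n h0, Complex.cpow_neg]
    simp only [N, Complex.ofReal_intCast]
    generalize (n.norm : ℂ) ^ s = z
    by_cases hz : z = 0
    · simp [hz]
    · field_simp

/-- The representation of `L(s, χ_D)` through the character sum extends to `Re s > 15/32`. -/
theorem IsFundamentalDiscriminant.quadLFunction_eq_mellin {D : GaussianInt}
    (hD : IsFundamentalDiscriminant D) {s : ℂ} (hs : 15 / 32 < s.re) :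
    quadLFunction D s = s * mellin (fun x => (charSum D x : ℂ)) (-s) := by
  set U : Set ℂ := {s : ℂ | 15 / 32 < s.re}
  have hU : IsOpen U := isOpen_lt continuous_const Complex.continuous_re
  have hUc : IsPreconnected U := (convex_halfSpace_re_gt _).isPreconnected
  obtain ⟨h1, h2⟩ := hD.quadLFunction_spec
  have h3 : DifferentiableOn ℂ (fun s => s * mellin (fun x => (charSum D x : ℂ)) (-s)) U := by
    intro z hz
    have hz : 15 / 32 < z.re := hz
    have h4 := hD.differentiableAt_mellin_charSum (s := -z) (by rw [Complex.neg_re]; linarith)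
    exact (differentiableAt_id.mul (h4.comp z differentiableAt_id.neg)).differentiableWithinAt
  -- Both sides are analytic on the half-plane and agree near 2, where the Dirichlet series
  -- converges.
  refine (h1.differentiableOn.analyticOnNhd hU).eqOn_of_preconnected_of_eventuallyEq
    (h3.analyticOnNhd hU) hUc (z₀ := 2) (by simp [U]; norm_num) ?_ hs
  have h5 : {s : ℂ | 1 < s.re} ∈ 𝓝 (2 : ℂ) :=
    (isOpen_lt continuous_const Complex.continuous_re).mem_nhds (by simp)
  filter_upwards [h5] with z hz
  rw [h2 z hz, quadLSeries_eq_mellin D hz]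

end GaussianQuadratic

/-! ### Gaussian cutoff in frequency -/

namespace GaussianQuadratic

open Real Filter Topology MeasureTheory FourierTransform

theorem integrable_abs_rpow_mul_exp {s : ℝ} (hs : -1 < s) :
    Integrable fun v : ℝ => |v| ^ s * rexp (-π * v ^ 2) := by
  have h := integrableOn_rpow_mul_exp_neg_mul_sq pi_pos hs
  have h1 : IntegrableOn (fun v : ℝ => |v| ^ s * rexp (-π * v ^ 2)) (Set.Ioi 0) :=
    h.congr_fun (fun v hv => by simp only [abs_of_pos (Set.mem_Ioi.mp hv)]) measurableSet_Ioi
  have h2 : IntegrableOn (fun v : ℝ => |v| ^ s * rexp (-π * v ^ 2)) (Set.Iio 0) := by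
    have h3 := h1
    rw [← neg_zero] at h3
    have := h3.comp_neg_Iio
    simpa using this
  rw [← integrableOn_univ, ← Set.Iio_union_Ici (a := (0 : ℝ))]
  exact h2.union ((integrableOn_Ici_iff_integrableOn_Ioi).mpr h1)

/-- For p ≥ 1 the base is at most 14 Y max(1, |v|). For p < 1 the exponent is negative and the base
is at least Y|v|; the resulting singularity at v = 0 is integrable because p > 0. -/
theorem add_mul_rpow_le {p Y v : ℝ} (hp : 0 < p) (hY : 1 ≤ Y) (hv : v ≠ 0) :
    (1 + 2 * π * |Y * v|) ^ (p - 1) ≤ 14 ^ p * Y ^ (p - 1) * (1 + |v| ^ (p - 1)) := by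
  have hv : 0 < |v| := abs_pos.mpr hv
  have hY0 : 0 < Y := by linarith
  rw [abs_mul, abs_of_pos hY0]
  rcases le_or_gt 1 p with h | h
  · have h1 : 1 + 2 * π * (Y * |v|) ≤ 14 * Y * max 1 |v| := by
      have h2 : 2 * π ≤ 8 := by linarith [pi_le_four]
      have h3 : Y * |v| ≤ Y * max 1 |v| := by gcongr; exact le_max_right _ _
      have h4 : 1 ≤ Y * max 1 |v| := one_le_mul_of_one_le_of_one_le hY (le_max_left _ _)
      have h5 : 2 * π * (Y * |v|) ≤ 8 * (Y * max 1 |v|) := by gcongr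
      linarith
    have h6 : (max 1 |v|) ^ (p - 1) ≤ 1 + |v| ^ (p - 1) := by
      rcases max_cases 1 |v| with ⟨e, -⟩ | ⟨e, -⟩ <;> rw [e]
      · rw [one_rpow]; linarith [rpow_nonneg hv.le (p - 1)]
      · linarith
    calc _ ≤ (14 * Y * max 1 |v|) ^ (p - 1) :=
          rpow_le_rpow (by positivity) h1 (by linarith)
      _ = 14 ^ (p - 1) * Y ^ (p - 1) * (max 1 |v|) ^ (p - 1) := by
          rw [mul_rpow (by positivity) (by positivity), mul_rpow (by positivity) (by positivity)]
      _ ≤ _ := by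
          gcongr
          · norm_num
          · linarith
  · have h1 : Y * |v| ≤ 1 + 2 * π * (Y * |v|) := by
      have h2 : 1 ≤ 2 * π := by linarith [pi_gt_three]
      have h3 : 0 ≤ Y * |v| := by positivity
      nlinarith
    calc _ ≤ (Y * |v|) ^ (p - 1) :=
          rpow_le_rpow_of_nonpos (by positivity) h1 (by linarith)
      _ = 1 * Y ^ (p - 1) * |v| ^ (p - 1) := by
          rw [mul_rpow (by positivity) (by positivity), one_mul]
      _ ≤ _ := by
          gcongr
          · exact one_le_rpow (by norm_num) hp.le
          · linarith

/-- A Gaussian of width `Y` cuts off a function of polynomial growth. -/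
theorem exists_integral_gaussian_cutoff_le {p : ℝ} (hp : 0 < p) : ∃ K : ℝ, 0 ≤ K ∧
    ∀ (Y M : ℝ) (f : ℝ → ℂ), 1 ≤ Y → 0 ≤ M →
      (∀ ξ, ‖f ξ‖ ≤ M * (1 + 2 * π * |ξ|) ^ (p - 1)) →
      ∫ ξ, ‖f ξ‖ * rexp (-π * (ξ / Y) ^ 2) ≤ M * K * Y ^ p := by
  set k : ℝ → ℝ := fun v => 14 ^ p * ((1 + |v| ^ (p - 1)) * rexp (-π * v ^ 2)) with hk
  have hk0 : ∀ v, 0 ≤ k v := fun v => by positivity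
  have hkint : Integrable k := by
    have h1 := (integrable_exp_neg_mul_sq pi_pos).add
      (integrable_abs_rpow_mul_exp (s := p - 1) (by linarith))
    refine (h1.congr (Eventually.of_forall fun v => ?_)).const_mul _
    simp only [Pi.add_apply]; ring
  refine ⟨∫ v, k v, integral_nonneg hk0, fun Y M f hY hM hf => ?_⟩
  have hY0 : 0 < Y := by linarith
  have h1 : ∀ᵐ ξ : ℝ, ‖f ξ‖ * rexp (-π * (ξ / Y) ^ 2) ≤ M * Y ^ (p - 1) * k (ξ / Y) := by
    -- At ξ = 0 the power on the right takes the default value 0 when p ≠ 1, and the bound may fail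
    -- there; one point is negligible.
    filter_upwards [compl_mem_ae_iff.mpr (measure_singleton (0 : ℝ))] with ξ hξ
    have hξ : ξ / Y ≠ 0 := div_ne_zero hξ hY0.ne'
    have h2 := add_mul_rpow_le hp hY hξ
    rw [mul_div_cancel₀ _ hY0.ne'] at h2
    calc _ ≤ M * (1 + 2 * π * |ξ|) ^ (p - 1) * rexp (-π * (ξ / Y) ^ 2) := by
          gcongr; exact hf ξ
      _ ≤ M * (14 ^ p * Y ^ (p - 1) * (1 + |ξ / Y| ^ (p - 1))) * rexp (-π * (ξ / Y) ^ 2) := by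
          gcongr
      _ = _ := by rw [hk]; ring
  have h3 := integral_mono_of_nonneg (Eventually.of_forall fun ξ => by positivity)
    ((hkint.comp_div hY0.ne').const_mul (M * Y ^ (p - 1))) h1
  refine h3.trans (le_of_eq ?_)
  rw [integral_const_mul, Measure.integral_comp_div, abs_of_pos hY0, smul_eq_mul,
    show p = (p - 1) + 1 by ring, rpow_add_one hY0.ne']
  ring_nf

/-- Gaussian mollification bounded through the Fourier transform. -/
theorem norm_integral_gaussian_mul_le {b : ℝ → ℂ} (hb : Integrable b) {Y : ℝ} (hY : 0 < Y)
    (u : ℝ) : ‖∫ v, (rexp (-π * v ^ 2) : ℂ) * b (u + v / Y)‖ ≤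
      ∫ ξ, ‖𝓕 b ξ‖ * rexp (-π * (ξ / Y) ^ 2) := by
  set c : ℝ := (Y ^ 2)⁻¹ with hc
  have hc0 : 0 < c := by positivity
  have hcre : 0 < (c : ℂ).re := by simpa using hc0
  -- A modulated Gaussian whose Fourier transform is the mollifier of width about 1/Y centred at u.
  -- The formula ∫ 𝓕b · g = ∫ b · 𝓕g then moves the mollification to the frequency side.
  let g : ℝ → ℂ := fun ξ => Complex.exp (-π * c * ξ ^ 2 + 2 * π * (Complex.I * u) * ξ)
  have hg : Integrable g := by
    have := integrable_cexp_quadratic (b := π * c) (by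
      rw [← Complex.ofReal_mul, Complex.ofReal_re]; positivity) (2 * π * (Complex.I * u)) 0
    refine this.congr (Eventually.of_forall fun ξ => ?_)
    simp only [g, add_zero]
    congr 2; ring
  have hFg : ∀ w, 𝓕 g w = ((Y * rexp (-π * (Y * (w - u)) ^ 2) : ℝ) : ℂ) := by
    intro w
    have h1 := congrFun (fourier_gaussian_pi' hcre (Complex.I * u)) w
    have h2 : (c : ℂ) ^ (1 / 2 : ℂ) = ((Y⁻¹ : ℝ) : ℂ) := by
      have : (c ^ (1 / 2 : ℝ) : ℝ) = Y⁻¹ := by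
        rw [hc, ← Real.sqrt_eq_rpow, Real.sqrt_inv, Real.sqrt_sq hY.le]
      rw [← this, Complex.ofReal_cpow hc0.le]
      push_cast; rfl
    rw [h1, h2]
    push_cast
    rw [one_div, inv_inv]
    congr 2
    rw [← mul_assoc, Complex.I_mul_I, hc]
    push_cast
    field_simp
    ring
  have h1 : ∫ ξ, 𝓕 b ξ * g ξ = ∫ w, b w * 𝓕 g w := by
    simpa using! VectorFourier.integral_fourierIntegral_smul_eq_flip (L := innerₗ ℝ)
      Real.continuous_fourierChar continuous_inner hb hg
  have h2 : ∫ w, b w * 𝓕 g w = ∫ v, (rexp (-π * v ^ 2) : ℂ) * b (u + v / Y) := by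
    have h3 := Measure.integral_comp_mul_left
      (fun v => (rexp (-π * v ^ 2) : ℂ) * b (u + v / Y)) Y
    rw [abs_of_pos (inv_pos.mpr hY)] at h3
    have h4 : ∫ v, (rexp (-π * v ^ 2) : ℂ) * b (u + v / Y) =
        Y • ∫ x, (rexp (-π * (Y * x) ^ 2) : ℂ) * b (u + Y * x / Y) := by
      rw [h3, smul_smul, mul_inv_cancel₀ hY.ne', one_smul]
    rw [h4, ← integral_add_left_eq_self _ u, ← integral_smul]
    refine integral_congr_ae (Eventually.of_forall fun w => ?_)
    simp only
    rw [hFg, mul_div_cancel_left₀ _ hY.ne', add_sub_cancel_left, Complex.real_smul]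
    push_cast
    ring
  rw [← h2, ← h1]
  refine (norm_integral_le_integral_norm _).trans (le_of_eq ?_)
  refine integral_congr_ae (Eventually.of_forall fun ξ => ?_)
  simp only [g, norm_mul, Complex.norm_exp]
  congr 2
  have : (-π * c * ξ ^ 2 + 2 * π * (Complex.I * u) * ξ : ℂ) =
      ((-π * c * ξ ^ 2 : ℝ) : ℂ) + ((2 * π * u * ξ : ℝ) : ℂ) * Complex.I := by push_cast; ring
  rw [this, Complex.add_re, Complex.ofReal_re, Complex.re_ofReal_mul, Complex.I_re, mul_zero,
    add_zero, hc]
  field_simp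

end GaussianQuadratic

/-! ### The character sum in logarithmic coordinates -/

namespace GaussianQuadratic

open Real Filter Topology MeasureTheory FourierTransform

/-- The normalised character sum in logarithmic coordinates. -/
noncomputable def logCharSum (D : GaussianInt) (w : ℝ) : ℂ :=
  ((rexp (w / 2) * charSum D (rexp (-w)) : ℝ) : ℂ)

theorem measurable_logCharSum (D : GaussianInt) : Measurable (logCharSum D) := by
  refine Complex.measurable_ofReal.comp (Measurable.mul (by fun_prop) ?_)
  exact (measurable_charSum D).comp (by fun_prop)

/-- For w > 0 the sum is empty. For w ≤ 0 the bound x^(15/32) with x = e^(-w) leaves e^(w/32),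
integrable precisely because 15/32 < 1/2. -/
theorem IsFundamentalDiscriminant.integrable_logCharSum {D : GaussianInt}
    (hD : IsFundamentalDiscriminant D) : Integrable (logCharSum D) := by
  obtain ⟨C, -, h⟩ := exists_abs_sum_quadChar_le
  set K := C * (charModulus D : ℝ) ^ 2
  have h1 : Integrable ((Set.Iic (0 : ℝ)).indicator fun w => K * rexp (1 / 32 * w)) :=
    (integrable_indicator_iff measurableSet_Iic).mpr
      ((integrableOn_exp_mul_Iic (by norm_num) 0).const_mul _)
  refine h1.mono' (measurable_logCharSum D).aestronglyMeasurable
    (Eventually.of_forall fun w => ?_)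
  rw [logCharSum, Complex.norm_real, norm_mul, Real.norm_of_nonneg (Real.exp_pos _).le]
  by_cases hw : w ≤ 0
  · rw [Set.indicator_of_mem (Set.mem_Iic.mpr hw)]
    have h2 := h D hD (rexp (-w)) (Real.one_le_exp (by linarith))
    rw [← Real.exp_mul] at h2
    calc rexp (w / 2) * ‖charSum D (rexp (-w))‖
        ≤ rexp (w / 2) * (K * rexp (-w * (15 / 32))) := by gcongr; exact h2
      _ = K * (rexp (w / 2) * rexp (-w * (15 / 32))) := by ring
      _ = _ := by rw [← Real.exp_add]; ring_nf
  · rw [Set.indicator_of_notMem (s := Set.Iic (0 : ℝ)) hw, charSum_of_lt_one D, norm_zero, mul_zero]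
    rw [Real.exp_lt_one_iff]
    linarith

/-- On Re s = 1/2 the Mellin transform is a Fourier transform in w = -log x, with t = -2πξ. -/
theorem IsFundamentalDiscriminant.fourier_logCharSum {D : GaussianInt}
    (hD : IsFundamentalDiscriminant D) (ξ : ℝ) :
    quadLFunction D (1 / 2 + ((-(2 * π * ξ) : ℝ) : ℂ) * Complex.I) =
      (1 / 2 + ((-(2 * π * ξ) : ℝ) : ℂ) * Complex.I) * 𝓕 (logCharSum D) ξ := by
  have hre : (1 / 2 + ((-(2 * π * ξ) : ℝ) : ℂ) * Complex.I).re = 1 / 2 := by simp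
  have him : (1 / 2 + ((-(2 * π * ξ) : ℝ) : ℂ) * Complex.I).im = -(2 * π * ξ) := by simp
  rw [hD.quadLFunction_eq_mellin (by rw [hre]; norm_num), mellin_eq_fourier, Complex.neg_re,
    Complex.neg_im, hre, him, neg_neg, neg_neg, mul_div_cancel_left₀ _ (by positivity)]
  congr 1
  refine congrArg (fun f : ℝ → ℂ => 𝓕 f ξ) (funext fun w => ?_)
  rw [logCharSum, Complex.real_smul]
  push_cast
  congr 2
  ring

/-- Dividing by s gains one power of 1 + |t|, since |s| is at least both 1/2 and |t|. -/
theorem IsFundamentalDiscriminant.norm_fourier_logCharSum_le {D : GaussianInt}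
    (hD : IsFundamentalDiscriminant D) {M p : ℝ}
    (h : ∀ t : ℝ, ‖quadLFunction D (1 / 2 + t * Complex.I)‖ ≤ M * (1 + |t|) ^ p) (ξ : ℝ) :
    ‖𝓕 (logCharSum D) ξ‖ ≤ 4 * M * (1 + 2 * π * |ξ|) ^ (p - 1) := by
  set s : ℂ := 1 / 2 + ((-(2 * π * ξ) : ℝ) : ℂ) * Complex.I with hs
  have h1 := h (-(2 * π * ξ))
  rw [hD.fourier_logCharSum, norm_mul, abs_neg, abs_mul, abs_of_pos (by positivity : 0 < 2 * π)]
    at h1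
  have h2 : 1 + 2 * π * |ξ| ≤ 4 * ‖s‖ := by
    have hre : |s.re| = 1 / 2 := by rw [hs]; norm_num
    have him : |s.im| = 2 * π * |ξ| := by
      have : s.im = -(2 * π * ξ) := by simp [hs]
      rw [this, abs_neg, abs_mul, abs_of_pos (by positivity : 0 < 2 * π)]
    have h3 := Complex.abs_re_le_norm s
    have h4 := Complex.abs_im_le_norm s
    rw [hre] at h3
    rw [him] at h4
    linarith
  have h5 : 0 < 1 + 2 * π * |ξ| := by positivity
  rw [rpow_sub_one h5.ne', ← mul_div_assoc, le_div_iff₀ h5]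
  calc ‖𝓕 (logCharSum D) ξ‖ * (1 + 2 * π * |ξ|) ≤ ‖𝓕 (logCharSum D) ξ‖ * (4 * ‖s‖) := by gcongr
    _ = 4 * (‖s‖ * ‖𝓕 (logCharSum D) ξ‖) := by ring
    _ ≤ 4 * (M * (1 + 2 * π * |ξ|) ^ p) := by gcongr
    _ = _ := by ring

theorem abs_exp_sub_one_le_mul (v : ℝ) : |rexp v - 1| ≤ |v| * rexp |v| := by
  have h1 := Real.add_one_le_exp v
  have h2 := Real.add_one_le_exp (-v)
  have h3 : rexp v * rexp (-v) = 1 := by rw [← Real.exp_add]; simp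
  have h4 := Real.exp_pos v
  rcases le_or_gt 0 v with hv | hv
  · rw [abs_of_nonneg (by linarith), abs_of_nonneg hv]
    nlinarith
  · have h5 : 1 ≤ rexp |v| := Real.one_le_exp (abs_nonneg v)
    have h6 : rexp v < 1 := Real.exp_lt_one_iff.mpr hv
    rw [abs_of_nonpos (by linarith), abs_of_neg hv] at *
    nlinarith

theorem abs_charSum_sub_le_card (D : GaussianInt) {x y : ℝ} (h : x ≤ y) :
    |charSum D y - charSum D x| ≤ (normLE y).card - (normLE x).card := by
  have hsub := normLE_mono h
  have h1 : charSum D y - charSum D x = ∑ n ∈ normLE y \ normLE x, (quadChar D n : ℝ) := by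
    rw [charSum, charSum, ← Finset.sum_sdiff hsub]; ring
  rw [h1]
  calc _ ≤ ∑ n ∈ normLE y \ normLE x, |(quadChar D n : ℝ)| := Finset.abs_sum_le_sum_abs _ _
    _ ≤ ∑ _n ∈ normLE y \ normLE x, (1 : ℝ) :=
        Finset.sum_le_sum fun _ _ => by exact_mod_cast abs_quadChar_le_one D _
    _ = _ := by
        rw [Finset.sum_const, nsmul_eq_mul, mul_one, Finset.card_sdiff_of_subset hsub,
          Nat.cast_sub (Finset.card_le_card hsub)]

/-- Variation of the character sum under a change of scale, ignoring cancellation. -/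
theorem exists_abs_charSum_sub_scaled_le : ∃ C : ℝ, 0 < C ∧ ∀ (D : GaussianInt) (x h : ℝ), 1 ≤ x →
    |charSum D x| ≤ C * x ∧
    |charSum D x - rexp (h / 2) * charSum D (x * rexp (-h))| ≤
      C * (x * |h| + √x) * rexp (2 * |h|) := by
  obtain ⟨C, hC, hcard⟩ := exists_abs_card_normLE_sub_le
  have hcard' : ∀ M x : ℝ, 1 ≤ M → 0 ≤ x → x ≤ M → ((normLE x).card : ℝ) ≤ (π + C) * M := by
    intro M x hM hx hxM
    have h1 := (abs_le.mp (hcard M x hM hx hxM)).2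
    have h2 : M ^ (15 / 32 : ℝ) ≤ M := by
      simpa using rpow_le_rpow_of_exponent_le hM (by norm_num : (15 / 32 : ℝ) ≤ 1)
    have h3 : π * x ≤ π * M := by gcongr
    have h4 : C * M ^ (15 / 32 : ℝ) ≤ C * M := by gcongr
    linarith
  have hdiff : ∀ (D : GaussianInt) (M x y : ℝ), 1 ≤ M → 0 ≤ x → x ≤ M → 0 ≤ y → y ≤ M →
      |charSum D x - charSum D y| ≤ π * |x - y| + 2 * C * M ^ (15 / 32 : ℝ) := by
    intro D M x y hM hx hxM hy hyM
    have h1 := abs_le.mp (hcard M x hM hx hxM)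
    have h2 := abs_le.mp (hcard M y hM hy hyM)
    rcases le_total x y with hxy | hxy
    · have h3 := abs_charSum_sub_le_card D hxy
      rw [abs_sub_comm, abs_sub_comm x, abs_of_nonneg (sub_nonneg.mpr hxy)]
      linarith
    · have h3 := abs_charSum_sub_le_card D hxy
      rw [abs_of_nonneg (sub_nonneg.mpr hxy)]
      linarith
  refine ⟨2 * π + 2 * C, by positivity, fun D x h hx => ⟨?_, ?_⟩⟩
  · have h1 := (abs_charSum_le_card D x).trans (hcard' x x hx (by linarith) le_rfl)
    have h2 : 0 ≤ (π + C) * x := by positivity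
    linarith
  have hx0 : 0 < x := by linarith
  set E := rexp |h| with hE
  have hE1 : 1 ≤ E := Real.one_le_exp (abs_nonneg h)
  have hE2 : rexp (2 * |h|) = E * E := by rw [hE, ← Real.exp_add, two_mul]
  have hEh : rexp (-h) ≤ E := Real.exp_le_exp.mpr (neg_le_abs h)
  set M := x * E with hM
  have hM1 : 1 ≤ M := one_le_mul_of_one_le_of_one_le hx hE1
  have hxM : x ≤ M := le_mul_of_one_le_right hx0.le hE1
  set y := x * rexp (-h) with hy
  have hy0 : 0 ≤ y := by positivity
  have hyM : y ≤ M := by rw [hy, hM]; gcongr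
  have h1 := hdiff D M x y hM1 hx0.le hxM hy0 hyM
  have h2 : |x - y| ≤ x * |h| * E := by
    have : x - y = -(x * (rexp (-h) - 1)) := by rw [hy]; ring
    rw [this, abs_neg, abs_mul, abs_of_pos hx0, mul_assoc]
    have h3 := abs_exp_sub_one_le_mul (-h)
    rw [abs_neg] at h3
    gcongr
  -- The circle problem error is below √x, so thin annuli cost at most √x beyond their area.
  have h3 : M ^ (15 / 32 : ℝ) ≤ √x * E := by
    rw [hM, mul_rpow hx0.le (by positivity), Real.sqrt_eq_rpow]
    have h4 : E ^ (15 / 32 : ℝ) ≤ E := by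
      simpa using rpow_le_rpow_of_exponent_le hE1 (by norm_num : (15 / 32 : ℝ) ≤ 1)
    have h5 : x ^ (15 / 32 : ℝ) ≤ x ^ (1 / 2 : ℝ) :=
      rpow_le_rpow_of_exponent_le hx (by norm_num)
    gcongr
  have h4 : |charSum D y| ≤ (π + C) * (x * E) :=
    (abs_charSum_le_card D y).trans (hcard' M y hM1 hy0 hyM)
  have h5 : |rexp (h / 2) - 1| ≤ |h| * E := by
    have h6 := abs_exp_sub_one_le_mul (h / 2)
    rw [abs_div, abs_two] at h6
    have h7 : |h| / 2 ≤ |h| := by linarith [abs_nonneg h]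
    refine h6.trans ?_
    have h8 : rexp (|h| / 2) ≤ E := Real.exp_le_exp.mpr h7
    gcongr
  have e : charSum D x - rexp (h / 2) * charSum D y =
      (charSum D x - charSum D y) - (rexp (h / 2) - 1) * charSum D y := by ring
  have hEE : E ≤ E * E := le_mul_of_one_le_left (by positivity) hE1
  rw [e, hE2]
  calc _ ≤ |charSum D x - charSum D y| + |(rexp (h / 2) - 1) * charSum D y| := abs_sub _ _
    _ ≤ (π * (x * |h| * E) + 2 * C * (√x * E)) + |h| * E * ((π + C) * (x * E)) := by
        rw [abs_mul]
        refine add_le_add (h1.trans ?_) ?_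
        · gcongr
        · gcongr
    _ = (π * (x * |h|) + 2 * C * √x) * E + (π + C) * (x * |h|) * (E * E) := by ring
    _ ≤ (π * (x * |h|) + 2 * C * √x) * (E * E) + (π + C) * (x * |h|) * (E * E) := by
        gcongr
    _ = (2 * π * (x * |h|) + 2 * C * √x + C * (x * |h|)) * (E * E) := by ring
    _ ≤ _ := by
        gcongr
        have h9 : 0 ≤ x * |h| := by positivity
        have h10 : 0 ≤ √x := Real.sqrt_nonneg x
        nlinarith [mul_nonneg hC.le h9, mul_nonneg pi_pos.le h10]

end GaussianQuadratic

/-! ### Removing the mollifier and choosing its width -/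

namespace GaussianQuadratic

open Real Filter Topology MeasureTheory FourierTransform

theorem abs_mul_exp_le (v : ℝ) :
    (1 + |v|) * rexp (2 * |v|) * rexp (-π * v ^ 2) ≤ rexp 3 * rexp (-1 * v ^ 2) := by
  have h1 : 1 + |v| ≤ rexp |v| := by linarith [Real.add_one_le_exp |v|]
  calc _ ≤ rexp |v| * rexp (2 * |v|) * rexp (-π * v ^ 2) := by gcongr
    _ = rexp (|v| + 2 * |v| + -π * v ^ 2) := by rw [Real.exp_add, Real.exp_add]
    _ ≤ rexp (3 + -1 * v ^ 2) := by
        apply Real.exp_le_exp.mpr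
        have h2 : 3 * v ^ 2 ≤ π * v ^ 2 := by gcongr; exact pi_gt_three.le
        have h3 := sq_abs v
        nlinarith [sq_nonneg (|v| - 1)]
    _ = _ := Real.exp_add _ _

/-- Comparison of the character sum with its mollification. -/
theorem exists_abs_charSum_sub_mollified_le : ∃ C : ℝ, 0 < C ∧ ∀ D : GaussianInt,
    IsFundamentalDiscriminant D → ∀ x Y : ℝ, 1 ≤ x → 1 ≤ Y →
      |charSum D x| ≤ C * (x / Y + √x) +
        √x * ‖∫ v, (rexp (-π * v ^ 2) : ℂ) * logCharSum D (-log x + v / Y)‖ := by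
  obtain ⟨C, hC, hvar⟩ := exists_abs_charSum_sub_scaled_le
  set K : ℝ := ∫ v : ℝ, rexp 3 * rexp (-1 * v ^ 2) with hK
  have hKint : Integrable fun v : ℝ => rexp 3 * rexp (-1 * v ^ 2) :=
    (integrable_exp_neg_mul_sq one_pos).const_mul _
  have hK0 : 0 ≤ K := integral_nonneg fun v => by positivity
  refine ⟨C * K + 1, by positivity, fun D hD x Y hx hY => ?_⟩
  have hx0 : 0 < x := by linarith
  have hY0 : 0 < Y := by linarith
  have hgauss : Integrable fun v : ℝ => rexp (-π * v ^ 2) := integrable_exp_neg_mul_sq pi_pos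
  have hone : ∫ v : ℝ, rexp (-π * v ^ 2) = 1 := by
    rw [integral_gaussian, div_self pi_ne_zero, Real.sqrt_one]
  have hlog : ∀ v, (√x : ℂ) * logCharSum D (-log x + v / Y) =
      ((rexp (v / Y / 2) * charSum D (x * rexp (-(v / Y))) : ℝ) : ℂ) := by
    intro v
    rw [logCharSum, ← Complex.ofReal_mul]
    congr 1
    have e1 : rexp (-(-log x + v / Y)) = x * rexp (-(v / Y)) := by
      rw [neg_add, neg_neg, Real.exp_add, Real.exp_log hx0]
    have e2 : √x * rexp ((-log x + v / Y) / 2) = rexp (v / Y / 2) := by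
      rw [Real.sqrt_eq_rpow, rpow_def_of_pos hx0, ← Real.exp_add]
      congr 1; ring
    rw [e1, ← mul_assoc, e2]
  have hint : Integrable fun v : ℝ => (rexp (-π * v ^ 2) : ℂ) * logCharSum D (-log x + v / Y) := by
    have h1 := (hD.integrable_logCharSum.comp_add_left (-log x)).comp_div hY0.ne'
    refine h1.bdd_mul (c := 1) (by fun_prop) (Eventually.of_forall fun v => ?_)
    rw [Complex.norm_real, Real.norm_of_nonneg (Real.exp_pos _).le, Real.exp_le_one_iff]
    nlinarith [pi_pos, sq_nonneg v]
  -- The Gaussian has mass 1, so S(x) can be taken under the integral and compared with the sums at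
  -- nearby scales.
  have hmain : (charSum D x : ℂ) -
      √x * ∫ v, (rexp (-π * v ^ 2) : ℂ) * logCharSum D (-log x + v / Y) =
      ∫ v, (rexp (-π * v ^ 2) : ℂ) * ((charSum D x -
        rexp (v / Y / 2) * charSum D (x * rexp (-(v / Y))) : ℝ) : ℂ) := by
    have e1 : (charSum D x : ℂ) = ∫ v : ℝ, (rexp (-π * v ^ 2) : ℂ) * (charSum D x : ℂ) := by
      rw [integral_mul_const, integral_complex_ofReal, hone, Complex.ofReal_one, one_mul]
    have e2 : Integrable fun v : ℝ => (rexp (-π * v ^ 2) : ℂ) * (charSum D x : ℂ) :=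
      hgauss.ofReal.mul_const _
    rw [e1, ← integral_const_mul, ← integral_sub e2 (hint.const_mul _)]
    refine integral_congr_ae (Eventually.of_forall fun v => ?_)
    simp only
    rw [mul_left_comm, hlog]
    push_cast
    ring
  have hbound : ‖∫ v, (rexp (-π * v ^ 2) : ℂ) * ((charSum D x -
      rexp (v / Y / 2) * charSum D (x * rexp (-(v / Y))) : ℝ) : ℂ)‖ ≤
      ∫ v, C * (x / Y + √x) * (rexp 3 * rexp (-1 * v ^ 2)) := by
    refine norm_integral_le_of_norm_le (hKint.const_mul _) (Eventually.of_forall fun v => ?_)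
    rw [norm_mul, Complex.norm_real, Complex.norm_real, Real.norm_of_nonneg (Real.exp_pos _).le,
      Real.norm_eq_abs]
    have h1 := (hvar D x (v / Y) hx).2
    have h2 : |v / Y| = |v| / Y := by rw [abs_div, abs_of_pos hY0]
    rw [h2] at h1
    have h3 : |v| / Y ≤ |v| := div_le_self (abs_nonneg v) hY
    have h4 : x * (|v| / Y) + √x ≤ (x / Y + √x) * (1 + |v|) := by
      have h5 : 0 ≤ x / Y := by positivity
      have h6 : 0 ≤ √x * |v| := by positivity
      have h7 : x * (|v| / Y) = x / Y * |v| := by ring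
      rw [h7]
      nlinarith
    calc rexp (-π * v ^ 2) * |charSum D x - rexp (v / Y / 2) * charSum D (x * rexp (-(v / Y)))|
        ≤ rexp (-π * v ^ 2) * (C * ((x / Y + √x) * (1 + |v|)) * rexp (2 * |v|)) := by
          gcongr
          refine h1.trans ?_
          gcongr
      _ = C * (x / Y + √x) * ((1 + |v|) * rexp (2 * |v|) * rexp (-π * v ^ 2)) := by ring
      _ ≤ _ := mul_le_mul_of_nonneg_left (abs_mul_exp_le v) (by positivity)
  rw [← hmain, integral_const_mul, ← hK] at hbound
  have h8 := norm_sub_norm_le (charSum D x : ℂ)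
    (√x * ∫ v, (rexp (-π * v ^ 2) : ℂ) * logCharSum D (-log x + v / Y))
  rw [norm_mul, Complex.norm_real, Complex.norm_real, Real.norm_eq_abs,
    Real.norm_of_nonneg (Real.sqrt_nonneg x)] at h8
  have h9 : 0 ≤ x / Y + √x := by positivity
  linarith

/-- The character sum bounded in terms of a free smoothing parameter. -/
theorem HybridSubconvexBound.exists_abs_charSum_le {ϑ ϑ' : ℝ} (hL : HybridSubconvexBound ϑ ϑ')
    (hϑ' : 0 ≤ ϑ') {ε : ℝ} (hε : 0 < ε) : ∃ C : ℝ, 0 < C ∧ ∀ D : GaussianInt,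
      IsFundamentalDiscriminant D → ∀ x Y : ℝ, 1 ≤ x → 1 ≤ Y →
        |charSum D x| ≤ C * (x / Y + √x) +
          C * (√x * ((D.norm : ℤ) : ℝ) ^ (ϑ + ε) * Y ^ (ϑ' + ε)) := by
  obtain ⟨C₁, hC₁, h₁⟩ := exists_abs_charSum_sub_mollified_le
  obtain ⟨C₂, hC₂, h₂⟩ := hL ε hε
  -- The added ε keeps the exponent p positive even when ϑ' = 0.
  obtain ⟨K, hK, h₃⟩ := exists_integral_gaussian_cutoff_le (p := ϑ' + ε) (by linarith)
  refine ⟨C₁ + 4 * C₂ * K, by positivity, fun D hD x Y hx hY => ?_⟩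
  have hx0 : 0 < x := by linarith
  have hY0 : 0 < Y := by linarith
  have hN : 0 ≤ ((D.norm : ℤ) : ℝ) := by exact_mod_cast GaussianInt.norm_nonneg D
  set N := ((D.norm : ℤ) : ℝ)
  have h4 := norm_integral_gaussian_mul_le hD.integrable_logCharSum hY0 (-log x)
  have h5 := h₃ Y (4 * (C₂ * N ^ (ϑ + ε))) (𝓕 (logCharSum D)) hY (by positivity)
    (hD.norm_fourier_logCharSum_le (h₂ D hD))
  have h6 := mul_le_mul_of_nonneg_left (h4.trans h5) (Real.sqrt_nonneg x)
  have h7 : 0 ≤ 4 * C₂ * K * (x / Y + √x) := by positivity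
  have h8 : 0 ≤ C₁ * (√x * N ^ (ϑ + ε) * Y ^ (ϑ' + ε)) := by positivity
  linarith [h₁ D hD x Y hx hY]

theorem abs_sum_normIoc_le (D : GaussianInt) {x y : ℝ} (h : x ≤ y) :
    |∑ n ∈ normIoc x y, (quadChar D n : ℝ)| ≤ |charSum D y| + |charSum D x| := by
  have h1 : charSum D y = ∑ n ∈ normIoc x y, (quadChar D n : ℝ) + charSum D x := by
    rw [charSum, charSum, normIoc, ← Finset.sum_filter_add_sum_filter_not (normLE y)
      (fun n => x < ((n.norm : ℤ) : ℝ))]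
    congr 1
    refine Finset.sum_congr ?_ fun _ _ => rfl
    ext n
    simp only [Finset.mem_filter, mem_normLE, not_lt]
    exact ⟨fun h => h.2, fun h' => ⟨h'.trans h, h'⟩⟩
  rw [eq_sub_of_add_eq h1.symm]
  exact abs_sub _ _

/-- The optimised bound for the character sum. -/
theorem HybridSubconvexBound.exists_abs_charSum_le_rpow {ϑ ϑ' : ℝ}
    (hL : HybridSubconvexBound ϑ ϑ') (hϑ : 0 ≤ ϑ) (hϑ' : 0 ≤ ϑ') {ε : ℝ} (hε : 0 < ε) :
    ∃ C : ℝ, 0 < C ∧ ∀ D : GaussianInt, IsFundamentalDiscriminant D → ∀ x : ℝ, 1 ≤ x →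
      |charSum D x| ≤ C * x ^ (1 - 1 / (2 * (1 + ϑ'))) *
        ((D.norm : ℤ) : ℝ) ^ (ϑ / (1 + ϑ') + ε) := by
  obtain ⟨C₁, hC₁, h₁⟩ := exists_abs_sum_quadChar_le
  obtain ⟨C₂, hC₂, h₂⟩ := exists_abs_charSum_sub_scaled_le
  -- In the range Y ≤ x < N^64 the losses are N^(ε/65) and Y^(ε/65) ≤ N^(64ε/65), in total N^ε.
  obtain ⟨C₃, hC₃, h₃⟩ := hL.exists_abs_charSum_le hϑ' (ε := ε / 65) (by positivity)
  refine ⟨64 * C₁ + C₂ + 3 * C₃, by positivity, fun D hD x hx => ?_⟩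
  have hN : 1 ≤ ((D.norm : ℤ) : ℝ) := norm_pos_of_ne_zero hD.ne_zero
  have hQ : (charModulus D : ℝ) = 8 * ((D.norm : ℤ) : ℝ) := by
    have h4 : ((charModulus D : ℕ) : ℤ) = 8 * D.norm := by
      rw [charModulus, Nat.cast_mul, Int.natCast_natAbs,
        abs_of_nonneg (GaussianInt.norm_nonneg D)]
      norm_num
    exact_mod_cast h4
  set N := ((D.norm : ℤ) : ℝ) with hNdef
  have hx0 : 0 < x := by linarith
  have hN0 : 0 < N := by linarith
  have hr0 : 0 < 1 + ϑ' := by linarith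
  set α := 1 - 1 / (2 * (1 + ϑ')) with hα
  set β := ϑ / (1 + ϑ') with hβ
  have hβ0 : 0 ≤ β := by positivity
  have hα2 : 1 / 2 ≤ α := by
    have : 1 / (2 * (1 + ϑ')) ≤ 1 / 2 := by
      apply one_div_le_one_div_of_le <;> linarith
    linarith
  set B := x ^ α * N ^ (β + ε) with hB
  have hB0 : 0 < B := by positivity
  rw [mul_assoc]
  suffices h : |charSum D x| ≤ 64 * C₁ * B ∨ |charSum D x| ≤ C₂ * B ∨
      |charSum D x| ≤ 3 * C₃ * B by
    have e1 : 0 < C₁ * B := by positivity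
    have e2 : 0 < C₂ * B := by positivity
    have e3 : 0 < C₃ * B := by positivity
    rcases h with h | h | h <;> linarith
  have hNβ : 1 ≤ N ^ (β + ε) := one_le_rpow hN (by linarith)
  have hNε : 1 ≤ N ^ ε := one_le_rpow hN hε.le
  -- The threshold is where N² ≤ x^(1/32), so that N² x^(15/32) ≤ √x.
  rcases le_or_gt (N ^ (64 : ℝ)) x with hxN | hxN
  · -- long sums: periodicity
    left
    have h4 : N ^ 2 ≤ x ^ (1 / 32 : ℝ) := by
      calc N ^ 2 = (N ^ (64 : ℝ)) ^ (1 / 32 : ℝ) := by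
            rw [← rpow_mul hN0.le, ← rpow_natCast]; norm_num
        _ ≤ _ := by gcongr
    have h5 : x ^ (1 / 2 : ℝ) ≤ B :=
      (rpow_le_rpow_of_exponent_le hx hα2).trans (le_mul_of_one_le_right (by positivity) hNβ)
    calc |charSum D x| ≤ C₁ * (8 * N) ^ 2 * x ^ (15 / 32 : ℝ) := by
          rw [← hQ]; exact h₁ D hD x hx
      _ = 64 * C₁ * (N ^ 2 * x ^ (15 / 32 : ℝ)) := by ring
      _ ≤ 64 * C₁ * (x ^ (1 / 32 : ℝ) * x ^ (15 / 32 : ℝ)) := by gcongr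
      _ = 64 * C₁ * x ^ (1 / 2 : ℝ) := by rw [← rpow_add hx0]; norm_num
      _ ≤ _ := by gcongr
  right
  -- The solution of x/Y = √x N^ϑ Y^ϑ'.
  set Y := x ^ (1 / (2 * (1 + ϑ'))) * N ^ (-β) with hY
  have hY0 : 0 < Y := by positivity
  have hxY : x / Y = x ^ α * N ^ β := by
    rw [hY, hα, rpow_sub hx0, rpow_one, rpow_neg hN0.le]
    field_simp
  have hNB : x ^ α * N ^ β ≤ B := by
    rw [hB]
    gcongr
    linarith
  rcases lt_or_ge Y 1 with hY1 | hY1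
  · -- short sums: trivial bound
    left
    have h4 : x ≤ x / Y := le_div_self hx0.le hY0 hY1.le
    calc |charSum D x| ≤ C₂ * x := (h₂ D x 0 hx).1
      _ ≤ C₂ * B := by gcongr; linarith
  · right
    have hYx : Y ≤ x := by
      have h5 : N ^ (-β) ≤ 1 := rpow_le_one_of_one_le_of_nonpos hN (by linarith)
      have h6 : x ^ (1 / (2 * (1 + ϑ'))) ≤ x := by
        have h7 : 1 / (2 * (1 + ϑ')) ≤ 1 := by linarith
        simpa using rpow_le_rpow_of_exponent_le hx h7
      calc Y ≤ x * 1 := by rw [hY]; gcongr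
        _ = x := mul_one x
    have h4 : √x * N ^ ϑ * Y ^ ϑ' = x ^ α * N ^ β := by
      rw [hY, mul_rpow (by positivity) (by positivity), ← rpow_mul hx0.le, ← rpow_mul hN0.le,
        Real.sqrt_eq_rpow]
      have e1 : α = 1 / 2 + 1 / (2 * (1 + ϑ')) * ϑ' := by rw [hα]; field_simp; ring
      have e2 : β = ϑ + -β * ϑ' := by rw [hβ]; field_simp; ring
      calc _ = (x ^ (1 / 2 : ℝ) * x ^ (1 / (2 * (1 + ϑ')) * ϑ')) * (N ^ ϑ * N ^ (-β * ϑ')) := by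
            ring
        _ = _ := by rw [← rpow_add hx0, ← rpow_add hN0, ← e1, ← e2]
    have h5 : √x * N ^ (ϑ + ε / 65) * Y ^ (ϑ' + ε / 65) ≤ B := by
      have h6 : Y ^ (ε / 65) ≤ N ^ (64 * (ε / 65)) := by
        rw [rpow_mul hN0.le]
        exact rpow_le_rpow hY0.le (hYx.trans hxN.le) (by positivity)
      calc _ = (√x * N ^ ϑ * Y ^ ϑ') * (N ^ (ε / 65) * Y ^ (ε / 65)) := by
            rw [rpow_add hN0, rpow_add hY0]; ring
        _ ≤ (√x * N ^ ϑ * Y ^ ϑ') * (N ^ (ε / 65) * N ^ (64 * (ε / 65))) := by gcongr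
        _ = x ^ α * N ^ β * N ^ ε := by rw [h4, ← rpow_add hN0]; ring_nf
        _ = B := by rw [hB, rpow_add hN0]; ring
    have h7 : √x ≤ B := by
      rw [Real.sqrt_eq_rpow]
      exact (rpow_le_rpow_of_exponent_le hx hα2).trans
        (le_mul_of_one_le_right (by positivity) hNβ)
    have h8 : C₃ * (x / Y + √x) ≤ C₃ * (B + B) := by
      gcongr; rw [hxY]; exact hNB
    have h9 := mul_le_mul_of_nonneg_left h5 hC₃.le
    linarith [h₃ D hD x Y hx hY1]

end GaussianQuadratic

/-! ### The exponent pair -/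

theorem mainTheorem9 (ϑ ϑ' : ℝ) (hϑ_nonneg : 0 ≤ ϑ) (hϑ_lt : ϑ < 1 / 4) (hϑ'_nonneg : 0 ≤ ϑ')
    (hL : GaussianQuadratic.HybridSubconvexBound ϑ ϑ') :
    GaussianQuadratic.IsQuadraticExponentPair (1 - 1 / (2 * (1 + ϑ'))) (ϑ / (1 + ϑ')) ∧
    ∀ ε : ℝ, 0 < ε → ∃ C : ℝ, 0 < C ∧
      ∀ D : GaussianInt, GaussianQuadratic.IsFundamentalDiscriminant D → ∀ x : ℝ, 1 ≤ x →
        |∑ n ∈ GaussianQuadratic.normLE x, ((GaussianQuadratic.quadChar D n : ℤ) : ℝ)| ≤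
          C * x ^ (1 - 1 / (2 * (1 + ϑ'))) *
            ((D.norm : ℤ) : ℝ) ^ (ϑ / (1 + ϑ') + ε) := by
  have hr : 0 < 1 + ϑ' := by linarith
  have h1 : 1 / (2 * (1 + ϑ')) ≤ 1 / 2 := by
    apply one_div_le_one_div_of_le <;> linarith
  have h2 : 0 < 1 / (2 * (1 + ϑ')) := by positivity
  refine ⟨⟨Or.inl ⟨by positivity, ?_, by linarith, by linarith⟩, fun ε hε => ?_⟩, fun ε hε =>
    hL.exists_abs_charSum_le_rpow hϑ_nonneg hϑ'_nonneg hε⟩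
  -- β ≤ 1/2 follows from ϑ < 1/4.
  · rw [div_le_iff₀ hr]; linarith
  · obtain ⟨C, hC, h⟩ := hL.exists_abs_charSum_le_rpow hϑ_nonneg hϑ'_nonneg hε
    -- The dyadic sum is S(2x) - S(x), and (2x)^α ≤ 2x^α, so the constants add up to 2C + C.
    refine ⟨3 * C, by positivity, fun D hD x hx => ?_⟩
    have hN : 0 ≤ ((D.norm : ℤ) : ℝ) := by exact_mod_cast GaussianInt.norm_nonneg D
    have h3 := h D hD x hx
    have h4 := h D hD (2 * x) (by linarith)
    have h5 : (2 * x) ^ (1 - 1 / (2 * (1 + ϑ'))) ≤ 2 * x ^ (1 - 1 / (2 * (1 + ϑ'))) := by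
      rw [Real.mul_rpow two_pos.le (by linarith)]
      gcongr
      simpa using Real.rpow_le_rpow_of_exponent_le one_le_two
        (by linarith : 1 - 1 / (2 * (1 + ϑ')) ≤ 1)
    have h6 : C * (2 * x) ^ (1 - 1 / (2 * (1 + ϑ'))) * ((D.norm : ℤ) : ℝ) ^ (ϑ / (1 + ϑ') + ε) ≤
        C * (2 * x ^ (1 - 1 / (2 * (1 + ϑ')))) * ((D.norm : ℤ) : ℝ) ^ (ϑ / (1 + ϑ') + ε) := by
      gcongr
    have h7 := GaussianQuadratic.abs_sum_normIoc_le D (x := x) (y := 2 * x) (by linarith)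
    linarith
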